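/- **Setting.** Let $L$ be a free abelian group of finite rank, let $\mu\colon L\to\mathbb C$ be a group homomorphism, and let $\|\cdot\|$ be a norm on $L\otimes_{\mathbb Z}\mathbb R$ such that for some $R>0$ one has $R\|\gamma\|\le|\mu(\gamma)|$ for all $\gamma\in L$. Let $C\subset\mathbb C$ be a finite set such that for distinct $c,c'\in C$ there is no $\gamma\in L$ with $c=c'+\mu(\gamma)$. For $e^{i\theta}\in S^1$ and $c,c'\in\mathbb C$ write $c<_\theta c'$ if $\operatorname{Re}(e^{-i\theta}(c-c'))<0$, and $c\leqslant_\theta c'$ if $c<_\theta c'$ or $c=c'$. For $I\subset S^1$ write $c\leqslant_I c'$ if $c\leqslant_\theta c'$ for all $e^{i\theta}\in I$. Regard $S^1$ as the boundary of the real oriented blow-up of $\mathbb C$ at $0$ (coordinate $z$), and consider germs along $S^1$ of functions on $\mathbb C\setminus\{0\}$. Let $\mathscr A^{\leqslant c}=\exp(c/z)\,\mathscr A^{\leqslant 0}$, where $\mathscr A^{\leqslant 0}$ is the sheaf on $S^1$ of germs of holomorphic functions of moderate growth. Let $\mathscr A_\mu^{\leqslant 0}$ be the sheaf on $S^1$ of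 functions which locally, on connected open sets $I$, have the form $$f(z)=\sum_{\gamma\in L,\ \mu(\gamma)\leqslant_I 0}a_\gamma\exp(\mu(\gamma)/z),\qquad a_\gamma\in\mathbb C,\qquad \sum_\gamma|a_\gamma|\varrho^{\|\gamma\|}<\infty\ \text{ for some }\varrho>0,$$ and put $\mathscr A_\mu=\sum_{\gamma\in L}\exp(\mu(\gamma)/z)\mathscr A_\mu^{\leqslant0}$, a sheaf of rings, filtered by $\mathscr A_\mu^{\leqslant c}=\mathscr A_\mu\cap\mathscr A^{\leqslant c}$ $(c\in\mathbb C)$. It contains the constants and the functions $u^\gamma=\exp(\mu(\gamma)/z)$, so it is an algebra over the group algebra $\mathbb C[L]$. **Filtered modules.** A filtered $\mathscr A_\mu$-module is a sheaf $\mathscr L$ of $\mathscr A_\mu$-modules on $S^1$ with a family of subsheaves of $\mathscr A_\mu^{\leqslant0}$-submodules $\mathscr L_{\leqslant c}\subset\mathscr L$ $(c\in\mathbb C)$ such that $(\mathscr L_{\leqslant c})_{e^{i\theta}}\subset(\mathscr L_{\leqslant c'})_{e^{i\theta}}$ whenever $c\leqslant_\theta c'$, and $u^\gamma\mathscr L_{\leqslant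 c}=\mathscr L_{\leqslant c+\mu(\gamma)}$ for all $\gamma\in L$. Let $\mathscr L_{<c}\subset \mathscr L$ be the subsheaf with stalks $(\mathscr L_{<c})_{e^{i\theta}}=\sum_{c'<_\theta c}(\mathscr L_{\leqslant c'})_{e^{i\theta}}$, and put $\operatorname{gr}_c\mathscr L=\mathscr L_{\leqslant c}/(\mathscr L_{\leqslant c}\cap\mathscr L_{<c})$. Put $\operatorname{gr}\mathscr L=\bigoplus_{c\in\mathbb C}\operatorname{gr}_c\mathscr L$, a sheaf of $\mathbb C[L]$-modules in which $\gamma\in L$ acts by $u^\gamma\colon\operatorname{gr}_c\mathscr L\to\operatorname{gr}_{c+\mu(\gamma)}\mathscr L$. The sheaf of $\mathscr A_\mu$-modules $\mathscr A_\mu\otimes_{\mathbb C[L]}\operatorname{gr}\mathscr L$ is filtered by the subsheaves whose stalks at $e^{i\theta}$ are $\sum_{c'+c''\leqslant_\theta c}\mathscr A_\mu^{\leqslant c'}\otimes\operatorname{gr}_{c''}\mathscr L$. **The category.** $\mathrm{Be}_{C,\mu}$ is the category whose objects are the filtered $\mathscr A_\mu$-modules $(\mathscr L,\mathscr L_\leqslant)$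 such that 1. for every $c\in\mathbb C$, $\operatorname{gr}_c\mathscr L$ is a local system of finite-dimensional $\mathbb C$-vector spaces on $S^1$; 2. $\operatorname{gr}_c\mathscr L\neq0$ only if $c\in -C+\mu(L)$; 3. every point of $S^1$ has an open neighbourhood $I$ with a filtered isomorphism of sheaves of $\mathscr A_\mu$-modules $\eta\colon(\mathscr A_\mu\otimes_{\mathbb C[L]}\operatorname{gr}\mathscr L)|_I\to\mathscr L|_I$ such that $\operatorname{gr}(\eta)=\mathrm{id}$, i.e. for every local section $v$ of $\operatorname{gr}_c\mathscr L$ the element $\eta(1\otimes v)$ lies in $\mathscr L_{\leqslant c}$ and has class $v$; and whose morphisms are the $\mathscr A_\mu$-linear morphisms $\lambda\colon\mathscr L\to\mathscr L'$ with $\lambda(\mathscr L_{\leqslant c})\subset\mathscr L'_{\leqslant c}$ for all $c\in\mathbb C$. **Theorem.** The category $\mathrm{Be}_{C,\mu}$ is abelian. -/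

import Mathlib

noncomputable section

namespace BettiStokes

open CategoryTheory TopologicalSpace Opposite Filter
open scoped TensorProduct DirectSum Topology

/-- The circle `S¹` of directions `e^{iθ}`. -/
abbrev S1 : TopCat.{0} := TopCat.of Circle

/-- The relation `c <_θ c'` in the direction `x = e^{iθ}`: `Re (e^{-iθ} (c - c')) < 0`. -/
def LtAt (x : Circle) (c c' : ℂ) : Prop := ((x : ℂ)⁻¹ * (c - c')).re < 0

/-- The relation `c ≤_θ c'`: `c <_θ c'` or `c = c'`. -/
def LeAt (x : Circle) (c c' : ℂ) : Prop := LtAt x c c' ∨ c = c'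

/-- A homomorphism `μ : L → ℂ` on a lattice `L` (a free abelian group of finite rank), together with a
norm on `L ⊗ ℝ` (a seminorm that vanishes only at `0`), which satisfies the support property
`R ‖γ‖ ≤ |μ γ|` for some `R > 0`. -/
structure PeriodMap (L : Type*) [AddCommGroup L] [Module.Free ℤ L] [Module.Finite ℤ L] where
  μ : L →+ ℂ
  nrm : Seminorm ℝ (ℝ ⊗[ℤ] L)
  definite : ∀ v, nrm v = 0 → v = 0
  support : ∃ R : ℝ, 0 < R ∧ ∀ γ : L, R * nrm (1 ⊗ₜ[ℤ] γ) ≤ ‖μ γ‖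

/-- Linear maps are bounded with respect to any norm on a finite-dimensional space. -/
theorem exists_bound_of_definite {E : Type*} [AddCommGroup E] [Module ℝ E] [FiniteDimensional ℝ E]
    (p : Seminorm ℝ E) (hp : ∀ v, p v = 0 → v = 0) (f : E →ₗ[ℝ] ℂ) :
    ∃ M : ℝ, 0 < M ∧ ∀ v, ‖f v‖ ≤ M * p v := by
  let _ : Norm E := ⟨p⟩
  have core : NormedSpace.Core ℝ E :=
    { norm_nonneg := fun _ => apply_nonneg p _
      norm_smul := fun c x => map_smul_eq_mul p _ _
      norm_triangle := fun x y => map_add_le_add p _ _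
      norm_eq_zero_iff := fun x => ⟨hp x, fun h => by rw [h]; exact map_zero p⟩ }
  let _ : NormedAddCommGroup E := NormedAddCommGroup.ofCore core
  let _ : NormedSpace ℝ E := NormedSpace.ofCore core
  refine ⟨‖LinearMap.toContinuousLinearMap f‖ + 1, by positivity, fun v => ?_⟩
  have h := (LinearMap.toContinuousLinearMap f).le_opNorm v
  have h2 : 0 ≤ p v := apply_nonneg p v
  have h3 : ‖v‖ = p v := rfl
  rw [h3] at h
  have h4 : ‖f v‖ ≤ ‖LinearMap.toContinuousLinearMap f‖ * p v := h
  linarith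

/-- The filter on `ℂ` of the punctured sectorial neighbourhoods of `0` in the direction `x`: the trace on
`ℂ ∖ {0}` of the neighbourhoods of the boundary point `x` in the real oriented blow-up of `ℂ` at `0`,
i.e. `z → 0`, `z ≠ 0` and `z / |z| → x`. -/
def dirFilter (x : Circle) : Filter ℂ :=
  𝓝[≠] (0 : ℂ) ⊓ comap (fun z : ℂ => z / (‖z‖ : ℂ)) (𝓝 (x : ℂ))

variable {L : Type*} [AddCommGroup L] [Module.Free ℤ L] [Module.Finite ℤ L] (P : PeriodMap L)

namespace PeriodMap

/-- The norm of a lattice vector. -/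
def len (γ : L) : ℝ := P.nrm (1 ⊗ₜ[ℤ] γ)

/-- The function `u^γ = exp (μ(γ) / z)`. -/
def u (γ : L) (z : ℂ) : ℂ := Complex.exp (P.μ γ / z)

/-- The sum of the series `∑_γ a_γ exp (μ(γ) / z)`. -/
def expSum (a : L → ℂ) (z : ℂ) : ℂ := ∑' γ : L, a γ * P.u γ z

/-- `a` is the coefficient family of a series `∑ a_γ exp (μ(γ) / z)` over the `γ` with `μ(γ) ≤_I 0` for which
`‖f‖_{I,ϱ} = ∑ |a_γ| ϱ^{‖γ‖}` is finite for some `ϱ > 0`. -/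
structure IsCoeff (I : Opens S1) (a : L → ℂ) : Prop where
  le_zero : ∀ γ, a γ ≠ 0 → ∀ x ∈ I, LeAt x (P.μ γ) 0
  summable : ∃ ϱ : ℝ, 0 < ϱ ∧ Summable fun γ => ‖a γ‖ * ϱ ^ P.len γ

variable {P}

theorem len_nonneg (γ : L) : 0 ≤ P.len γ := apply_nonneg _ _

theorem exists_norm_le_len (P : PeriodMap L) : ∃ M : ℝ, 0 < M ∧ ∀ γ, ‖P.μ γ‖ ≤ M * P.len γ := by
  obtain ⟨M, hM, h⟩ := exists_bound_of_definite P.nrm P.definite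
    (P.μ.toIntLinearMap.liftBaseChange ℝ)
  exact ⟨M, hM, fun γ => by simpa [len] using h (1 ⊗ₜ γ)⟩

/-- An exponent which is dominated by `0` on an arc decays uniformly near each of its points. -/
theorem exists_re_le {I : Opens S1} {x : Circle} (hx : x ∈ I) : ∃ ε : ℝ, 0 < ε ∧
    ∀ m : ℂ, (∀ y ∈ I, LeAt y m 0) → ((x : ℂ)⁻¹ * m).re ≤ -ε * ‖m‖ := by
  have hc : Continuous fun t : ℝ => x * Circle.exp t := by fun_prop
  have h0 : x * Circle.exp 0 ∈ (I : Set Circle) := by simpa using hx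
  have hn : (fun t : ℝ => x * Circle.exp t) ⁻¹' (I : Set Circle) ∈ 𝓝 (0 : ℝ) :=
    hc.continuousAt.preimage_mem_nhds (I.isOpen.mem_nhds h0)
  obtain ⟨r, hr, hball⟩ := Metric.mem_nhds_iff.1 hn
  set δ : ℝ := min (r / 2) 1 with hδ
  have hδ0 : 0 < δ := by positivity
  have hδ1 : δ ≤ 1 := min_le_right _ _
  have hδr : δ < r := (min_le_left _ _).trans_lt (by linarith)
  have hsin : 0 < Real.sin δ := Real.sin_pos_of_pos_of_lt_pi hδ0 (by linarith [Real.pi_gt_three])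
  have hcos : 0 < Real.cos δ := Real.cos_pos_of_mem_Ioo ⟨by linarith [Real.pi_gt_three],
    by linarith [Real.pi_gt_three]⟩
  have hp : x * Circle.exp δ ∈ I := hball (by simp [abs_of_pos hδ0, hδr])
  have hm : x * Circle.exp (-δ) ∈ I := hball (by simp [abs_of_pos hδ0, hδr])
  refine ⟨Real.sin δ / (Real.sin δ + Real.cos δ), by positivity, fun m h => ?_⟩
  by_cases hm0 : m = 0
  · simp [hm0]
  have key : ∀ t : ℝ, x * Circle.exp t ∈ I →
      ((x : ℂ)⁻¹ * m).re * Real.cos t + ((x : ℂ)⁻¹ * m).im * Real.sin t < 0 := by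
    intro t ht
    rcases h _ ht with h1 | h1
    · have h2 : ((x * Circle.exp t : Circle) : ℂ)⁻¹ * (m - 0)
          = ((x : ℂ)⁻¹ * m) * Complex.exp (((-t : ℝ) : ℂ) * Complex.I) := by
        rw [Circle.coe_mul, Circle.coe_exp, mul_inv, ← Complex.exp_neg]
        push_cast
        ring_nf
      rw [LtAt, h2, Complex.mul_re, Complex.exp_ofReal_mul_I_re, Complex.exp_ofReal_mul_I_im,
        Real.cos_neg, Real.sin_neg] at h1
      linarith
    · exact absurd h1 hm0
  have k1 := key δ hp
  have k2 := key (-δ) hm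
  rw [Real.cos_neg, Real.sin_neg] at k2
  set w := (x : ℂ)⁻¹ * m with hw
  have hnw : ‖m‖ = ‖w‖ := by rw [hw, norm_mul, norm_inv, Circle.norm_coe]; simp
  have habs : ‖w‖ ≤ |w.re| + |w.im| := Complex.norm_le_abs_re_add_abs_im w
  have hre : w.re < 0 := by nlinarith
  rw [abs_of_neg hre] at habs
  have him : |w.im| * Real.sin δ ≤ -w.re * Real.cos δ := by
    rcases abs_cases w.im with ⟨e, _⟩ | ⟨e, _⟩ <;> rw [e] <;> nlinarith
  rw [hnw, neg_mul, div_mul_eq_mul_div, le_neg, div_le_iff₀ (by positivity)]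
  nlinarith

theorem eventually_re_le {I : Opens S1} {x : Circle} (hx : x ∈ I) : ∃ ε : ℝ, 0 < ε ∧
    ∀ᶠ z in dirFilter x, ∀ m : ℂ, (∀ y ∈ I, LeAt y m 0) → (m / z).re ≤ -ε * ‖m‖ / ‖z‖ := by
  obtain ⟨ε, hε, h⟩ := exists_re_le hx
  refine ⟨ε / 2, by positivity, ?_⟩
  have hx0 : (x : ℂ) ≠ 0 := Circle.coe_ne_zero x
  have h1 : ∀ᶠ w in 𝓝 (x : ℂ), ‖w⁻¹ - (x : ℂ)⁻¹‖ < ε / 2 := by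
    have := (continuousAt_inv₀ hx0).tendsto.sub_const ((x : ℂ)⁻¹)
    rw [sub_self] at this
    simpa using this.eventually (Metric.ball_mem_nhds (0 : ℂ) (half_pos hε))
  have h2 : ∀ᶠ z in dirFilter x, ‖(z / (‖z‖ : ℂ))⁻¹ - (x : ℂ)⁻¹‖ < ε / 2 :=
    (h1.comap _).filter_mono inf_le_right
  have h3 : ∀ᶠ z in dirFilter x, z ≠ 0 :=
    (eventually_mem_nhdsWithin (a := (0 : ℂ)) (s := {0}ᶜ)).filter_mono inf_le_left
  filter_upwards [h2, h3] with z hz hz0 m hm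
  have hzn : 0 < ‖z‖ := norm_pos_iff.2 hz0
  have e : m / z = ((‖z‖⁻¹ : ℝ) : ℂ) * ((x : ℂ)⁻¹ * m
      + ((z / (‖z‖ : ℂ))⁻¹ - (x : ℂ)⁻¹) * m) := by
    have : (‖z‖ : ℂ) ≠ 0 := by exact_mod_cast hzn.ne'
    push_cast
    field_simp
    ring
  rw [e, Complex.re_ofReal_mul, Complex.add_re]
  have h4 : (((z / (‖z‖ : ℂ))⁻¹ - (x : ℂ)⁻¹) * m).re ≤ ε / 2 * ‖m‖ := by
    refine (Complex.re_le_norm _).trans ?_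
    rw [norm_mul]
    gcongr
  have h5 := h m hm
  rw [div_eq_inv_mul (-(ε / 2) * ‖m‖) ‖z‖]
  refine mul_le_mul_of_nonneg_left ?_ (inv_nonneg.2 hzn.le)
  linarith

theorem IsCoeff.eventually_summable {I : Opens S1} {a : L → ℂ} (ha : P.IsCoeff I a)
    {x : Circle} (hx : x ∈ I) :
    ∀ᶠ z in dirFilter x, Summable fun γ => ‖a γ * P.u γ z‖ := by
  obtain ⟨ε, hε, h⟩ := eventually_re_le hx
  obtain ⟨ϱ, hϱ, hs⟩ := ha.summable
  obtain ⟨R, hR, hsupp⟩ := P.support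
  have h0 : Tendsto (fun z : ℂ => ‖z‖) (dirFilter x) (𝓝[>] 0) := by
    refine tendsto_nhdsWithin_iff.2 ⟨?_, ?_⟩
    · have : Tendsto (fun z : ℂ => ‖z‖) (𝓝 0) (𝓝 0) := by simpa using (continuous_norm (E := ℂ)).tendsto 0
      exact this.mono_left (inf_le_left.trans nhdsWithin_le_nhds)
    · have : ∀ᶠ z in dirFilter x, z ≠ 0 :=
        (eventually_mem_nhdsWithin (a := (0 : ℂ)) (s := {0}ᶜ)).filter_mono inf_le_left
      filter_upwards [this] with z hz using norm_pos_iff.2 hz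
  have h1 : ∀ᶠ z in dirFilter x, -Real.log ϱ ≤ ε * R * ‖z‖⁻¹ :=
    (((tendsto_inv_nhdsGT_zero.comp h0).const_mul_atTop (by positivity : 0 < ε * R))).eventually_ge_atTop _
  filter_upwards [h, h1] with z hz hz1
  refine Summable.of_nonneg_of_le (fun _ => norm_nonneg _) (fun γ => ?_) hs
  by_cases haγ : a γ = 0
  · simp [haγ]
  rw [norm_mul, u, Complex.norm_exp, Real.rpow_def_of_pos hϱ]
  gcongr
  refine (hz _ (ha.le_zero γ haγ)).trans ?_
  have hl := len_nonneg (P := P) γ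
  have h6 : ε * (R * P.len γ) * ‖z‖⁻¹ ≤ ε * ‖P.μ γ‖ * ‖z‖⁻¹ := by
    have := hsupp γ
    gcongr
    exact this
  have h7 := mul_le_mul_of_nonneg_right hz1 hl
  rw [div_eq_mul_inv]
  nlinarith

/-- The coefficients of a product of two exponential series. -/
def conv (a b : L → ℂ) (γ : L) : ℂ := ∑' β : L, a β * b (γ - β)

theorem exists_len_add_le {I : Opens S1} {x : Circle} (hx : x ∈ I) (P : PeriodMap L) :
    ∃ κ : ℝ, 0 < κ ∧ ∀ β γ : L, (∀ y ∈ I, LeAt y (P.μ β) 0) → (∀ y ∈ I, LeAt y (P.μ γ) 0) →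
      P.len β + P.len γ ≤ κ * P.len (β + γ) := by
  obtain ⟨ε, hε, h⟩ := exists_re_le hx
  obtain ⟨R, hR, hsupp⟩ := P.support
  obtain ⟨M, hM, hbd⟩ := exists_norm_le_len P
  refine ⟨M / (R * ε), by positivity, fun β γ hβ hγ => ?_⟩
  have h1 := h _ hβ
  have h2 := h _ hγ
  have h3 : -((x : ℂ)⁻¹ * (P.μ β + P.μ γ)).re ≤ ‖P.μ (β + γ)‖ := by
    rw [map_add]
    refine (neg_le_abs _).trans ((Complex.abs_re_le_norm _).trans ?_)
    rw [norm_mul, norm_inv, Circle.norm_coe]; simp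
  rw [mul_add, Complex.add_re] at h3
  have h4 := hbd (β + γ)
  have h5 : R * P.len β ≤ _ := hsupp β
  have h6 : R * P.len γ ≤ _ := hsupp γ
  rw [div_mul_eq_mul_div, le_div_iff₀ (by positivity)]
  nlinarith

/-- The pairs `(β, γ - β)` against the pairs `(β, γ)`. -/
def shear : L × L ≃ L × L where
  toFun p := (p.2, p.1 - p.2)
  invFun p := (p.1 + p.2, p.1)
  left_inv p := by simp
  right_inv p := by simp

theorem IsCoeff.conv {I : Opens S1} {a b : L → ℂ} (ha : P.IsCoeff I a) (hb : P.IsCoeff I b)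
    {x : Circle} (hx : x ∈ I) : P.IsCoeff I (PeriodMap.conv a b) := by
  refine ⟨fun γ hγ y hy => ?_, ?_⟩
  · obtain ⟨β, hβ⟩ : ∃ β, a β * b (γ - β) ≠ 0 := by
      by_contra! hcon
      exact hγ (by simp [PeriodMap.conv, hcon])
    have h1 := ha.le_zero β (left_ne_zero_of_mul hβ) y hy
    have h2 := hb.le_zero _ (right_ne_zero_of_mul hβ) y hy
    have e : P.μ γ = P.μ β + P.μ (γ - β) := by rw [← map_add]; congr 1; abel
    rw [e]
    rcases h1 with h1 | h1 <;> rcases h2 with h2 | h2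
    · left
      simp only [LtAt, sub_zero, mul_add, Complex.add_re] at h1 h2 ⊢
      linarith
    · left; rw [h2, add_zero]; exact h1
    · left; rw [h1, zero_add]; exact h2
    · right; rw [h1, h2, add_zero]
  · obtain ⟨κ, hκ, hlen⟩ := exists_len_add_le hx P
    obtain ⟨ϱ₁, h1, hs1⟩ := ha.summable
    obtain ⟨ϱ₂, h2, hs2⟩ := hb.summable
    set ϱ := min (min ϱ₁ ϱ₂) 1 with hϱ
    have hϱ0 : 0 < ϱ := by positivity
    have hϱ1 : ϱ ≤ 1 := min_le_right _ _
    have mono : ∀ (c : L → ℂ) (r : ℝ), ϱ ≤ r → Summable (fun γ => ‖c γ‖ * r ^ P.len γ) →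
        Summable (fun γ => ‖c γ‖ * ϱ ^ P.len γ) := fun c r hr hs =>
      Summable.of_nonneg_of_le (fun _ => by positivity) (fun γ => by
        have := len_nonneg (P := P) γ
        gcongr) hs
    have hs1' := mono a ϱ₁ ((min_le_left _ _).trans (min_le_left _ _)) hs1
    have hs2' := mono b ϱ₂ ((min_le_left _ _).trans (min_le_right _ _)) hs2
    have hprod := (hs1'.mul_of_nonneg hs2' (fun _ => by positivity) (fun _ => by positivity))
    rw [← (shear (L := L)).summable_iff] at hprod
    have hprod2 : Summable fun p : L × L => ‖a p.2 * b (p.1 - p.2)‖ * (ϱ ^ κ) ^ P.len p.1 := by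
      refine Summable.of_nonneg_of_le (fun _ => by positivity) (fun p => ?_) hprod
      simp only [Function.comp, shear, Equiv.coe_fn_mk]
      by_cases ha0 : a p.2 = 0
      · simp [ha0]
      by_cases hb0 : b (p.1 - p.2) = 0
      · simp [hb0]
      have hl := hlen _ _ (ha.le_zero _ ha0) (hb.le_zero _ hb0)
      rw [add_sub_cancel] at hl
      have h8 : (ϱ ^ κ) ^ P.len p.1 ≤ ϱ ^ P.len p.2 * ϱ ^ P.len (p.1 - p.2) := by
        rw [← Real.rpow_mul hϱ0.le, ← Real.rpow_add hϱ0]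
        exact Real.rpow_le_rpow_of_exponent_ge hϱ0 hϱ1 hl
      calc _ ≤ ‖a p.2 * b (p.1 - p.2)‖ * (ϱ ^ P.len p.2 * ϱ ^ P.len (p.1 - p.2)) := by gcongr
        _ = _ := by rw [norm_mul]; ring
    refine ⟨ϱ ^ κ, by positivity, ?_⟩
    refine Summable.of_nonneg_of_le (fun _ => by positivity) (fun γ => ?_) hprod2.prod
    have hγ := hprod2.prod_factor γ
    simp only at hγ ⊢
    rw [tsum_mul_right]
    have hpos : 0 < (ϱ ^ κ) ^ P.len γ := by positivity
    have hγ' : Summable fun β => ‖a β * b (γ - β)‖ := (summable_mul_right_iff hpos.ne').1 hγ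
    gcongr
    exact norm_tsum_le_tsum_norm hγ'

theorem u_add (β γ : L) (z : ℂ) : P.u (β + γ) z = P.u β z * P.u γ z := by
  rw [u, u, u, map_add, add_div, Complex.exp_add]

theorem IsCoeff.expSum_mul {I : Opens S1} {a b : L → ℂ} (ha : P.IsCoeff I a)
    (hb : P.IsCoeff I b) {x : Circle} (hx : x ∈ I) :
    ∀ᶠ z in dirFilter x, P.expSum a z * P.expSum b z = P.expSum (PeriodMap.conv a b) z := by
  filter_upwards [ha.eventually_summable hx, hb.eventually_summable hx] with z h1 h2
  rw [expSum, expSum, tsum_mul_tsum_of_summable_norm h1 h2]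
  have hs := (summable_mul_of_summable_norm h1 h2)
  rw [← (shear (L := L)).summable_iff] at hs
  rw [← (shear (L := L)).tsum_eq]
  refine (Summable.tsum_prod hs).trans ?_
  rw [expSum]
  refine tsum_congr fun γ => ?_
  rw [PeriodMap.conv, ← tsum_mul_right]
  refine tsum_congr fun β => ?_
  simp only [Function.comp, shear, Equiv.coe_fn_mk]
  have : P.u γ z = P.u β z * P.u (γ - β) z := by rw [← u_add, add_sub_cancel]
  rw [this]
  ring

/-- `f` is a finite sum `∑ᵢ exp (μ(γᵢ)/z) fᵢ(z)`, where each `fᵢ` is the sum of a series whose coefficients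
satisfy `IsCoeff` on `I`: a local representative of a section of `𝒜_μ = ∑_γ exp (μ(γ)/z) 𝒜_μ^{≤ 0}`. -/
def IsRep (P : PeriodMap L) (I : Opens S1) (f : ℂ → ℂ) : Prop :=
  ∃ (n : ℕ) (γ : Fin n → L) (a : Fin n → L → ℂ), (∀ i, P.IsCoeff I (a i)) ∧
    ∀ z, f z = ∑ i, P.u (γ i) z * P.expSum (a i) z

theorem IsCoeff.mono {I J : Opens S1} (h : J ≤ I) {a : L → ℂ} (ha : P.IsCoeff I a) :
    P.IsCoeff J a :=
  ⟨fun γ hγ x hx => ha.le_zero γ hγ x (h hx), ha.summable⟩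

theorem IsRep.mono {I J : Opens S1} (h : J ≤ I) {f : ℂ → ℂ} (hf : P.IsRep I f) :
    P.IsRep J f := by
  obtain ⟨n, γ, a, ha, e⟩ := hf
  exact ⟨n, γ, a, fun i => (ha i).mono h, e⟩

theorem isRep_of_fintype {I : Opens S1} {ι : Type*} [Fintype ι] (γ : ι → L) (a : ι → L → ℂ)
    (ha : ∀ i, P.IsCoeff I (a i)) : P.IsRep I fun z => ∑ i, P.u (γ i) z * P.expSum (a i) z := by
  let e := Fintype.equivFin ι
  refine ⟨Fintype.card ι, γ ∘ e.symm, a ∘ e.symm, fun i => ha _, fun z => ?_⟩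
  exact (e.symm.sum_comp (fun i => P.u (γ i) z * P.expSum (a i) z)).symm

theorem IsRep.add {I : Opens S1} {f g : ℂ → ℂ} (hf : P.IsRep I f) (hg : P.IsRep I g) :
    P.IsRep I (f + g) := by
  obtain ⟨n, γ, a, ha, e⟩ := hf
  obtain ⟨m, δ, b, hb, e'⟩ := hg
  have := isRep_of_fintype (P := P) (I := I) (Sum.elim γ δ) (Sum.elim a b)
    (by rintro (i | i); exacts [ha i, hb i])
  convert this using 2 with z
  simp [e, e']

theorem IsRep.mul {I : Opens S1} {f g : ℂ → ℂ} (hf : P.IsRep I f) (hg : P.IsRep I g)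
    {x₀ : Circle} (hx₀ : x₀ ∈ I) :
    ∃ h, P.IsRep I h ∧ ∀ x ∈ I, f * g =ᶠ[dirFilter x] h := by
  obtain ⟨n, γ, a, ha, e⟩ := hf
  obtain ⟨m, δ, b, hb, e'⟩ := hg
  refine ⟨_, isRep_of_fintype (P := P) (I := I) (fun p : Fin n × Fin m => γ p.1 + δ p.2)
    (fun p => conv (a p.1) (b p.2)) (fun p => (ha p.1).conv (hb p.2) hx₀), fun x hx => ?_⟩
  have : ∀ᶠ z in dirFilter x, ∀ i j, P.expSum (a i) z * P.expSum (b j) z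
      = P.expSum (conv (a i) (b j)) z :=
    eventually_all.2 fun i => eventually_all.2 fun j => (ha i).expSum_mul (hb j) hx
  filter_upwards [this] with z hz
  rw [Pi.mul_apply, e, e', Finset.sum_mul_sum, ← Finset.univ_product_univ, Finset.sum_product]
  refine Finset.sum_congr rfl fun i _ => Finset.sum_congr rfl fun j _ => ?_
  rw [u_add, ← hz]
  ring

theorem isCoeff_single [DecidableEq L] (I : Opens S1) (c : ℂ) : P.IsCoeff I (Pi.single 0 c) := by
  refine ⟨fun γ hγ x _ => Or.inr ?_, 1, one_pos, ?_⟩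
  · rcases eq_or_ne γ 0 with rfl | h
    · exact map_zero _
    · simp [h] at hγ
  · refine summable_of_ne_finset_zero (s := {0}) fun γ hγ => ?_
    have : γ ≠ 0 := by simpa using hγ
    simp [this]

theorem isRep_const_mul_u (I : Opens S1) (c : ℂ) (γ : L) : P.IsRep I fun z => c * P.u γ z := by
  classical
  refine ⟨1, fun _ => γ, fun _ => Pi.single 0 c, fun _ => isCoeff_single I c, fun z => ?_⟩
  rw [Fin.sum_univ_one, expSum, tsum_eq_single 0 (fun β hβ => by simp [hβ])]
  simp [u, mul_comm]

/-- Germs of functions at the boundary point `x` of the real oriented blow-up. The stalk at `x` of the sheaf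
`i⁻¹ j_* 𝒪_{ℂ^*}` on the circle consists of those that have a holomorphic representative. -/
abbrev FunGerm (x : S1) : Type := Germ (dirFilter x) ℂ

variable (P) in
/-- Families of germs over `U` that are the germs of one function satisfying `IsRep`. -/
def repPrelocal : TopCat.PrelocalPredicate FunGerm where
  pred {U} s := ∃ f : ℂ → ℂ, P.IsRep U f ∧ ∀ x : U, s x = (f : FunGerm x)
  res := by
    rintro U V i s ⟨f, hf, h⟩
    exact ⟨f, hf.mono i.le, fun x => h ⟨x.1, i.le x.2⟩⟩

variable (P) in
/-- Families of germs over `U` that are locally the germs of a function satisfying `IsRep`: the sections of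
the sheaf `𝒜_μ` over `U`, as a subsheaf of the sheaf `i⁻¹ j_* 𝒪_{ℂ^*}`. Since being a coefficient family
passes to smaller open sets, it does not matter here whether the open sets are connected. -/
def repLocal : TopCat.LocalPredicate FunGerm := P.repPrelocal.sheafify

variable (P) in
/-- The sections of `𝒜_μ` form a ring. -/
def sectionsSubring (U : (Opens S1)ᵒᵖ) : Subring (∀ x : U.unop, FunGerm x.1) where
  carrier := {s | P.repLocal.pred s}
  zero_mem' := TopCat.PrelocalPredicate.sheafifyOf ⟨_, isRep_const_mul_u (P := P) _ 0 0, fun x => by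
    simp; rfl⟩
  one_mem' := TopCat.PrelocalPredicate.sheafifyOf ⟨_, isRep_const_mul_u (P := P) _ 1 0, fun x => by
    simp [u]; rfl⟩
  add_mem' {s t} hs ht := by
    refine TopCat.PrelocalPredicate.sheafify_inductionOn₂' _ _ P.repPrelocal (fun a b => a + b)
      ?_ hs ht
    rintro V W a b ⟨f, hf, h⟩ ⟨g, hg, h'⟩
    refine ⟨f + g, (hf.mono inf_le_left).add (hg.mono inf_le_right), fun x => ?_⟩
    exact congrArg₂ (· + ·) (h ⟨x.1, x.2.1⟩) (h' ⟨x.1, x.2.2⟩)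
  mul_mem' {s t} hs ht := by
    refine TopCat.PrelocalPredicate.sheafify_inductionOn₂ _ _ P.repPrelocal (fun a b => a * b)
      ?_ hs ht
    rintro V W a b ⟨f, hf, h⟩ ⟨g, hg, h'⟩ p
    obtain ⟨k, hk, e⟩ := (hf.mono inf_le_left).mul (hg.mono inf_le_right) p.2
    refine ⟨V ⊓ W, V.infLELeft W, V.infLERight W, p.2, k, hk, fun x => ?_⟩
    exact (congrArg₂ (· * ·) (h ⟨x.1, x.2.1⟩) (h' ⟨x.1, x.2.2⟩)).trans
      (Germ.coe_eq.2 (e x.1 x.2))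
  neg_mem' {s} hs := by
    refine TopCat.PrelocalPredicate.sheafify_inductionOn _ (fun a => -a) ?_ hs
    rintro V a ⟨f, hf, h⟩ p
    obtain ⟨k, hk, e⟩ := (isRep_const_mul_u (P := P) V (-1) 0).mul hf p.2
    refine ⟨V, 𝟙 _, p.2, k, hk, fun x => ?_⟩
    change -a x = _
    rw [h]
    refine Germ.coe_eq.2 (EventuallyEq.trans ?_ (e x.1 x.2))
    exact Eventually.of_forall fun z => by simp [u]

variable (P) in
/-- The sheaf `𝒜_μ`, as a sheaf of sets. -/
def sheafInType : TopCat.Sheaf (Type) S1 := TopCat.subsheafToTypes P.repLocal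

instance (U : (Opens S1)ᵒᵖ) : CommRing (P.sheafInType.1.obj U) :=
  (P.sectionsSubring U).toCommRing

variable (P) in
/-- The sheaf `𝒜_μ`, as a presheaf of commutative rings. -/
def coeffPresheaf : TopCat.Presheaf CommRingCat.{0} S1 where
  obj U := CommRingCat.of (P.sheafInType.1.obj U)
  map i := CommRingCat.ofHom
    { toFun := P.sheafInType.1.map i
      map_zero' := rfl
      map_add' := fun _ _ => rfl
      map_one' := rfl
      map_mul' := fun _ _ => rfl }

variable (P) in
/-- The two versions of `𝒜_μ` agree. -/
def coeffPresheafCompForget : P.coeffPresheaf ⋙ forget CommRingCat ≅ P.sheafInType.1 :=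
  NatIso.ofComponents (fun _ => Iso.refl _) (by cat_disch)

variable (P) in
/-- The sheaf `𝒜_μ`, as a sheaf of commutative rings on the circle. -/
def coeffSheaf : TopCat.Sheaf CommRingCat.{0} S1 :=
  ⟨P.coeffPresheaf, (TopCat.Presheaf.isSheaf_iff_isSheaf_comp (forget CommRingCat) _).2
    (TopCat.Presheaf.isSheaf_of_iso P.coeffPresheafCompForget.symm P.sheafInType.property)⟩

variable (P) in
/-- The sheaf of rings `𝒜_μ`, in the form used for sheaves of modules. -/
def ringSheaf : Sheaf (Opens.grothendieckTopology S1) RingCat.{0} :=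
  ⟨P.coeffPresheaf ⋙ forget₂ CommRingCat RingCat,
    ((sheafCompose _ (forget₂ CommRingCat RingCat)).obj P.coeffSheaf).property⟩

/-- The sections of `𝒜_μ` over `U`. -/
abbrev Sec (P : PeriodMap L) (U : Opens S1) : Type := P.coeffPresheaf.obj (op U)

/-- The stalk of `𝒜_μ` at `x`. -/
abbrev Stalk (P : PeriodMap L) (x : S1) : Type := P.coeffPresheaf.stalk x

/-- The section `u^γ = exp (μ(γ)/z)` of `𝒜_μ`. -/
def expSec (P : PeriodMap L) (U : Opens S1) (γ : L) : P.Sec U :=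
  ⟨fun x => (P.u γ : FunGerm x), TopCat.PrelocalPredicate.sheafifyOf ⟨_, isRep_const_mul_u (P := P) U 1 γ,
    fun x => by simp⟩⟩

/-- The constant sections of `𝒜_μ`. -/
def constSec (P : PeriodMap L) (U : Opens S1) : ℂ →+* P.Sec U where
  toFun c := ⟨fun x => ((fun _ => c : ℂ → ℂ) : FunGerm x), TopCat.PrelocalPredicate.sheafifyOf
    ⟨_, isRep_const_mul_u (P := P) U c 0, fun x => by simp [u]⟩⟩
  map_one' := rfl
  map_zero' := rfl
  map_add' _ _ := rfl
  map_mul' _ _ := rfl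

variable (P) in
/-- The germ at `x` of a section of `𝒜_μ`. -/
def stalkGerm (U : Opens S1) (x : S1) (hx : x ∈ U) : P.Sec U →+* P.Stalk x :=
  (P.coeffPresheaf.germ U x hx).hom

/-- The germ `g` belongs to `𝒜^{≤ c} = exp (c/z) 𝒜^{≤ 0}` at `x`: the function `exp (-c/z) g(z)` is of
moderate growth, i.e. `O(|z|^{-N})` for some `N`. -/
def ModerateAt (x : S1) (c : ℂ) (g : FunGerm x) : Prop :=
  ∃ f : ℂ → ℂ, g = (f : FunGerm x) ∧ ∃ (N : ℕ) (K : ℝ),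
    ∀ᶠ z in dirFilter x, ‖Complex.exp (-c / z) * f z‖ ≤ K * (‖z‖⁻¹) ^ N

/-- The section `a` of `𝒜_μ` belongs to `𝒜_μ^{≤ c} = 𝒜_μ ∩ 𝒜^{≤ c}`. For `c = 0` this is the same as being
locally the sum of a series with coefficients satisfying `IsCoeff`. -/
def IsLE {U : Opens S1} (c : ℂ) (a : P.Sec U) : Prop := ∀ x : U, ModerateAt x.1 c (a.1 x)

variable (P) in
/-- The stalk at `x` of `𝒜_μ^{≤ c}`. -/
def stalkLE (x : S1) (c : ℂ) : Set (P.Stalk x) :=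
  {t | ∃ (U : Opens S1) (hx : x ∈ U) (a : P.Sec U), IsLE c a ∧ P.stalkGerm U x hx a = t}

theorem constSec_isLE (U : Opens S1) (a : ℂ) : IsLE 0 (P.constSec U a) := fun x =>
  ⟨fun _ => a, rfl, 0, ‖a‖, Eventually.of_forall fun z => by simp⟩

variable (P) in
/-- The constants in the stalk of `𝒜_μ`. -/
def constStalk (x : S1) : ℂ →+* P.Stalk x := (P.stalkGerm ⊤ x trivial).comp (P.constSec ⊤)

variable (P) in
/-- The germ of `u^γ` at `x`. -/
def expStalk (x : S1) (γ : L) : P.Stalk x := P.stalkGerm ⊤ x trivial (P.expSec ⊤ γ)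

theorem expSec_zero (U : Opens S1) : P.expSec U 0 = 1 := by
  refine Subtype.ext (funext fun x => Germ.coe_eq.2 (Eventually.of_forall fun z => ?_))
  simp [u]

theorem expSec_add (U : Opens S1) (β γ : L) : P.expSec U (β + γ) = P.expSec U β * P.expSec U γ := by
  refine Subtype.ext (funext fun x => Germ.coe_eq.2 (Eventually.of_forall fun z => ?_))
  exact u_add β γ z

theorem stalkGerm_constSec {U : Opens S1} {x : S1} (hx : x ∈ U) (a : ℂ) :
    P.stalkGerm U x hx (P.constSec U a) = P.constStalk x a :=
  TopCat.Presheaf.germ_res_apply P.coeffPresheaf (homOfLE le_top : U ⟶ ⊤) x hx (P.constSec ⊤ a)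

theorem stalkGerm_expSec {U : Opens S1} {x : S1} (hx : x ∈ U) (γ : L) :
    P.stalkGerm U x hx (P.expSec U γ) = P.expStalk x γ :=
  TopCat.Presheaf.germ_res_apply P.coeffPresheaf (homOfLE le_top : U ⟶ ⊤) x hx (P.expSec ⊤ γ)

variable (P) in
/-- The homomorphism `γ ↦ u^γ` to the stalk of `𝒜_μ`. -/
def expStalkHom (x : S1) : Multiplicative L →* P.Stalk x where
  toFun γ := P.expStalk x γ.toAdd
  map_one' := by simp [expStalk, expSec_zero]
  map_mul' β γ := by simp [expStalk, expSec_add]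

variable (P) in
/-- The homomorphism from the group algebra `ℂ[L]` to the stalk of `𝒜_μ` that sends `γ` to `u^γ`. -/
def groupAlgebraToStalk (x : S1) : AddMonoidAlgebra ℂ L →+* P.Stalk x :=
  AddMonoidAlgebra.liftNCRingHom (P.constStalk x) (P.expStalkHom x) fun _ _ => mul_comm _ _

instance (x : S1) : Algebra (AddMonoidAlgebra ℂ L) (P.Stalk x) :=
  (P.groupAlgebraToStalk x).toAlgebra

variable (P) in
/-- The category of sheaves of `𝒜_μ`-modules. -/
abbrev Mod := SheafOfModules.{0} P.ringSheaf

variable (M : P.Mod)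

/-- The sections of a sheaf of modules over `U`. -/
abbrev ModSec (U : Opens S1) : Type := M.val.obj (op U)

instance (U : Opens S1) : Module (P.Sec U) (ModSec M U) :=
  inferInstanceAs (Module (P.ringSheaf.obj.obj (op U)) (M.val.obj (op U)))

/-- The stalk of a sheaf of modules at `x`. -/
abbrev ModStalk (x : S1) : Type := ↑(TopCat.Presheaf.stalk (X := S1) M.val.presheaf x)

/-- The module structure on the stalk of a presheaf of modules (made explicit to guide unification). -/
abbrev stalkModuleAux {X : TopCat.{0}} (R : X.Presheaf CommRingCat.{0})
    (M : PresheafOfModules.{0} (R ⋙ forget₂ CommRingCat RingCat)) (x : X) :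
    Module (R.stalk x) ↑(TopCat.Presheaf.stalk M.presheaf x) := inferInstance

instance (x : S1) : Module (P.Stalk x) (ModStalk M x) := stalkModuleAux P.coeffPresheaf M.val x

instance (x : S1) : Module ℂ (ModStalk M x) := Module.compHom _ (P.constStalk x)

/-- Restriction of sections of a sheaf of modules. -/
def res {U V : Opens S1} (h : V ≤ U) : ModSec M U →+ ModSec M V :=
  (M.val.presheaf.map (homOfLE h).op).hom

/-- The germ at `x` of a section of a sheaf of modules. -/
def germ (U : Opens S1) (x : S1) (hx : x ∈ U) : ModSec M U →+ ModStalk M x :=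
  (TopCat.Presheaf.germ (X := S1) M.val.presheaf U x hx).hom

theorem germ_res {U V : Opens S1} (h : V ≤ U) (x : S1) (hx : x ∈ V) (s : ModSec M U) :
    germ M V x hx (res M h s) = germ M U x (h hx) s :=
  TopCat.Presheaf.germ_res_apply (X := S1) M.val.presheaf (homOfLE h) x hx s

theorem germ_smul (U : Opens S1) (x : S1) (hx : x ∈ U) (a : P.Sec U) (s : ModSec M U) :
    germ M U x hx (a • s) = P.stalkGerm U x hx a • germ M U x hx s :=
  PresheafOfModules.germ_smul (R := P.coeffPresheaf) M.val x U hx a s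

theorem complex_smul_def (x : S1) (a : ℂ) (t : ModStalk M x) : a • t = P.constStalk x a • t := rfl

end PeriodMap

open PeriodMap

/-- A filtered module `(ℒ, ℒ_≤)` over the filtered sheaf of rings `𝒜_μ`, indexed by `ℂ`: a sheaf of
`𝒜_μ`-modules `ℒ` with a family of subsheaves `ℒ_{≤ c}` (`fil`) of `𝒜_μ^{≤ 0}`-submodules (`smul_mem`) such that
* if `c ≤_θ c'` then the stalks at `e^{iθ}` satisfy `(ℒ_{≤ c})_{e^{iθ}} ⊆ (ℒ_{≤ c'})_{e^{iθ}}` (`le_mem`);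
* `u^γ ℒ_{≤ c} = ℒ_{≤ c + μ(γ)}` (`exp_smul`). -/
structure FilteredModule (P : PeriodMap L) where
  mod : P.Mod
  fil : ℂ → ∀ U : Opens S1, AddSubgroup (ModSec mod U)
  res_mem : ∀ {c : ℂ} {U V : Opens S1} (h : V ≤ U) {s : ModSec mod U},
    s ∈ fil c U → res mod h s ∈ fil c V
  local_mem : ∀ {c : ℂ} {U : Opens S1} {s : ModSec mod U},
    (∀ x ∈ U, ∃ (V : Opens S1) (h : V ≤ U), x ∈ V ∧ res mod h s ∈ fil c V) → s ∈ fil c U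
  smul_mem : ∀ {c : ℂ} {U : Opens S1} {a : P.Sec U} {s : ModSec mod U},
    IsLE 0 a → s ∈ fil c U → a • s ∈ fil c U
  le_mem : ∀ {x : S1} {c c' : ℂ}, LeAt x c c' → ∀ {U : Opens S1} {s : ModSec mod U}, x ∈ U →
    s ∈ fil c U → ∃ (V : Opens S1) (h : V ≤ U), x ∈ V ∧ res mod h s ∈ fil c' V
  exp_smul : ∀ (γ : L) (c : ℂ) (U : Opens S1),
    (fil c U).map (DistribSMul.toAddMonoidHom (ModSec mod U) (P.expSec U γ)) = fil (c + P.μ γ) U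

namespace FilteredModule

variable {P} (F : FilteredModule P)

/-- The stalk `(ℒ_{≤ c})_x`. -/
def filStalk (c : ℂ) (x : S1) : Submodule ℂ (ModStalk F.mod x) where
  carrier := {t | ∃ (U : Opens S1) (hx : x ∈ U) (s : ModSec F.mod U),
    s ∈ F.fil c U ∧ germ F.mod U x hx s = t}
  zero_mem' := ⟨⊤, trivial, 0, zero_mem _, map_zero _⟩
  add_mem' := by
    rintro _ _ ⟨U, hU, s, hs, rfl⟩ ⟨V, hV, t, ht, rfl⟩
    refine ⟨U ⊓ V, ⟨hU, hV⟩, res F.mod inf_le_left s + res F.mod inf_le_right t,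
      add_mem (F.res_mem _ hs) (F.res_mem _ ht), ?_⟩
    rw [map_add]
    exact congrArg₂ (· + ·) (germ_res _ _ _ _ _) (germ_res _ _ _ _ _)
  smul_mem' := by
    rintro a _ ⟨U, hU, s, hs, rfl⟩
    refine ⟨U, hU, P.constSec U a • s, F.smul_mem (constSec_isLE U a) hs, ?_⟩
    rw [germ_smul, stalkGerm_constSec, complex_smul_def]

theorem germ_mem {c : ℂ} {U : Opens S1} {x : S1} (hx : x ∈ U) {s : ModSec F.mod U}
    (hs : s ∈ F.fil c U) : germ F.mod U x hx s ∈ F.filStalk c x := ⟨U, hx, s, hs, rfl⟩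

/-- The stalk `(ℒ_{< c})_x = ∑_{c' <_x c} (ℒ_{≤ c'})_x`. -/
def filStalkLT (c : ℂ) (x : S1) : Submodule ℂ (ModStalk F.mod x) :=
  ⨆ (c' : ℂ) (_ : LtAt x c' c), F.filStalk c' x

/-- The stalk at `x` of `gr_c ℒ = ℒ_{≤ c} / ℒ_{< c}`. -/
abbrev Gr (c : ℂ) (x : S1) : Type :=
  F.filStalk c x ⧸ (F.filStalkLT c x).submoduleOf (F.filStalk c x)

/-- The class in `gr_c ℒ` of an element of `ℒ_{≤ c}`, on stalks. -/
def grMk (c : ℂ) (x : S1) : F.filStalk c x →ₗ[ℂ] F.Gr c x := Submodule.mkQ _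

/-- Multiplication by `u^γ` on the stalk of `ℒ`. -/
def expMul (γ : L) (x : S1) : ModStalk F.mod x →ₗ[ℂ] ModStalk F.mod x where
  toFun t := P.expStalk x γ • t
  map_add' := smul_add _
  map_smul' a t := by
    simp only [complex_smul_def, RingHom.id_apply, smul_smul, mul_comm]

theorem expMul_mem (γ : L) {c : ℂ} {x : S1} {t : ModStalk F.mod x} (ht : t ∈ F.filStalk c x) :
    F.expMul γ x t ∈ F.filStalk (c + P.μ γ) x := by
  obtain ⟨U, hx, s, hs, rfl⟩ := ht
  refine ⟨U, hx, P.expSec U γ • s, ?_, ?_⟩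
  · rw [← F.exp_smul]
    exact ⟨s, hs, rfl⟩
  · rw [germ_smul, stalkGerm_expSec]; rfl

theorem expMul_mem_LT (γ : L) {c : ℂ} {x : S1} {t : ModStalk F.mod x}
    (ht : t ∈ F.filStalkLT c x) : F.expMul γ x t ∈ F.filStalkLT (c + P.μ γ) x := by
  have : F.filStalkLT c x ≤ (F.filStalkLT (c + P.μ γ) x).comap (F.expMul γ x) := by
    refine iSup₂_le fun c' hc' => fun t ht => ?_
    have h : LtAt x (c' + P.μ γ) (c + P.μ γ) := by simpa [LtAt] using hc'
    exact (le_iSup₂_of_le (f := fun c' (_ : LtAt x c' (c + P.μ γ)) => F.filStalk c' x)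
      (c' + P.μ γ) h le_rfl) (F.expMul_mem γ ht)
  exact this ht

/-- Multiplication by `u^γ` as a map `gr_c ℒ → gr_{c + μ(γ)} ℒ`, on stalks. -/
def grExp (γ : L) (c : ℂ) (x : S1) : F.Gr c x →ₗ[ℂ] F.Gr (c + P.μ γ) x :=
  Submodule.mapQ _ _ ((F.expMul γ x).restrict fun _ => F.expMul_mem γ)
    fun _ ht => F.expMul_mem_LT γ ht

/-- The stalk at `x` of `gr ℒ = ⨁_c gr_c ℒ`. -/
def GrTot (x : S1) : Type := ⨁ c : ℂ, F.Gr c x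

instance (x : S1) : AddCommGroup (F.GrTot x) := inferInstanceAs (AddCommGroup (⨁ c : ℂ, F.Gr c x))
instance (x : S1) : Module ℂ (F.GrTot x) := inferInstanceAs (Module ℂ (⨁ c : ℂ, F.Gr c x))

/-- The inclusion of the summand `gr_c ℒ` into `gr ℒ`, on stalks. -/
def grIncl (c : ℂ) (x : S1) : F.Gr c x →ₗ[ℂ] F.GrTot x :=
  DirectSum.lof ℂ ℂ (fun c => F.Gr c x) c

theorem grTot_ext {x : S1} {f g : F.GrTot x →ₗ[ℂ] F.GrTot x}
    (h : ∀ c (t : F.filStalk c x), f (F.grIncl c x (F.grMk c x t)) = g (F.grIncl c x (F.grMk c x t))) :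
    f = g := by
  refine DirectSum.linearMap_ext ℂ fun c => LinearMap.ext fun v => ?_
  obtain ⟨t, rfl⟩ := Submodule.mkQ_surjective _ v
  exact h c t

theorem grIncl_congr {x : S1} {c c' : ℂ} (hc : c = c') {t t' : ModStalk F.mod x} (ht : t = t')
    (h : t ∈ F.filStalk c x) (h' : t' ∈ F.filStalk c' x) :
    F.grIncl c x (F.grMk c x ⟨t, h⟩) = F.grIncl c' x (F.grMk c' x ⟨t', h'⟩) := by
  subst hc; subst ht; rfl

/-- Multiplication by `u^γ` on `gr ℒ`, on stalks. -/
def expTot (γ : L) (x : S1) : Module.End ℂ (F.GrTot x) :=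
  DirectSum.toModule ℂ ℂ (F.GrTot x) fun c => F.grIncl (c + P.μ γ) x ∘ₗ F.grExp γ c x

theorem expTot_apply (γ : L) {c : ℂ} {x : S1} (t : F.filStalk c x) :
    F.expTot γ x (F.grIncl c x (F.grMk c x t)) =
      F.grIncl (c + P.μ γ) x (F.grMk _ x ⟨P.expStalk x γ • t.1, F.expMul_mem γ t.2⟩) :=
  DirectSum.toModule_lof ℂ c _

/-- The action of `L` on `gr ℒ`, on stalks. -/
def expTotHom (x : S1) : Multiplicative L →* Module.End ℂ (F.GrTot x) where
  toFun γ := F.expTot γ.toAdd x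
  map_one' := F.grTot_ext fun c t => by
    rw [expTot_apply]
    refine F.grIncl_congr (by simp) ?_ _ t.2
    exact (congrArg (· • t.1) (map_one (P.expStalkHom x))).trans (one_smul _ _)
  map_mul' β γ := F.grTot_ext fun c t => by
    rw [Module.End.mul_apply, expTot_apply, expTot_apply, expTot_apply]
    refine F.grIncl_congr ?_ ?_ _ _
    · rw [toAdd_mul, map_add]; ring
    · exact (congrArg (· • t.1) (map_mul (P.expStalkHom x) β γ)).trans (mul_smul _ _ _)

/-- The `ℂ[L]`-module structure on (the stalk of) `gr ℒ`, in which `γ` acts as multiplication by `u^γ`. -/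
instance (x : S1) : Module (AddMonoidAlgebra ℂ L) (F.GrTot x) :=
  Module.compHom _ (AddMonoidAlgebra.lift ℂ (Module.End ℂ (F.GrTot x)) L (F.expTotHom x)).toRingHom

/-- The stalk at `x` of `𝒜_μ ⊗_{ℂ[L]} gr ℒ`. -/
abbrev TensorStalk (x : S1) : Type _ := P.Stalk x ⊗[AddMonoidAlgebra ℂ L] F.GrTot x

/-- The filtration of `𝒜_μ ⊗_{ℂ[L]} gr ℒ` on the stalk at `x`: its step `≤ c` is
`∑_{c' + c'' ≤_x c} 𝒜_μ^{≤ c'} ⊗ gr_{c''} ℒ`. -/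
def tensorFil (c : ℂ) (x : S1) : AddSubgroup (F.TensorStalk x) :=
  AddSubgroup.closure {t | ∃ c' c'' : ℂ, LeAt x (c' + c'') c ∧ ∃ a ∈ P.stalkLE x c',
    ∃ v : F.Gr c'' x, t = a ⊗ₜ F.grIncl c'' x v}

/-- The sections over `U` of the quotient sheaf `gr_c ℒ = ℒ_{≤ c} / ℒ_{< c}`: the families of elements of the
stalks that are locally the class of a section of `ℒ_{≤ c}`. -/
def IsGrSection (c : ℂ) (U : Opens S1) (v : ∀ x : U, F.Gr c x.1) : Prop :=
  ∀ x : U, ∃ (V : Opens S1) (h : V ≤ U) (_ : x.1 ∈ V) (s : ModSec F.mod V) (hs : s ∈ F.fil c V),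
    ∀ y : V, v ⟨y.1, h y.2⟩ = F.grMk c y.1 ⟨germ F.mod V y.1 y.2 s, F.germ_mem y.2 hs⟩

/-- The sections over `U` of the sheaf `𝒜_μ ⊗_{ℂ[L]} gr ℒ`: the families of elements of the stalks that are
locally a finite sum `∑ᵢ aᵢ ⊗ vᵢ` with sections `aᵢ` of `𝒜_μ` and `vᵢ` of `gr_{cᵢ} ℒ`. -/
def IsTensorSection (U : Opens S1) (t : ∀ x : U, F.TensorStalk x.1) : Prop :=
  ∀ x : U, ∃ (V : Opens S1) (h : V ≤ U) (_ : x.1 ∈ V) (n : ℕ) (a : Fin n → P.Sec V)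
    (c : Fin n → ℂ) (v : ∀ (i : Fin n) (y : V), F.Gr (c i) y.1),
    (∀ i, F.IsGrSection (c i) V (v i)) ∧
    ∀ y : V, t ⟨y.1, h y.2⟩ =
      ∑ i, P.stalkGerm V y.1 y.2 (a i) ⊗ₜ[AddMonoidAlgebra ℂ L] F.grIncl (c i) y.1 (v i y)

/-- A filtered isomorphism `η : (𝒜_μ ⊗_{ℂ[L]} gr ℒ)|_I ≅ ℒ|_I` of sheaves of `𝒜_μ`-modules with `gr η = id`.
It is given by isomorphisms of the stalks (`toEquiv`) which map sections to sections, so that they define a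
morphism of sheaves (`map_section`), and identify the filtrations (`mem_fil`). The condition `gr η = id`
refers to the identification of `gr_c ℒ` with `gr_c (𝒜_μ ⊗ gr ℒ)` by `v ↦ 1 ⊗ v` (`gr_eq_id`). -/
structure Splitting (I : Opens S1) where
  toEquiv : ∀ x : I, F.TensorStalk x.1 ≃ₗ[P.Stalk x.1] ModStalk F.mod x.1
  map_section : ∀ (V : Opens S1) (h : V ≤ I) (t : ∀ x : V, F.TensorStalk x.1),
    F.IsTensorSection V t → ∃ s : ModSec F.mod V,
      ∀ x : V, germ F.mod V x.1 x.2 s = toEquiv ⟨x.1, h x.2⟩ (t x)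
  mem_fil : ∀ (x : I) (c : ℂ) (t : F.TensorStalk x.1),
    toEquiv x t ∈ F.filStalk c x.1 ↔ t ∈ F.tensorFil c x.1
  gr_eq_id : ∀ (x : I) (c : ℂ) (v : F.Gr c x.1),
    ∃ h : toEquiv x (1 ⊗ₜ F.grIncl c x.1 v) ∈ F.filStalk c x.1, F.grMk c x.1 ⟨_, h⟩ = v

/-- The conditions on a filtered `𝒜_μ`-module to be an object of `Be_{C,μ}`:
* each `gr_c ℒ` is a local system of (finite-dimensional) complex vector spaces: every point has a neighbourhood
  `I` on which `gr_c ℒ` is isomorphic to the constant sheaf with fibre some `ℂⁿ`. A morphism from this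
  constant sheaf is a linear map from `ℂⁿ` to the sections over `I`, and it is an isomorphism if and only if it is
  bijective on stalks;
* the `c` with `gr_c ℒ ≠ 0` lie in `-C + μ(L)`;
* every point has a neighbourhood over which `ℒ` splits. -/
structure IsBetti (C : Finset ℂ) : Prop where
  local_system : ∀ (c : ℂ) (x : S1), ∃ (I : Opens S1) (_ : x ∈ I) (n : ℕ)
    (φ : ∀ y : I, (Fin n → ℂ) ≃ₗ[ℂ] F.Gr c y.1),
    ∀ w : Fin n → ℂ, F.IsGrSection c I fun y => φ y w
  exponents : ∀ (c : ℂ) (x : S1), Nontrivial (F.Gr c x) → ∃ c₀ ∈ C, ∃ γ : L, c = -c₀ + P.μ γ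
  splitting : ∀ x : S1, ∃ I : Opens S1, x ∈ I ∧ Nonempty (F.Splitting I)

/-- A morphism of filtered `𝒜_μ`-modules: a morphism of `𝒜_μ`-modules which preserves the filtration. -/
@[ext]
structure Hom (F G : FilteredModule P) where
  hom : F.mod ⟶ G.mod
  map_fil : ∀ (c : ℂ) (U : Opens S1) (s : ModSec F.mod U),
    s ∈ F.fil c U → hom.val.app (op U) s ∈ G.fil c U

instance : Category (FilteredModule P) where
  Hom := Hom
  id F := ⟨𝟙 _, fun _ _ _ h => h⟩
  comp f g := ⟨f.hom ≫ g.hom, fun c U s h => g.map_fil c U _ (f.map_fil c U s h)⟩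

end FilteredModule

/-- The category `Be_{C,μ}`: the full subcategory of the category of filtered `𝒜_μ`-modules on the objects
satisfying `IsBetti`. -/
abbrev Be (C : Finset ℂ) (P : PeriodMap L) : Type _ :=
  ObjectProperty.FullSubcategory fun F : FilteredModule P => F.IsBetti C

end BettiStokes

end

/-! Kernels and cokernels exist for all filtered modules. What has to be shown is that those of a
morphism of `Be C P` stay in `Be C P`, and that morphisms are strict, so that monomorphisms and
epimorphisms are normal. Both follow from a local normal form (`HasLocalFrames.hasNormalForm`): near
every point there are bases of source and target, adapted to the filtrations, in which the morphism
is the identity on a common part of the two bases and zero on the rest.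

Adapted bases (`IsFrame`). The condition on `C` says that the exponents in `-C` are pairwise
incongruent modulo `μ(L)`. Hence local bases of the `gr_{-c₀} ℒ`, `c₀ ∈ C`, together form a
`ℂ[L]`-basis of `gr ℒ`, which a splitting carries to a basis of `ℒ` (`IsBetti.hasLocalFrames`).
Conversely, frames give back the local systems and the splittings, because leading terms of sections
are locally constant (`isBetti_of_hasLocalFrames`). The conditions defining `Be C P` can therefore
be replaced by the existence of frames.

Analysis of `𝒜_μ`. A germ is the sum of one exponential series. By the support property only
finitely many exponents lie in a bounded region, and the growth of the germ in directions where no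
two exponents have equal order shows that the filtration is read off from the support of the series
(`HasCoeff.mem_stalkLE_iff`). Hence leading terms are locally constant, and a germ with nonzero
leading term is a unit, whose inverse is a geometric series (`exists_inv_of_lead`).

Normal form. In frames with exponents `c i` and `d j` the matrix of the morphism has entries `A j i`
of order at most `c i - d j`. Choose `r` such that some `r`-minor has nonzero leading term but no
`(r+1)`-minor has. The corresponding block is invertible in the filtered sense, and elimination
yields the normal form as soon as its Schur complement is zero, that is, as soon as the
`(r+1)`-minors are zero and not merely small. This is the crux, and it is global on the circle.
Vanishing of the leading terms of the minors is open and closed in the direction, so it holds in all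
directions if it holds in one. The order of growth of the minors relative to the expected exponents
is then negative everywhere. An exponent `m` contributes `Re (e^{-iθ} (m - b))` to it, a sinusoid in
`θ`, which is strictly convex wherever it is negative. So the order has no negative local maximum,
and on the compact circle it must be `-∞`: the minors vanish (`mem_stalkLT_of_eventually`,
`forall_of_forall_zero`, `MinorBound.all`).

`MinorBound` is phrased with arbitrary filtered vectors and covectors, so that it does not depend on
frames and can be compared at all points of the circle. -/

noncomputable section

namespace BettiStokes

open CategoryTheory TopologicalSpace Opposite Filter
open scoped TensorProduct DirectSum Topology

variable {L : Type*} [AddCommGroup L] [Module.Free ℤ L] [Module.Finite ℤ L] {P : PeriodMap L}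

section

namespace PeriodMap

/-! ### Germs of sections of the structure sheaf -/

/-- Restriction of sections of `𝒜_μ`. -/
def resSec {U V : Opens S1} (h : V ≤ U) : P.Sec U →+* P.Sec V :=
  (P.coeffPresheaf.map (homOfLE h).op).hom

theorem resSec_val {U V : Opens S1} (h : V ≤ U) (a : P.Sec U) (y : V) :
    (resSec h a).1 y = a.1 ⟨y.1, h y.2⟩ := rfl

theorem stalkGerm_res {U V : Opens S1} (h : V ≤ U) (x : S1) (hx : x ∈ V) (a : P.Sec U) :
    P.stalkGerm V x hx (resSec h a) = P.stalkGerm U x (h hx) a :=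
  TopCat.Presheaf.germ_res_apply P.coeffPresheaf (homOfLE h) x hx a

theorem exists_stalkGerm {x : S1} (t : P.Stalk x) :
    ∃ (U : Opens S1) (hx : x ∈ U) (a : P.Sec U), P.stalkGerm U x hx a = t :=
  TopCat.Presheaf.exists_germ_eq P.coeffPresheaf t

theorem exists_stalkGerm_le {x : S1} {U : Opens S1} (hU : x ∈ U) (t : P.Stalk x) :
    ∃ (V : Opens S1) (_ : V ≤ U) (hx : x ∈ V) (a : P.Sec V), P.stalkGerm V x hx a = t := by
  obtain ⟨W, hx, a, rfl⟩ := exists_stalkGerm t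
  exact ⟨U ⊓ W, inf_le_left, ⟨hU, hx⟩, resSec inf_le_right a, stalkGerm_res _ _ _ _⟩

theorem stalkGerm_eq {x : S1} {U V : Opens S1} (hU : x ∈ U) (hV : x ∈ V) {a : P.Sec U} {b : P.Sec V}
    (h : P.stalkGerm U x hU a = P.stalkGerm V x hV b) :
    ∃ (W : Opens S1) (h₁ : W ≤ U) (h₂ : W ≤ V), x ∈ W ∧ resSec h₁ a = resSec h₂ b := by
  obtain ⟨W, hW, i, j, e⟩ := TopCat.Presheaf.germ_eq P.coeffPresheaf x hU hV a b h
  exact ⟨W, i.le, j.le, hW, e⟩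

/-! ### Germs of sections of sheaves of modules -/

section Mod

variable (M : P.Mod)

theorem exists_germ {x : S1} (t : ModStalk M x) :
    ∃ (U : Opens S1) (hx : x ∈ U) (s : ModSec M U), germ M U x hx s = t :=
  TopCat.Presheaf.exists_germ_eq (X := S1) M.val.presheaf t

theorem exists_germ_le {x : S1} {U : Opens S1} (hU : x ∈ U) (t : ModStalk M x) :
    ∃ (V : Opens S1) (_ : V ≤ U) (hx : x ∈ V) (s : ModSec M V), germ M V x hx s = t := by
  obtain ⟨W, hx, a, rfl⟩ := exists_germ M t
  exact ⟨U ⊓ W, inf_le_left, ⟨hU, hx⟩, res M inf_le_right a, germ_res _ _ _ _ _⟩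

theorem germ_eq {x : S1} {U V : Opens S1} (hU : x ∈ U) (hV : x ∈ V) {s : ModSec M U}
    {t : ModSec M V} (h : germ M U x hU s = germ M V x hV t) :
    ∃ (W : Opens S1) (h₁ : W ≤ U) (h₂ : W ≤ V), x ∈ W ∧ res M h₁ s = res M h₂ t := by
  obtain ⟨W, hW, i, j, e⟩ := TopCat.Presheaf.germ_eq (X := S1) M.val.presheaf x hU hV s t h
  exact ⟨W, i.le, j.le, hW, e⟩

theorem res_res {U V W : Opens S1} (h : V ≤ U) (h' : W ≤ V) (s : ModSec M U) :
    res M h' (res M h s) = res M (h'.trans h) s := by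
  have := M.val.presheaf.map_comp (homOfLE h).op (homOfLE h').op
  exact (ConcreteCategory.congr_hom this s).symm

/-- The underlying sheaf of abelian groups. -/
def abSheaf : TopCat.Sheaf AddCommGrpCat.{0} S1 := ⟨M.val.presheaf, M.isSheaf⟩

theorem section_ext {U : Opens S1} {s t : ModSec M U}
    (h : ∀ x (hx : x ∈ U), germ M U x hx s = germ M U x hx t) : s = t :=
  TopCat.Presheaf.section_ext (abSheaf M) U s t h

theorem res_smul {U V : Opens S1} (h : V ≤ U) (a : P.Sec U) (s : ModSec M U) :
    res M h (a • s) = resSec h a • res M h s :=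
  section_ext M fun x hx => by
    rw [germ_smul, germ_res, germ_smul, stalkGerm_res, germ_res]

/-- A family of elements of the stalks which locally comes from sections comes from a section. -/
theorem exists_section {U : Opens S1} (t : ∀ x : U, ModStalk M x.1)
    (h : ∀ x : U, ∃ (V : Opens S1) (hV : V ≤ U) (_ : x.1 ∈ V) (s : ModSec M V),
      ∀ y : V, germ M V y.1 y.2 s = t ⟨y.1, hV y.2⟩) :
    ∃ s : ModSec M U, ∀ x : U, germ M U x.1 x.2 s = t x := by
  choose V hV hxV s hs using h
  have hcomp : TopCat.Presheaf.IsCompatible (abSheaf M).1 V s := by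
    intro i j
    refine section_ext M fun y hy => ?_
    have e1 := germ_res M (inf_le_left : V i ⊓ V j ≤ V i) y hy (s i)
    have e2 := germ_res M (inf_le_right : V i ⊓ V j ≤ V j) y hy (s j)
    refine e1.trans (((hs i ⟨y, hy.1⟩).trans (hs j ⟨y, hy.2⟩).symm).trans e2.symm)
  obtain ⟨g, hg, -⟩ := (abSheaf M).existsUnique_gluing' V U (fun i => homOfLE (hV i))
    (fun x hx => Opens.mem_iSup.2 ⟨⟨x, hx⟩, hxV ⟨x, hx⟩⟩) s hcomp
  refine ⟨g, fun x => ?_⟩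
  have e1 := germ_res M (hV x) x.1 (hxV x) g
  rw [← e1]
  refine Eq.trans ?_ (hs x ⟨x.1, hxV x⟩)
  exact congrArg _ (hg x)

variable {M} {N : P.Mod} (f : M ⟶ N)

/-- The map on sections of a morphism of sheaves of modules. -/
def secMap (U : Opens S1) : ModSec M U →ₗ[P.Sec U] ModSec N U := (f.val.app (op U)).hom

theorem secMap_res {U V : Opens S1} (h : V ≤ U) (s : ModSec M U) :
    secMap f V (res M h s) = res N h (secMap f U s) :=
  PresheafOfModules.naturality_apply f.val (homOfLE h).op s

/-- The map on stalks of a morphism of sheaves of modules, as an additive map. -/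
def stalkMapAux (x : S1) : ModStalk M x →+ ModStalk N x :=
  ((TopCat.Presheaf.stalkFunctor AddCommGrpCat.{0} (X := S1) x).map
    ((PresheafOfModules.toPresheaf _).map f.val)).hom

theorem stalkMapAux_germ (U : Opens S1) (x : S1) (hx : x ∈ U) (s : ModSec M U) :
    stalkMapAux f x (germ M U x hx s) = germ N U x hx (secMap f U s) :=
  TopCat.Presheaf.stalkFunctor_map_germ_apply (X := S1) U x hx
    ((PresheafOfModules.toPresheaf _).map f.val) s

/-- The map on stalks of a morphism of sheaves of modules. -/
def stalkMap (x : S1) : ModStalk M x →ₗ[P.Stalk x] ModStalk N x where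
  toFun := stalkMapAux f x
  map_add' := map_add _
  map_smul' a t := by
    obtain ⟨U, hx, a, rfl⟩ := exists_stalkGerm a
    obtain ⟨V, hV, hxV, s, rfl⟩ := exists_germ_le M hx t
    rw [← stalkGerm_res hV x hxV, ← germ_smul, stalkMapAux_germ, map_smul, germ_smul,
      stalkMapAux_germ]
    rfl

theorem stalkMap_germ (U : Opens S1) (x : S1) (hx : x ∈ U) (s : ModSec M U) :
    stalkMap f x (germ M U x hx s) = germ N U x hx (secMap f U s) :=
  stalkMapAux_germ f U x hx s

theorem stalkMap_comp {K : P.Mod} (g : N ⟶ K) (x : S1) (t : ModStalk M x) :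
    stalkMap (f ≫ g) x t = stalkMap g x (stalkMap f x t) := by
  obtain ⟨U, hx, s, rfl⟩ := exists_germ M t
  rw [stalkMap_germ, stalkMap_germ, stalkMap_germ]; rfl

theorem stalkMap_id (x : S1) (t : ModStalk M x) : stalkMap (𝟙 M) x t = t := by
  obtain ⟨U, hx, s, rfl⟩ := exists_germ M t
  rw [stalkMap_germ]; rfl

theorem stalkMap_add (f g : M ⟶ N) (x : S1) (t : ModStalk M x) :
    stalkMap (f + g) x t = stalkMap f x t + stalkMap g x t := by
  obtain ⟨U, hx, s, rfl⟩ := exists_germ M t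
  rw [stalkMap_germ, stalkMap_germ, stalkMap_germ, ← map_add]; rfl

theorem stalkMap_zero (x : S1) (t : ModStalk M x) : stalkMap (0 : M ⟶ N) x t = 0 := by
  obtain ⟨U, hx, s, rfl⟩ := exists_germ M t
  rw [stalkMap_germ]; exact map_zero _

end Mod

end PeriodMap

open PeriodMap

/-! ### The filtration of a module seen on stalks -/

namespace FilteredModule

variable (F : FilteredModule P)

/-- Two sections with the same germ agree nearby, and `local_mem` glues. This lets all later
arguments about the filtration be carried out on stalks. -/
theorem mem_fil_iff {c : ℂ} {U : Opens S1} {s : ModSec F.mod U} :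
    s ∈ F.fil c U ↔ ∀ x (hx : x ∈ U), germ F.mod U x hx s ∈ F.filStalk c x := by
  refine ⟨fun h x hx => F.germ_mem hx h, fun h => F.local_mem fun x hx => ?_⟩
  obtain ⟨V, hV, t, ht, e⟩ := h x hx
  obtain ⟨W, h₁, h₂, hW, e'⟩ := germ_eq F.mod hV hx e
  exact ⟨W, h₂, hW, e' ▸ F.res_mem h₁ ht⟩

theorem filStalk_mono {x : S1} {c c' : ℂ} (h : LeAt x c c') : F.filStalk c x ≤ F.filStalk c' x := by
  rintro _ ⟨U, hx, s, hs, rfl⟩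
  obtain ⟨V, hV, hxV, h'⟩ := F.le_mem h hx hs
  exact ⟨V, hxV, _, h', germ_res _ _ _ _ _⟩

theorem smul_mem_filStalk {x : S1} {c : ℂ} {a : P.Stalk x} {t : ModStalk F.mod x}
    (ha : a ∈ P.stalkLE x 0) (ht : t ∈ F.filStalk c x) : a • t ∈ F.filStalk c x := by
  obtain ⟨U, hx, a, ha, rfl⟩ := ha
  obtain ⟨V, hV, s, hs, rfl⟩ := ht
  have hUV : x ∈ U ⊓ V := ⟨hx, hV⟩
  refine ⟨U ⊓ V, hUV, resSec inf_le_left a • res F.mod inf_le_right s,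
    F.smul_mem (fun y => ha ⟨y.1, y.2.1⟩) (F.res_mem _ hs), ?_⟩
  rw [germ_smul, stalkGerm_res, germ_res]

/-- Morphisms of filtered modules preserve the filtration of the stalks. -/
theorem Hom.stalkMap_mem {F G : FilteredModule P} (f : F ⟶ G) {c : ℂ} {x : S1}
    {t : ModStalk F.mod x} (ht : t ∈ F.filStalk c x) :
    stalkMap (Hom.hom f) x t ∈ G.filStalk c x := by
  obtain ⟨U, hx, s, hs, rfl⟩ := ht
  exact ⟨U, hx, _, Hom.map_fil f c U s hs, (stalkMap_germ _ _ _ _ _).symm⟩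

end FilteredModule

end

section

namespace PeriodMap

/-! ### The lattice of exponents -/

variable (P) in
-- Coordinates extend to linear forms on the finite-dimensional space `L ⊗ ℝ`, hence are bounded by
-- the norm, and the support property bounds the norm by `|μ|`.
theorem exists_coord_le : ∃ M : ℝ, 0 < M ∧ ∀ (γ : L) (i : Module.Free.ChooseBasisIndex ℤ L),
    |((Module.Free.chooseBasis ℤ L).repr γ i : ℝ)| ≤ M * ‖P.μ γ‖ := by
  obtain ⟨R, hR, hsupp⟩ := P.support
  have key : ∀ i : Module.Free.ChooseBasisIndex ℤ L, ∃ M : ℝ, 0 < M ∧ ∀ γ : L,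
      |((Module.Free.chooseBasis ℤ L).repr γ i : ℝ)| ≤ M * P.len γ := by
    intro i
    obtain ⟨M, hM, h⟩ := exists_bound_of_definite P.nrm P.definite
      (((Int.castAddHom ℂ).comp
        ((Module.Free.chooseBasis ℤ L).coord i).toAddMonoidHom).toIntLinearMap.liftBaseChange ℝ)
    refine ⟨M, hM, fun γ => ?_⟩
    have := h (1 ⊗ₜ γ)
    simpa [len] using this
  choose M hM h using key
  refine ⟨(∑ i, M i + 1) / R, by have := Finset.sum_nonneg fun i (_ : i ∈ Finset.univ) => (hM i).le; positivity,
    fun γ i => ?_⟩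
  have h1 : M i ≤ ∑ i, M i + 1 := by
    have := Finset.single_le_sum (fun i _ => (hM i).le) (Finset.mem_univ i)
    linarith
  have h2 : P.len γ ≤ ‖P.μ γ‖ / R := by
    rw [le_div_iff₀ hR, mul_comm]; exact hsupp γ
  refine (h i γ).trans ((mul_le_mul h1 h2 (len_nonneg γ) ((hM i).le.trans h1)).trans (le_of_eq ?_))
  ring

variable (P) in
-- A bound on `|μ(γ)|` bounds the integer coordinates of `γ`. This finiteness is what reduces
-- statements about whole series to finitely many exponents.
theorem finite_norm_le (B : ℝ) : {γ : L | ‖P.μ γ‖ ≤ B}.Finite := by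
  obtain ⟨M, hM, h⟩ := P.exists_coord_le
  have hfin : (Set.pi Set.univ fun _ : Module.Free.ChooseBasisIndex ℤ L =>
      Set.Icc (-⌈M * B⌉) ⌈M * B⌉).Finite := Set.Finite.pi fun _ => Set.finite_Icc _ _
  refine (hfin.preimage (f := fun γ i => (Module.Free.chooseBasis ℤ L).repr γ i) ?_).subset ?_
  · intro a _ b _ hab
    exact (Module.Free.chooseBasis ℤ L).repr.injective (Finsupp.ext fun i => congrFun hab i)
  · intro γ hγ i _
    have h1 := (h γ i).trans (mul_le_mul_of_nonneg_left hγ hM.le)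
    have h2 := abs_le.1 (h1.trans (Int.le_ceil _))
    constructor
    · have := h2.1; exact_mod_cast this
    · have := h2.2; exact_mod_cast this

/-- Again the support property. It makes the part of `ℂ[L]` of a given degree at most
one-dimensional, so that a leading term is a single monomial. -/
theorem μ_injective : Function.Injective P.μ := by
  obtain ⟨M, hM, h⟩ := P.exists_coord_le
  refine (injective_iff_map_eq_zero _).2 fun γ hγ => ?_
  refine (Module.Free.chooseBasis ℤ L).repr.injective (Finsupp.ext fun i => ?_)
  have := h γ i
  rw [hγ, norm_zero, mul_zero] at this
  simpa using abs_nonpos_iff.1 this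

theorem norm_re_inv_mul_le (x : Circle) (m : ℂ) : |((x : ℂ)⁻¹ * m).re| ≤ ‖m‖ := by
  refine (Complex.abs_re_le_norm _).trans ?_
  rw [norm_mul, norm_inv, Circle.norm_coe]; simp

/-! ### The filter of sectorial neighbourhoods -/

theorem dirFilter_ne_zero (x : Circle) : ∀ᶠ z in dirFilter x, z ≠ 0 :=
  (eventually_mem_nhdsWithin (a := (0 : ℂ)) (s := {0}ᶜ)).filter_mono inf_le_left

theorem tendsto_norm_dirFilter (x : Circle) :
    Tendsto (fun z : ℂ => ‖z‖) (dirFilter x) (𝓝[>] 0) := by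
  refine tendsto_nhdsWithin_iff.2 ⟨?_, ?_⟩
  · have : Tendsto (fun z : ℂ => ‖z‖) (𝓝 0) (𝓝 0) := by
      simpa using (continuous_norm (E := ℂ)).tendsto 0
    exact this.mono_left (inf_le_left.trans nhdsWithin_le_nhds)
  · filter_upwards [dirFilter_ne_zero x] with z hz using norm_pos_iff.2 hz

theorem tendsto_inv_norm_dirFilter (x : Circle) :
    Tendsto (fun z : ℂ => ‖z‖⁻¹) (dirFilter x) atTop :=
  tendsto_inv_nhdsGT_zero.comp (tendsto_norm_dirFilter x)

/-- The ray through `x` approaches the boundary point, so the filter is proper and limits along it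
are unique. -/
theorem tendsto_ray (x : Circle) :
    Tendsto (fun t : ℝ => (t : ℂ) * x) (𝓝[>] 0) (dirFilter x) := by
  refine tendsto_inf.2 ⟨?_, tendsto_comap_iff.2 ?_⟩
  · refine tendsto_nhdsWithin_iff.2 ⟨?_, ?_⟩
    · have : Continuous fun t : ℝ => (t : ℂ) * (x : ℂ) := by fun_prop
      have h := this.tendsto 0
      simp only [Complex.ofReal_zero, zero_mul] at h
      exact h.mono_left nhdsWithin_le_nhds
    · filter_upwards [self_mem_nhdsWithin] with t ht
      have : t ≠ 0 := ne_of_gt ht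
      simp [this]
  · refine tendsto_const_nhds.congr' ?_
    filter_upwards [self_mem_nhdsWithin] with t ht
    have h0 : (0 : ℝ) < t := ht
    have h1 : (t : ℂ) ≠ 0 := by exact_mod_cast h0.ne'
    simp only [Function.comp, norm_mul, Complex.norm_real, Circle.norm_coe, mul_one,
      Real.norm_of_nonneg h0.le]
    field_simp

instance (x : Circle) : (dirFilter x).NeBot := (tendsto_ray x).neBot

/-- A property that holds near the boundary point `x` of the real blow-up holds near all boundary points
close to `x`. -/
theorem eventually_dirFilter {x : Circle} {p : ℂ → Prop} (h : ∀ᶠ z in dirFilter x, p z) :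
    ∀ᶠ y in 𝓝 x, ∀ᶠ z in dirFilter y, p z := by
  obtain ⟨s, hs, t, ht, hst⟩ := mem_inf_iff_superset.1 h
  obtain ⟨v, hv, hvt⟩ := mem_comap.1 ht
  have h1 : ∀ᶠ y : Circle in 𝓝 x, ∀ᶠ w in 𝓝 (y : ℂ), w ∈ v :=
    (continuous_subtype_val.tendsto x).eventually (eventually_eventually_nhds.2 hv)
  filter_upwards [h1] with y hy
  exact mem_inf_iff_superset.2 ⟨s, hs, _, preimage_mem_comap hy, fun z hz => hst ⟨hz.1, hvt hz.2⟩⟩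

/-- With `z = |z| w` and `w` close to `x`, one has `m/z = |z|⁻¹ (x⁻¹ m + (w⁻¹ - x⁻¹) m)`, and the
second term is at most `δ |m|`. The neighbourhood does not depend on `m`, which is what infinite
series require. -/
theorem eventually_re_div_le (x : Circle) {δ : ℝ} (hδ : 0 < δ) : ∀ᶠ z in dirFilter x, ∀ m : ℂ,
    (m / z).re ≤ (((x : ℂ)⁻¹ * m).re + δ * ‖m‖) * ‖z‖⁻¹ := by
  have hx0 : (x : ℂ) ≠ 0 := Circle.coe_ne_zero x
  have h1 : ∀ᶠ w in 𝓝 (x : ℂ), ‖w⁻¹ - (x : ℂ)⁻¹‖ < δ := by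
    have := (continuousAt_inv₀ hx0).tendsto.sub_const ((x : ℂ)⁻¹)
    rw [sub_self] at this
    simpa using this.eventually (Metric.ball_mem_nhds (0 : ℂ) hδ)
  have h2 : ∀ᶠ z in dirFilter x, ‖(z / (‖z‖ : ℂ))⁻¹ - (x : ℂ)⁻¹‖ < δ :=
    (h1.comap _).filter_mono inf_le_right
  filter_upwards [h2, dirFilter_ne_zero x] with z hz hz0 m
  have hzn : 0 < ‖z‖ := norm_pos_iff.2 hz0
  have e : m / z = ((‖z‖⁻¹ : ℝ) : ℂ) * ((x : ℂ)⁻¹ * m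
      + ((z / (‖z‖ : ℂ))⁻¹ - (x : ℂ)⁻¹) * m) := by
    have : (‖z‖ : ℂ) ≠ 0 := by exact_mod_cast hzn.ne'
    push_cast
    field_simp
    ring
  rw [e, Complex.re_ofReal_mul, Complex.add_re, mul_comm]
  have h4 : (((z / (‖z‖ : ℂ))⁻¹ - (x : ℂ)⁻¹) * m).re ≤ δ * ‖m‖ := by
    refine (Complex.re_le_norm _).trans ?_
    rw [norm_mul]
    gcongr
  gcongr

theorem eventually_re_div_le_half {x : Circle} {m : ℂ} (hm : ((x : ℂ)⁻¹ * m).re < 0) :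
    ∀ᶠ z in dirFilter x, (m / z).re ≤ ((x : ℂ)⁻¹ * m).re / 2 * ‖z‖⁻¹ := by
  have hm0 : 0 < ‖m‖ := by
    have := (abs_nonneg _).trans (norm_re_inv_mul_le x m)
    rcases this.eq_or_lt with h | h
    · simp [norm_eq_zero.1 h.symm] at hm
    · exact h
  -- This `δ` makes the error term exactly half of the leading term.
  have hδ : 0 < -((x : ℂ)⁻¹ * m).re / 2 / ‖m‖ := by
    have : 0 < -((x : ℂ)⁻¹ * m).re := by linarith
    positivity
  filter_upwards [eventually_re_div_le x hδ] with z hz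
  refine (hz m).trans (le_of_eq ?_)
  rw [div_mul_cancel₀ _ hm0.ne']
  ring

end PeriodMap

/-! ### The order on exponents in a given direction -/

theorem LtAt.eventually {x : Circle} {c c' : ℂ} (h : LtAt x c c') : ∀ᶠ y in 𝓝 x, LtAt y c c' := by
  have : Continuous fun y : Circle => ((y : ℂ)⁻¹ * (c - c')).re := by
    refine Complex.continuous_re.comp (Continuous.mul ?_ continuous_const)
    exact Continuous.inv₀ continuous_subtype_val Circle.coe_ne_zero
  exact this.continuousAt.eventually_lt continuousAt_const h

theorem LeAt.eventually {x : Circle} {c c' : ℂ} (h : LeAt x c c') : ∀ᶠ y in 𝓝 x, LeAt y c c' := by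
  rcases h with h | h
  · exact (LtAt.eventually h).mono fun y hy => Or.inl hy
  · exact Eventually.of_forall fun y => Or.inr h

theorem ltAt_iff {x : Circle} {c c' : ℂ} :
    LtAt x c c' ↔ ((x : ℂ)⁻¹ * c).re < ((x : ℂ)⁻¹ * c').re := by
  rw [LtAt, mul_sub, Complex.sub_re, sub_neg]

theorem LeAt.re_le {x : Circle} {c c' : ℂ} (h : LeAt x c c') :
    ((x : ℂ)⁻¹ * c).re ≤ ((x : ℂ)⁻¹ * c').re := by
  rcases h with h | h
  · exact (ltAt_iff.1 h).le
  · rw [h]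

theorem LeAt.trans_ltAt {x : Circle} {a b c : ℂ} (h : LeAt x a b) (h' : LtAt x b c) : LtAt x a c :=
  ltAt_iff.2 (h.re_le.trans_lt (ltAt_iff.1 h'))

theorem LtAt.trans_leAt {x : Circle} {a b c : ℂ} (h : LtAt x a b) (h' : LeAt x b c) : LtAt x a c :=
  ltAt_iff.2 ((ltAt_iff.1 h).trans_le h'.re_le)

theorem LeAt.trans {x : Circle} {a b c : ℂ} (h : LeAt x a b) (h' : LeAt x b c) : LeAt x a c := by
  rcases h with h | rfl
  · exact Or.inl (LtAt.trans_leAt h h')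
  · exact h'

theorem LeAt.refl (x : Circle) (a : ℂ) : LeAt x a a := Or.inr rfl

theorem leAt_add_right {x : Circle} {a b c : ℂ} : LeAt x (a + c) (b + c) ↔ LeAt x a b := by
  simp [LeAt, LtAt]

theorem ltAt_add_right {x : Circle} {a b c : ℂ} : LtAt x (a + c) (b + c) ↔ LtAt x a b := by
  simp [LtAt]

namespace PeriodMap

/-- The number `t x` is an exponent of prescribed real order `t` in the direction `x`. It serves
whenever an index strictly between two orders is needed. -/
theorem re_inv_mul_real (x : Circle) (t : ℝ) : ((x : ℂ)⁻¹ * (t * x)).re = t := by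
  have hx0 : (x : ℂ) ≠ 0 := Circle.coe_ne_zero x
  have : (x : ℂ)⁻¹ * (t * x) = t := by field_simp
  rw [this, Complex.ofReal_re]

end PeriodMap

end

section

namespace PeriodMap

/-! ### Exponential series with support in a translated cone -/

variable (P) in
/-- `A` is the coefficient family of a series `∑ A_γ exp (μ(γ) / z)` of finite norm for some `ϱ > 0`, the
support of which is contained in a translate of a cone that is strictly negative in the directions of `J`. -/
structure IsLaurent (J : Opens S1) (A : L → ℂ) : Prop where
  bound : ∃ K ε : ℝ, 0 < ε ∧ ∀ γ, A γ ≠ 0 → ∀ y ∈ J, ((y : ℂ)⁻¹ * P.μ γ).re ≤ K - ε * ‖P.μ γ‖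
  summable : ∃ ϱ : ℝ, 0 < ϱ ∧ Summable fun γ => ‖A γ‖ * ϱ ^ P.len γ

theorem IsLaurent.mono {I J : Opens S1} (h : J ≤ I) {A : L → ℂ} (hA : P.IsLaurent I A) :
    P.IsLaurent J A := by
  obtain ⟨K, ε, hε, hb⟩ := hA.bound
  exact ⟨⟨K, ε, hε, fun γ hγ y hy => hb γ hγ y (h hy)⟩, hA.summable⟩

theorem summable_of_le {A : L → ℂ} {ϱ ϱ' : ℝ} (h0 : 0 < ϱ) (h : ϱ ≤ ϱ')
    (hs : Summable fun γ => ‖A γ‖ * ϱ' ^ P.len γ) : Summable fun γ => ‖A γ‖ * ϱ ^ P.len γ :=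
  Summable.of_nonneg_of_le (fun _ => by positivity) (fun γ => by
    have := len_nonneg (P := P) γ
    gcongr) hs

theorem IsLaurent.add {J : Opens S1} {A B : L → ℂ} (hA : P.IsLaurent J A) (hB : P.IsLaurent J B) :
    P.IsLaurent J (A + B) := by
  obtain ⟨K, ε, hε, hb⟩ := hA.bound
  obtain ⟨K', ε', hε', hb'⟩ := hB.bound
  obtain ⟨ϱ, hϱ, hs⟩ := hA.summable
  obtain ⟨ϱ', hϱ', hs'⟩ := hB.summable
  refine ⟨⟨max K K', min ε ε', by positivity, fun γ hγ y hy => ?_⟩, min ϱ ϱ', by positivity, ?_⟩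
  · have hn := norm_nonneg (P.μ γ)
    by_cases h : A γ = 0
    · have h' : B γ ≠ 0 := fun h' => hγ (by simp [h, h'])
      refine (hb' γ h' y hy).trans (sub_le_sub (le_max_right _ _) ?_)
      gcongr; exact min_le_right _ _
    · refine (hb γ h y hy).trans (sub_le_sub (le_max_left _ _) ?_)
      gcongr; exact min_le_left _ _
  · have h1 := summable_of_le (P := P) (lt_min hϱ hϱ') (min_le_left _ _) hs
    have h2 := summable_of_le (P := P) (lt_min hϱ hϱ') (min_le_right _ _) hs'
    refine Summable.of_nonneg_of_le (fun _ => by positivity) (fun γ => ?_) (h1.add h2)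
    rw [← add_mul]
    gcongr
    exact norm_add_le _ _

theorem len_add_le (β γ : L) : P.len (β + γ) ≤ P.len β + P.len γ := by
  rw [len, TensorProduct.tmul_add]; exact map_add_le_add _ _ _

theorem IsLaurent.shift {J : Opens S1} {A : L → ℂ} (hA : P.IsLaurent J A) (β : L) :
    P.IsLaurent J (fun γ => A (γ - β)) := by
  obtain ⟨K, ε, hε, hb⟩ := hA.bound
  obtain ⟨ϱ, hϱ, hs⟩ := hA.summable
  -- The first correction to `K` bounds the order of `u^β`, the second one compares `‖μ(γ - β)‖`
  -- with `‖μ(γ)‖`. The radius is taken at most `1` so that a bound on lengths from above bounds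
  -- powers from below.
  refine ⟨⟨K + ‖P.μ β‖ + ε * ‖P.μ β‖, ε, hε, fun γ hγ y hy => ?_⟩, min ϱ 1, by positivity, ?_⟩
  · have h1 := hb _ hγ y hy
    have e : P.μ γ = P.μ (γ - β) + P.μ β := by rw [← map_add, sub_add_cancel]
    have h2 := (le_abs_self _).trans (norm_re_inv_mul_le y (P.μ β))
    have h3 : ‖P.μ γ‖ ≤ ‖P.μ (γ - β)‖ + ‖P.μ β‖ := by rw [e]; exact norm_add_le _ _
    have h4 : ((y : ℂ)⁻¹ * P.μ γ).re = ((y : ℂ)⁻¹ * P.μ (γ - β)).re + ((y : ℂ)⁻¹ * P.μ β).re := by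
      rw [e, mul_add, Complex.add_re]
    rw [h4]
    nlinarith
  · have h1 := summable_of_le (P := P) (lt_min hϱ one_pos) (min_le_left _ _) hs
    set r := min ϱ 1 with hr
    have hr0 : 0 < r := by positivity
    have hr1 : r ≤ 1 := min_le_right _ _
    have h2 : Summable fun γ => ‖A (γ - β)‖ * r ^ P.len (γ - β) :=
      h1.comp_injective (sub_left_injective (b := β))
    refine Summable.of_nonneg_of_le (fun _ => by positivity) (fun γ => ?_)
      (h2.mul_right (r ^ (-P.len (-β))))
    rw [mul_assoc, ← Real.rpow_add hr0]
    refine mul_le_mul_of_nonneg_left ?_ (norm_nonneg _)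
    refine Real.rpow_le_rpow_of_exponent_ge hr0 hr1 ?_
    have := len_add_le (P := P) γ (-β)
    rw [← sub_eq_add_neg] at this
    linarith

theorem isLaurent_of_finite {J : Opens S1} {A : L → ℂ} (s : Finset L) (h : ∀ γ, A γ ≠ 0 → γ ∈ s) :
    P.IsLaurent J A := by
  -- The order of `μ(γ)` is at most `‖μ(γ)‖ = 2 ‖μ(γ)‖ - ‖μ(γ)‖`, so cone slope `1` works for any
  -- finite support.
  refine ⟨⟨∑ γ ∈ s, 2 * ‖P.μ γ‖, 1, one_pos, fun γ hγ y hy => ?_⟩, 1, one_pos, ?_⟩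
  · have h1 := Finset.single_le_sum (f := fun γ => 2 * ‖P.μ γ‖) (fun i _ => by positivity) (h γ hγ)
    have h2 := (le_abs_self _).trans (norm_re_inv_mul_le y (P.μ γ))
    linarith
  · refine summable_of_ne_finset_zero (s := s) fun γ hγ => ?_
    have : A γ = 0 := by by_contra hcon; exact hγ (h γ hcon)
    simp [this]

theorem IsLaurent.sum {J : Opens S1} {ι : Type*} (s : Finset ι) {A : ι → L → ℂ}
    (hA : ∀ i ∈ s, P.IsLaurent J (A i)) : P.IsLaurent J (fun γ => ∑ i ∈ s, A i γ) := by
  classical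
  induction s using Finset.induction_on with
  | empty => exact isLaurent_of_finite ∅ (by simp)
  | insert i s hi ih =>
    have := (hA i (Finset.mem_insert_self i s)).add
      (ih fun j hj => hA j (Finset.mem_insert_of_mem hj))
    convert this using 1
    funext γ
    simp [Finset.sum_insert hi]

/-- The terms of an exponential series whose exponents are dominated by `c` in the direction `x`. -/
theorem IsLaurent.exists_norm_exp_le {J : Opens S1} {A : L → ℂ} (hA : P.IsLaurent J A) {x : S1}
    (hx : x ∈ J) {c : ℂ} (hc : ∀ γ, A γ ≠ 0 → LeAt x (P.μ γ) c) :
    ∃ C ϱ : ℝ, 0 ≤ C ∧ 0 < ϱ ∧ (Summable fun γ => ‖A γ‖ * ϱ ^ P.len γ) ∧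
      ∀ᶠ z in dirFilter x, ∀ γ, A γ ≠ 0 →
        ‖Complex.exp ((P.μ γ - c) / z)‖ ≤ C * ϱ ^ P.len γ := by
  obtain ⟨K, ε, hε, hb⟩ := hA.bound
  obtain ⟨ϱ, hϱ, hs⟩ := hA.summable
  obtain ⟨R, hR, hsupp⟩ := P.support
  -- Beyond this radius the slope of the cone outweighs `K`, the order of `c` and the angular error
  -- `ε/4`, and decay at rate `ε/4` remains.
  set B := 2 * (K + ‖c‖ + ε / 4 * ‖c‖) / ε with hB
  have hfin := P.finite_norm_le B
  -- For the finitely many exponents within the radius the exponential is only known to be at most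
  -- `1`; `C` is large enough to absorb that.
  set C : ℝ := 1 + ∑ γ ∈ hfin.toFinset, (ϱ ^ P.len γ)⁻¹ with hC
  have hC0 : ∀ γ ∈ hfin.toFinset, 0 ≤ (ϱ ^ P.len γ)⁻¹ := fun γ _ => by positivity
  have hC1 : 1 ≤ C := by have := Finset.sum_nonneg hC0; linarith
  refine ⟨C, ϱ, by linarith, hϱ, hs, ?_⟩
  -- For small `|z|` the decay `exp (-(ε/4) R ‖γ‖ / |z|)` is stronger than `ϱ^{‖γ‖}`.
  have h1 : ∀ᶠ z in dirFilter x, -Real.log ϱ ≤ (ε / 4 * R) * ‖z‖⁻¹ :=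
    ((tendsto_inv_norm_dirFilter x).const_mul_atTop (by positivity)).eventually_ge_atTop _
  have h2 : ∀ᶠ z in dirFilter x, ∀ γ ∈ hfin.toFinset, A γ ≠ 0 → ((P.μ γ - c) / z).re ≤ 0 := by
    refine (Finset.eventually_all _).2 fun γ _ => ?_
    by_cases h0 : A γ = 0
    · exact Eventually.of_forall fun z h => absurd h0 h
    rcases hc γ h0 with h | h
    · filter_upwards [eventually_re_div_le_half h] with z hz _
      refine hz.trans ?_
      have h' : ((x : ℂ)⁻¹ * (P.μ γ - c)).re < 0 := h
      have : 0 ≤ ‖z‖⁻¹ := by positivity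
      nlinarith
    · exact Eventually.of_forall fun z _ => by simp [h]
  filter_upwards [h1, h2, eventually_re_div_le x (show 0 < ε / 4 by positivity)] with z hz1 hz2 hz3 γ hγ
  have hϱl : 0 < ϱ ^ P.len γ := by positivity
  rw [Complex.norm_exp]
  by_cases hγB : ‖P.μ γ‖ ≤ B
  · have hmem : γ ∈ hfin.toFinset := hfin.mem_toFinset.2 hγB
    have h3 : (ϱ ^ P.len γ)⁻¹ ≤ C := by
      have := Finset.single_le_sum hC0 hmem
      linarith
    calc _ ≤ 1 := Real.exp_le_one_iff.2 (hz2 γ hmem hγ)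
      _ = (ϱ ^ P.len γ)⁻¹ * ϱ ^ P.len γ := (inv_mul_cancel₀ hϱl.ne').symm
      _ ≤ _ := by gcongr
  · push Not at hγB
    refine le_trans ?_ (le_mul_of_one_le_left hϱl.le hC1)
    rw [Real.rpow_def_of_pos hϱ]
    refine Real.exp_le_exp.2 ((hz3 _).trans ?_)
    have h4 := hb γ hγ x hx
    have h5 := (neg_le_abs _).trans (norm_re_inv_mul_le x c)
    have h6 := norm_sub_le (P.μ γ) c
    rw [hB, div_lt_iff₀ hε] at hγB
    have h7 : ((x : ℂ)⁻¹ * (P.μ γ - c)).re + ε / 4 * ‖P.μ γ - c‖ ≤ -(ε / 4 * (R * P.len γ)) := by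
      rw [mul_sub, Complex.sub_re]
      have h8 : R * P.len γ ≤ _ := hsupp γ
      nlinarith
    have h9 : 0 ≤ ‖z‖⁻¹ := by positivity
    have h10 := mul_le_mul_of_nonneg_right h7 h9
    have h11 := mul_le_mul_of_nonneg_right hz1 (len_nonneg (P := P) γ)
    nlinarith

theorem u_eq (γ : L) (c z : ℂ) :
    P.u γ z = Complex.exp (c / z) * Complex.exp ((P.μ γ - c) / z) := by
  rw [u, ← Complex.exp_add]; congr 1; ring

theorem IsLaurent.exists_leAt {J : Opens S1} {A : L → ℂ} (hA : P.IsLaurent J A) {x : S1}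
    (hx : x ∈ J) : ∃ c, ∀ γ, A γ ≠ 0 → LeAt x (P.μ γ) c := by
  obtain ⟨K, ε, hε, hb⟩ := hA.bound
  refine ⟨((K + 1 : ℝ) : ℂ) * x, fun γ hγ => Or.inl (ltAt_iff.2 ?_)⟩
  rw [re_inv_mul_real]
  have := hb γ hγ x hx
  have h2 : 0 ≤ ε * ‖P.μ γ‖ := by positivity
  linarith

theorem IsLaurent.eventually_summable {J : Opens S1} {A : L → ℂ} (hA : P.IsLaurent J A) {x : S1}
    (hx : x ∈ J) : ∀ᶠ z in dirFilter x, Summable fun γ => ‖A γ * P.u γ z‖ := by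
  obtain ⟨c, hc⟩ := hA.exists_leAt hx
  obtain ⟨C, ϱ, hC, hϱ, hs, h⟩ := hA.exists_norm_exp_le hx hc
  filter_upwards [h] with z hz
  refine Summable.of_nonneg_of_le (fun _ => norm_nonneg _) (fun γ => ?_)
    (hs.mul_left (‖Complex.exp (c / z)‖ * C))
  by_cases h0 : A γ = 0
  · simp [h0]
  rw [u_eq γ c, norm_mul, norm_mul]
  calc _ ≤ ‖A γ‖ * (‖Complex.exp (c / z)‖ * (C * ϱ ^ P.len γ)) := by gcongr; exact hz γ h0
    _ = _ := by ring

theorem IsLaurent.eventually_expSum_add {J : Opens S1} {A B : L → ℂ} (hA : P.IsLaurent J A)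
    (hB : P.IsLaurent J B) {x : S1} (hx : x ∈ J) :
    P.expSum (A + B) =ᶠ[dirFilter x] P.expSum A + P.expSum B := by
  filter_upwards [hA.eventually_summable hx, hB.eventually_summable hx] with z h1 h2
  rw [Pi.add_apply, expSum, expSum, expSum, ← h1.of_norm.tsum_add h2.of_norm]
  exact tsum_congr fun γ => by rw [Pi.add_apply, add_mul]

theorem expSum_shift (A : L → ℂ) (β : L) (z : ℂ) :
    P.expSum (fun γ => A (γ - β)) z = P.u β z * P.expSum A z := by
  rw [expSum, expSum, ← tsum_mul_left, ← (Equiv.addRight β).tsum_eq]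
  refine tsum_congr fun γ => ?_
  simp only [Equiv.coe_addRight, add_sub_cancel_right, u_add]
  ring

theorem IsLaurent.eventually_expSum_sum {J : Opens S1} {ι : Type*} (s : Finset ι) {A : ι → L → ℂ}
    (hA : ∀ i ∈ s, P.IsLaurent J (A i)) {x : S1} (hx : x ∈ J) :
    ∀ᶠ z in dirFilter x, P.expSum (fun γ => ∑ i ∈ s, A i γ) z = ∑ i ∈ s, P.expSum (A i) z := by
  have : ∀ᶠ z in dirFilter x, ∀ i ∈ s, Summable fun γ => ‖A i γ * P.u γ z‖ :=
    (Finset.eventually_all s).2 fun i hi => (hA i hi).eventually_summable hx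
  filter_upwards [this] with z hz
  simp only [expSum, Finset.sum_mul]
  exact Summable.tsum_finsetSum fun i hi => (hz i hi).of_norm

/-- The exponents of a series that are dominated by `c` at `x` are dominated by `c` near `x`. -/
theorem IsLaurent.eventually_leAt {J : Opens S1} {A : L → ℂ} (hA : P.IsLaurent J A) {x : S1}
    (hx : x ∈ J) {c : ℂ} (hc : ∀ γ, A γ ≠ 0 → LeAt x (P.μ γ) c) :
    ∀ᶠ y in 𝓝 x, ∀ γ, A γ ≠ 0 → LeAt y (P.μ γ) c := by
  obtain ⟨K, ε, hε, hb⟩ := hA.bound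
  -- Exponents beyond this radius have order below `-‖c‖` in every direction of `J`, so only
  -- finitely many need the openness of domination.
  have hfin := P.finite_norm_le ((K + ‖c‖) / ε)
  have h1 : ∀ᶠ y in 𝓝 x, ∀ γ ∈ hfin.toFinset, A γ ≠ 0 → LeAt y (P.μ γ) c := by
    refine (Finset.eventually_all _).2 fun γ _ => ?_
    by_cases h0 : A γ = 0
    · exact Eventually.of_forall fun z h => absurd h0 h
    · exact (hc γ h0).eventually.mono fun y hy _ => hy
  filter_upwards [h1, J.isOpen.mem_nhds hx] with y hy hyJ γ hγ
  by_cases hγB : ‖P.μ γ‖ ≤ (K + ‖c‖) / ε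
  · exact hy γ (hfin.mem_toFinset.2 hγB) hγ
  · push Not at hγB
    rw [div_lt_iff₀ hε] at hγB
    refine Or.inl (ltAt_iff.2 ?_)
    have h4 := hb γ hγ y hyJ
    have h5 := (abs_le.1 (norm_re_inv_mul_le y c)).1
    linarith

/-- The series multiplied by `exp (-c/z)` is dominated termwise by a convergent series independent
of `z`. It is even bounded, so the exponent `N = 0` suffices. -/
theorem IsLaurent.moderateAt {J : Opens S1} {A : L → ℂ} (hA : P.IsLaurent J A) {x : S1}
    (hx : x ∈ J) {c : ℂ} (hc : ∀ γ, A γ ≠ 0 → LeAt x (P.μ γ) c) :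
    ModerateAt x c (P.expSum A : FunGerm x) := by
  obtain ⟨C, ϱ, hC, hϱ, hs, h⟩ := hA.exists_norm_exp_le hx hc
  refine ⟨_, rfl, 0, C * ∑' γ, ‖A γ‖ * ϱ ^ P.len γ, ?_⟩
  filter_upwards [h, hA.eventually_summable hx] with z hz hsz
  have e : Complex.exp (-c / z) * P.expSum A z
      = ∑' γ, A γ * Complex.exp ((P.μ γ - c) / z) := by
    rw [expSum, ← tsum_mul_left]
    refine tsum_congr fun γ => ?_
    rw [u_eq γ c, neg_div, Complex.exp_neg]
    have := Complex.exp_ne_zero (c / z)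
    field_simp
  rw [e, pow_zero, mul_one, ← tsum_mul_left]
  refine tsum_of_norm_bounded (hs.mul_left C).hasSum fun γ => ?_
  by_cases h0 : A γ = 0
  · simp [h0]
  rw [norm_mul]
  calc _ ≤ ‖A γ‖ * (C * ϱ ^ P.len γ) := by gcongr; exact hz γ h0
    _ = _ := by ring

/-- A series with a unique dominant exponent in the direction `x`. -/
theorem IsLaurent.tendsto_of_dominant {J : Opens S1} {A : L → ℂ} (hA : P.IsLaurent J A) {x : S1}
    (hx : x ∈ J) {β : L} (hβ : ∀ γ, A γ ≠ 0 → γ ≠ β → LtAt x (P.μ γ) (P.μ β)) :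
    Tendsto (fun z => Complex.exp (-P.μ β / z) * P.expSum A z) (dirFilter x) (𝓝 (A β)) := by
  classical
  have hc : ∀ γ, A γ ≠ 0 → LeAt x (P.μ γ) (P.μ β) := fun γ hγ => by
    by_cases h : γ = β
    · exact h ▸ LeAt.refl _ _
    · exact Or.inl (hβ γ hγ h)
  obtain ⟨C, ϱ, hC, hϱ, hs, h⟩ := hA.exists_norm_exp_le hx hc
  have e : ∀ z, Complex.exp (-P.μ β / z) * P.expSum A z
      = ∑' γ, A γ * Complex.exp ((P.μ γ - P.μ β) / z) := by
    intro z
    rw [expSum, ← tsum_mul_left]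
    refine tsum_congr fun γ => ?_
    rw [u_eq γ (P.μ β), neg_div, Complex.exp_neg]
    have := Complex.exp_ne_zero (P.μ β / z)
    field_simp
  simp only [e]
  -- All terms except the one of `β` decay exponentially, and the uniform bound of the previous
  -- lemma is the dominating series.
  have key := tendsto_tsum_of_dominated_convergence (𝓕 := dirFilter x)
    (f := fun z γ => A γ * Complex.exp ((P.μ γ - P.μ β) / z))
    (g := fun γ => if γ = β then A β else 0) (hs.mul_left C) ?_ ?_
  · rw [tsum_ite_eq] at key
    exact key
  · intro γ
    by_cases hγ : γ = β
    · subst hγ; simp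
    rw [if_neg hγ]
    by_cases h0 : A γ = 0
    · simp [h0]
    rw [← mul_zero (A γ)]
    refine Tendsto.const_mul _ (squeeze_zero_norm' (a := fun z : ℂ => Real.exp
      (((x : ℂ)⁻¹ * (P.μ γ - P.μ β)).re / 2 * ‖z‖⁻¹)) ?_ ?_)
    · filter_upwards [eventually_re_div_le_half (hβ γ h0 hγ)] with z hz
      rw [Complex.norm_exp]
      exact Real.exp_le_exp.2 hz
    · refine Real.tendsto_exp_atBot.comp ?_
      refine (tendsto_inv_norm_dirFilter x).const_mul_atTop_of_neg ?_
      have : ((x : ℂ)⁻¹ * (P.μ γ - P.μ β)).re < 0 := hβ γ h0 hγ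
      linarith
  · filter_upwards [h] with z hz γ
    by_cases h0 : A γ = 0
    · simp [h0]
    rw [norm_mul]
    calc _ ≤ ‖A γ‖ * (C * ϱ ^ P.len γ) := by gcongr; exact hz γ h0
      _ = _ := by ring

end PeriodMap

end

section

namespace PeriodMap

/-! ### Growth of germs -/

section Moderate

variable {x : S1} {c c' : ℂ} {f g : FunGerm x}

theorem ModerateAt.add (hf : ModerateAt x c f) (hg : ModerateAt x c g) :
    ModerateAt x c (f + g) := by
  obtain ⟨f, rfl, N, K, h⟩ := hf
  obtain ⟨g, rfl, N', K', h'⟩ := hg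
  refine ⟨f + g, rfl, max N N', |K| + |K'|, ?_⟩
  have h1 := (tendsto_inv_norm_dirFilter x).eventually_ge_atTop 1
  filter_upwards [h, h', h1] with z hz hz' hz1
  have a1 : K * ‖z‖⁻¹ ^ N ≤ |K| * ‖z‖⁻¹ ^ max N N' :=
    mul_le_mul (le_abs_self K) (pow_le_pow_right₀ hz1 (le_max_left _ _)) (by positivity)
      (abs_nonneg _)
  have a2 : K' * ‖z‖⁻¹ ^ N' ≤ |K'| * ‖z‖⁻¹ ^ max N N' :=
    mul_le_mul (le_abs_self K') (pow_le_pow_right₀ hz1 (le_max_right _ _)) (by positivity)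
      (abs_nonneg _)
  rw [Pi.add_apply, mul_add, add_mul]
  exact (norm_add_le _ _).trans (add_le_add (hz.trans a1) (hz'.trans a2))

theorem ModerateAt.mul (hf : ModerateAt x c f) (hg : ModerateAt x c' g) :
    ModerateAt x (c + c') (f * g) := by
  obtain ⟨f, rfl, N, K, h⟩ := hf
  obtain ⟨g, rfl, N', K', h'⟩ := hg
  refine ⟨f * g, rfl, N + N', K * K', ?_⟩
  filter_upwards [h, h'] with z hz hz'
  have e : Complex.exp (-(c + c') / z) * (f * g) z
      = (Complex.exp (-c / z) * f z) * (Complex.exp (-c' / z) * g z) := by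
    have : -(c + c') / z = -c / z + -c' / z := by ring
    rw [this, Complex.exp_add, Pi.mul_apply]; ring
  rw [e, norm_mul, pow_add]
  calc _ ≤ (K * ‖z‖⁻¹ ^ N) * (K' * ‖z‖⁻¹ ^ N') :=
        mul_le_mul hz hz' (norm_nonneg _) ((norm_nonneg _).trans hz)
    _ = _ := by ring

theorem moderateAt_exp (x : S1) (h : LeAt x c c') :
    ModerateAt x c' ((fun z => Complex.exp (c / z) : ℂ → ℂ) : FunGerm x) := by
  refine ⟨_, rfl, 0, 1, ?_⟩
  have h1 : ∀ᶠ z in dirFilter x, ((c - c') / z).re ≤ 0 := by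
    rcases h with h | h
    · filter_upwards [eventually_re_div_le_half h] with z hz
      refine hz.trans ?_
      have h' : ((x : ℂ)⁻¹ * (c - c')).re < 0 := h
      have : 0 ≤ ‖z‖⁻¹ := by positivity
      nlinarith
    · exact Eventually.of_forall fun z => by simp [h]
  filter_upwards [h1] with z hz
  rw [← Complex.exp_add, Complex.norm_exp]
  have : -c' / z + c / z = (c - c') / z := by ring
  rw [this, pow_zero, mul_one]
  exact Real.exp_le_one_iff.2 hz

theorem moderateAt_zero : ModerateAt x c (0 : FunGerm x) :=
  ⟨0, rfl, 0, 0, Eventually.of_forall fun z => by simp⟩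

theorem moderateAt_congr {f : ℂ → ℂ} (h : ModerateAt x c (f : FunGerm x)) : ∃ (N : ℕ) (K : ℝ),
    ∀ᶠ z in dirFilter x, ‖Complex.exp (-c / z) * f z‖ ≤ K * (‖z‖⁻¹) ^ N := by
  obtain ⟨g, hg, N, K, h⟩ := h
  refine ⟨N, K, ?_⟩
  filter_upwards [h, Germ.coe_eq.1 hg] with z hz hz'
  rwa [hz']

end Moderate

/-- A dominant exponent of a series of moderate growth relative to `exp (c / z)`. -/
theorem IsLaurent.re_le_of_dominant {J : Opens S1} {A : L → ℂ} (hA : P.IsLaurent J A) {x : S1}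
    (hx : x ∈ J) {β : L} (hβ0 : A β ≠ 0) (hβ : ∀ γ, A γ ≠ 0 → γ ≠ β → LtAt x (P.μ γ) (P.μ β))
    {c : ℂ} {N : ℕ} {K : ℝ}
    (h : ∀ᶠ z in dirFilter x, ‖Complex.exp (-c / z) * P.expSum A z‖ ≤ K * (‖z‖⁻¹) ^ N) :
    ((x : ℂ)⁻¹ * (P.μ β - c)).re ≤ 0 := by
  by_contra! hcon
  set η := ((x : ℂ)⁻¹ * (P.μ β - c)).re with hη
  have h1 := (hA.tendsto_of_dominant hx hβ).norm
  have h1' : ∀ᶠ z in dirFilter x, ‖A β‖ / 2 < ‖Complex.exp (-P.μ β / z) * P.expSum A z‖ :=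
    h1.eventually_const_lt (by have := norm_pos_iff.2 hβ0; linarith)
  -- If `μ(β)` had larger order than `c`, passing from the factor `exp (-c/z)` to `exp (-μ(β)/z)`
  -- would gain exponential decay. This beats the polynomial bound and contradicts the nonzero limit
  -- `A β`.
  have h2 : ∀ᶠ z in dirFilter x, ((c - P.μ β) / z).re ≤ -η / 2 * ‖z‖⁻¹ := by
    have e : ((x : ℂ)⁻¹ * (c - P.μ β)).re = -η := by
      rw [hη, ← Complex.neg_re]; congr 1; ring
    have := eventually_re_div_le_half (x := x) (m := c - P.μ β) (by rw [e]; linarith)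
    rwa [e] at this
  have h3 : Tendsto (fun z : ℂ => K * (‖z‖⁻¹ ^ N * Real.exp (-(η / 2) * ‖z‖⁻¹))) (dirFilter x)
      (𝓝 (K * 0)) := by
    refine Tendsto.const_mul K ?_
    have := (Real.tendsto_pow_mul_exp_neg_atTop_nhds_zero N).comp
      ((tendsto_inv_norm_dirFilter x).const_mul_atTop (show 0 < η / 2 by linarith))
    have h4 := this.const_mul ((η / 2) ^ N)⁻¹
    rw [mul_zero] at h4
    refine h4.congr fun z => ?_
    have : η / 2 ≠ 0 := by linarith
    simp only [Function.comp, mul_pow, neg_mul]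
    field_simp
  rw [mul_zero] at h3
  have h5 : ∀ᶠ z in dirFilter x, K * (‖z‖⁻¹ ^ N * Real.exp (-(η / 2) * ‖z‖⁻¹)) < ‖A β‖ / 2 :=
    h3.eventually_lt_const (by have := norm_pos_iff.2 hβ0; linarith)
  obtain ⟨z, hz, hz1, hz2, hz5⟩ := (h.and (h1'.and (h2.and h5))).exists
  have e : Complex.exp (-P.μ β / z) * P.expSum A z
      = Complex.exp ((c - P.μ β) / z) * (Complex.exp (-c / z) * P.expSum A z) := by
    rw [← mul_assoc, ← Complex.exp_add]; congr 2; ring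
  rw [e, norm_mul, Complex.norm_exp] at hz1
  have h6 : Real.exp ((c - P.μ β) / z).re ≤ Real.exp (-(η / 2) * ‖z‖⁻¹) :=
    Real.exp_le_exp.2 (hz2.trans (le_of_eq (by ring)))
  have h7 := mul_le_mul h6 hz (norm_nonneg _) (by positivity)
  nlinarith

/-- As a function of the angle the order of an exponent is a sinusoid. Both the choice of generic
directions and the maximum principle rest on this formula. -/
theorem re_inv_mul_exp_mul (x : Circle) (t : ℝ) (m : ℂ) :
    (((x * Circle.exp t : Circle) : ℂ)⁻¹ * m).re =
      ((x : ℂ)⁻¹ * m).re * Real.cos t + ((x : ℂ)⁻¹ * m).im * Real.sin t := by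
  have h2 : ((x * Circle.exp t : Circle) : ℂ)⁻¹ * m
      = ((x : ℂ)⁻¹ * m) * Complex.exp (((-t : ℝ) : ℂ) * Complex.I) := by
    rw [Circle.coe_mul, Circle.coe_exp, mul_inv, ← Complex.exp_neg]
    push_cast
    ring_nf
  rw [h2, Complex.mul_re, Complex.exp_ofReal_mul_I_re, Complex.exp_ofReal_mul_I_im,
    Real.cos_neg, Real.sin_neg]
  ring

/-- The expression is `|w| cos (t - arg w)` with `w = x⁻¹ m ≠ 0`, and the cosine has countably many
zeros. -/
theorem countable_re_eq_zero (x : Circle) {m : ℂ} (hm : m ≠ 0) :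
    {t : ℝ | (((x * Circle.exp t : Circle) : ℂ)⁻¹ * m).re = 0}.Countable := by
  set w := (x : ℂ)⁻¹ * m with hw
  have hw0 : w ≠ 0 := mul_ne_zero (inv_ne_zero (Circle.coe_ne_zero x)) hm
  refine (Set.countable_range fun k : ℤ => Complex.arg w + (2 * k + 1) * Real.pi / 2).mono ?_
  intro t ht
  simp only [Set.mem_ofPred_eq, re_inv_mul_exp_mul] at ht
  rw [← hw] at ht
  have h1 : ‖w‖ * Real.cos (t - Complex.arg w) = 0 := by
    rw [Real.cos_sub, ← ht, ← Complex.norm_mul_cos_arg w, ← Complex.norm_mul_sin_arg w]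
    simp only [Complex.norm_mul_cos_arg, Complex.norm_mul_sin_arg]
    rw [mul_add]
    conv_rhs => rw [← Complex.norm_mul_cos_arg w, ← Complex.norm_mul_sin_arg w]
    ring
  rcases mul_eq_zero.1 h1 with h | h
  · exact absurd (norm_eq_zero.1 h) hw0
  · obtain ⟨k, hk⟩ := Real.cos_eq_zero_iff.1 h
    exact ⟨k, by simp only; linarith⟩

/-- Arbitrarily close to a direction `x` in which `Re (x⁻¹ m) ≥ 0`, `m ≠ 0`, there are directions `y` in which
`Re (y⁻¹ m) > 0` and which are not Stokes directions of any pair of exponents. -/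
theorem exists_generic (P : PeriodMap L) {x : Circle} {U : Set Circle} (hU : U ∈ 𝓝 x) {m : ℂ}
    (hm : m ≠ 0) (h : 0 ≤ ((x : ℂ)⁻¹ * m).re) :
    ∃ y ∈ U, 0 < ((y : ℂ)⁻¹ * m).re ∧ ∀ γ : L, γ ≠ 0 → ((y : ℂ)⁻¹ * P.μ γ).re ≠ 0 := by
  have hc : Continuous fun t : ℝ => x * Circle.exp t := by fun_prop
  have hn : (fun t : ℝ => x * Circle.exp t) ⁻¹' interior U ∈ 𝓝 (0 : ℝ) :=
    hc.continuousAt.preimage_mem_nhds (by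
      simp only [Circle.exp_zero, mul_one]; exact interior_mem_nhds.2 hU)
  obtain ⟨r, hr, hball⟩ := Metric.mem_nhds_iff.1 hn
  set w := (x : ℂ)⁻¹ * m with hw
  have hw0 : w ≠ 0 := mul_ne_zero (inv_ne_zero (Circle.coe_ne_zero x)) hm
  obtain ⟨δ, hδ, hδr, hδ1⟩ : ∃ δ : ℝ, 0 < δ ∧ δ < r ∧ δ < 1 :=
    ⟨min (r / 2) (1 / 2), by positivity, (min_le_left _ _).trans_lt (by linarith),
      (min_le_right _ _).trans_lt (by norm_num)⟩
  have hsin : 0 < Real.sin δ := Real.sin_pos_of_pos_of_lt_pi hδ (by linarith [Real.pi_gt_three])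
  have hcos : 0 < Real.cos δ := Real.cos_pos_of_mem_Ioo ⟨by linarith [Real.pi_gt_three],
    by linarith [Real.pi_gt_three]⟩
  -- If the real part is zero, the imaginary part is not, and a small rotation towards its sign
  -- makes the real part positive.
  have hex : ∃ t : ℝ, |t| < r ∧ 0 < w.re * Real.cos t + w.im * Real.sin t := by
    rcases h.eq_or_lt with h | h
    · have him : w.im ≠ 0 := fun him => hw0 (Complex.ext h.symm him)
      rcases lt_or_gt_of_ne him with h' | h'
      · refine ⟨-δ, by rwa [abs_neg, abs_of_pos hδ], ?_⟩
        rw [Real.sin_neg, ← h]; nlinarith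
      · refine ⟨δ, by rwa [abs_of_pos hδ], ?_⟩
        rw [← h]; nlinarith
    · exact ⟨0, by simpa using hr, by simpa using h⟩
  obtain ⟨t, ht, htpos⟩ := hex
  set V := {s : ℝ | 0 < (((x * Circle.exp s : Circle) : ℂ)⁻¹ * m).re} ∩
    ((fun t : ℝ => x * Circle.exp t) ⁻¹' interior U) with hV
  have hVo : IsOpen V := by
    refine IsOpen.inter ?_ (isOpen_interior.preimage hc)
    simp only [re_inv_mul_exp_mul]
    exact isOpen_lt continuous_const (by fun_prop)
  have hVn : V.Nonempty := by
    refine ⟨t, ?_, hball (by simpa using ht)⟩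
    simp only [Set.mem_ofPred_eq, re_inv_mul_exp_mul]
    exact htpos
  -- The lattice is countable and each nonzero `γ` excludes countably many angles, so the admissible
  -- angles are dense.
  have hcount : (⋃ γ : {γ : L // γ ≠ 0},
      {t : ℝ | (((x * Circle.exp t : Circle) : ℂ)⁻¹ * P.μ γ.1).re = 0}).Countable := by
    have : Countable L := (Module.Free.chooseBasis ℤ L).repr.injective.countable
    refine Set.countable_iUnion fun γ => countable_re_eq_zero x fun h => γ.2 ?_
    exact μ_injective (h.trans (map_zero _).symm)
  obtain ⟨s, hs, hs'⟩ := (hcount.dense_compl ℝ).inter_open_nonempty V hVo hVn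
  refine ⟨x * Circle.exp s, interior_subset hs.2, hs.1, fun γ hγ h0 => hs' ?_⟩
  exact Set.mem_iUnion.2 ⟨⟨γ, hγ⟩, h0⟩

/-- In a nonempty Laurent support there is an exponent of maximal growth in a given direction. -/
theorem IsLaurent.exists_max {J : Opens S1} {A : L → ℂ} (hA : P.IsLaurent J A) {x : S1}
    (hx : x ∈ J) {γ₀ : L} (h0 : A γ₀ ≠ 0) : ∃ β, A β ≠ 0 ∧
      ∀ γ, A γ ≠ 0 → ((x : ℂ)⁻¹ * P.μ γ).re ≤ ((x : ℂ)⁻¹ * P.μ β).re := by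
  obtain ⟨K, ε, hε, hb⟩ := hA.bound
  -- The cone bound confines the exponents that grow at least as fast as `γ₀` to a bounded region.
  have hfin : {γ | A γ ≠ 0 ∧ ((x : ℂ)⁻¹ * P.μ γ₀).re ≤ ((x : ℂ)⁻¹ * P.μ γ).re}.Finite := by
    refine (P.finite_norm_le ((K - ((x : ℂ)⁻¹ * P.μ γ₀).re) / ε)).subset fun γ hγ => ?_
    have h1 := hb γ hγ.1 x hx
    have h2 := hγ.2
    rw [Set.mem_ofPred_eq, le_div_iff₀ hε]
    linarith
  obtain ⟨β, hβ, hmax⟩ := Set.exists_max_image _ (fun γ => ((x : ℂ)⁻¹ * P.μ γ).re) hfin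
    ⟨γ₀, h0, le_rfl⟩
  refine ⟨β, hβ.1, fun γ hγ => ?_⟩
  by_cases h : ((x : ℂ)⁻¹ * P.μ γ₀).re ≤ ((x : ℂ)⁻¹ * P.μ γ).re
  · exact hmax γ ⟨hγ, h⟩
  · exact (not_le.1 h).le.trans hβ.2

/-- At `x` itself several exponents may have the same order and cancel. Moderate growth persists in
nearby directions, and among these there is a generic one in which a violating `γ` still grows
faster than `exp (c/z)`. There a single exponent dominates the series, and no cancellation is
possible. -/
theorem IsLaurent.leAt_of_moderateAt {J : Opens S1} {A : L → ℂ} (hA : P.IsLaurent J A) {x : S1}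
    (hx : x ∈ J) {c : ℂ} (h : ModerateAt x c (P.expSum A : FunGerm x)) {γ : L} (hγ : A γ ≠ 0) :
    LeAt x (P.μ γ) c := by
  by_contra hcon
  rw [LeAt, not_or, LtAt, not_lt] at hcon
  obtain ⟨N, K, h⟩ := moderateAt_congr h
  obtain ⟨y, ⟨hy1, hy2⟩, hypos, hgen⟩ := exists_generic P
    (inter_mem (eventually_dirFilter h) (J.isOpen.mem_nhds hx)) (sub_ne_zero.2 hcon.2) hcon.1
  obtain ⟨β, hβ0, hβ⟩ := hA.exists_max hy2 hγ
  have h1 := hA.re_le_of_dominant hy2 hβ0 (fun γ' hγ' hne => ltAt_iff.2 ?_) hy1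
  · have h2 := hβ γ hγ
    rw [mul_sub, Complex.sub_re] at h1 hypos
    linarith
  -- Genericity of `y` excludes ties, so the maximal exponent is strictly dominant.
  · refine lt_of_le_of_ne (hβ γ' hγ') fun he => hgen (γ' - β) (sub_ne_zero.2 hne) ?_
    rw [map_sub, mul_sub, Complex.sub_re, he, sub_self]

end PeriodMap

end

section

namespace PeriodMap

/-! ### Coefficients of germs of sections of `𝒜_μ` -/

/-- The uniform estimate at `x` survives a small change of direction at the price of half the
constant. It turns the sign condition in `IsCoeff` into the cone condition in `IsLaurent`. -/
theorem exists_re_le_nhds {V : Opens S1} {x : S1} (hx : x ∈ V) :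
    ∃ (J : Opens S1) (ε : ℝ), J ≤ V ∧ x ∈ J ∧ 0 < ε ∧ ∀ m : ℂ, (∀ y ∈ V, LeAt y m 0) →
      ∀ y ∈ J, ((y : ℂ)⁻¹ * m).re ≤ -ε * ‖m‖ := by
  obtain ⟨ε, hε, h⟩ := exists_re_le hx
  have hc : Continuous fun y : Circle => ‖(y : ℂ)⁻¹ - (x : ℂ)⁻¹‖ :=
    ((Continuous.inv₀ continuous_subtype_val Circle.coe_ne_zero).sub continuous_const).norm
  let J : Opens S1 := V ⊓ ⟨{y : Circle | ‖(y : ℂ)⁻¹ - (x : ℂ)⁻¹‖ < ε / 2},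
    isOpen_lt hc continuous_const⟩
  have hxJ : x ∈ J := by
    refine ⟨hx, ?_⟩
    change ‖(x : ℂ)⁻¹ - (x : ℂ)⁻¹‖ < ε / 2
    rw [sub_self, norm_zero]; positivity
  refine ⟨J, ε / 2, inf_le_left, hxJ, by positivity, fun m hm y hy => ?_⟩
  have h1 := h m hm
  have h2 : ‖(y : ℂ)⁻¹ - (x : ℂ)⁻¹‖ < ε / 2 := hy.2
  have e : (y : ℂ)⁻¹ * m = (x : ℂ)⁻¹ * m + ((y : ℂ)⁻¹ - (x : ℂ)⁻¹) * m := by ring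
  rw [e, Complex.add_re]
  have h4 : (((y : ℂ)⁻¹ - (x : ℂ)⁻¹) * m).re ≤ ε / 2 * ‖m‖ := by
    refine (Complex.re_le_norm _).trans ?_
    rw [norm_mul]
    gcongr
  linarith

/-- For `‖μ(γ)‖ > K/ε` the cone bound is negative, so all but finitely many exponents are negative
on `J`. The remaining ones are split off as a finite sum of monomials. -/
theorem IsLaurent.isRep {J : Opens S1} {A : L → ℂ} (hA : P.IsLaurent J A) :
    ∃ f, P.IsRep J f ∧ ∀ x ∈ J, P.expSum A =ᶠ[dirFilter x] f := by
  classical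
  obtain ⟨K, ε, hε, hb⟩ := hA.bound
  obtain ⟨ϱ, hϱ, hs⟩ := hA.summable
  have hfin := P.finite_norm_le (K / ε)
  set s := hfin.toFinset with hs'
  set B : L → ℂ := fun γ => if γ ∈ s then 0 else A γ with hB
  have hBc : P.IsCoeff J B := by
    refine ⟨fun γ hγ y hy => Or.inl ?_, ϱ, hϱ, ?_⟩
    · have h1 : γ ∉ s := fun h => hγ (by simp [hB, h])
      have h2 : A γ ≠ 0 := fun h => hγ (by simp [hB, h])
      have h3 := hb γ h2 y hy
      rw [hs', hfin.mem_toFinset, Set.mem_ofPred_eq, not_le, div_lt_iff₀ hε] at h1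
      rw [LtAt, sub_zero]
      linarith
    · refine Summable.of_nonneg_of_le (fun _ => by positivity) (fun γ => ?_) hs
      simp only [hB]
      split_ifs
      · rw [norm_zero, zero_mul]; positivity
      · exact le_rfl
  refine ⟨_, isRep_of_fintype (P := P) (I := J) (ι := Option s)
    (fun i => i.elim 0 Subtype.val) (fun i => i.elim B fun γ => Pi.single 0 (A γ)) ?_, ?_⟩
  · rintro (_ | i)
    · exact hBc
    · exact isCoeff_single J _
  · intro x hx
    have h1 : P.IsLaurent J B := by
      refine ⟨⟨K, ε, hε, fun γ hγ => hb γ fun h => hγ (by simp [hB, h])⟩, hBc.summable⟩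
    have h2 : P.IsLaurent J (A - B) := by
      refine isLaurent_of_finite s fun γ hγ => ?_
      by_contra hcon
      exact hγ (by simp [hB, hcon])
    have h3 := h1.eventually_expSum_add h2 hx
    rw [add_sub_cancel] at h3
    refine h3.trans (Eventually.of_forall fun z => ?_)
    beta_reduce
    rw [Fintype.sum_option, Pi.add_apply]
    simp only [Option.elim]
    congr 1
    · simp [u]
    · rw [expSum, tsum_eq_sum (s := s)]
      · rw [← Finset.sum_coe_sort]
        refine Finset.sum_congr rfl fun i _ => ?_
        rw [expSum, tsum_eq_single 0 (fun β hβ => by simp [hβ])]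
        simp [hB, u, mul_comm]
      · intro γ hγ
        simp [hB, hγ]

/-- The section of `𝒜_μ` defined by a Laurent series. -/
def laurentSec {J : Opens S1} {A : L → ℂ} (hA : P.IsLaurent J A) : P.Sec J :=
  ⟨fun x => (P.expSum A : FunGerm x), TopCat.PrelocalPredicate.sheafifyOf
    ⟨hA.isRep.choose, hA.isRep.choose_spec.1, fun x =>
      Germ.coe_eq.2 (hA.isRep.choose_spec.2 x.1 x.2)⟩⟩

variable (P) in
/-- `A` is the family of coefficients of the germ `a`. -/
def HasCoeff (x : S1) (a : P.Stalk x) (A : L → ℂ) : Prop :=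
  ∃ (J : Opens S1) (hx : x ∈ J) (hA : P.IsLaurent J A), P.stalkGerm J x hx (laurentSec hA) = a

/-- The prefactors `exp (μ(γᵢ)/z)` are absorbed by translating the coefficient families, and the
finite sum of the translated families is a single one. -/
theorem exists_hasCoeff_sec {U : Opens S1} (s : P.Sec U) {x : S1} (hx : x ∈ U) :
    ∃ (A : L → ℂ) (J : Opens S1) (h : J ≤ U) (_ : x ∈ J) (hA : P.IsLaurent J A),
      resSec h s = laurentSec hA := by
  obtain ⟨V, hxV, i, f, ⟨n, γ, a, ha, hf⟩, hs⟩ := s.2 ⟨x, hx⟩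
  obtain ⟨J, ε, hJV, hxJ, hε, hre⟩ := exists_re_le_nhds hxV
  have hL : ∀ k, P.IsLaurent J (a k) := fun k =>
    ⟨⟨0, ε, hε, fun β hβ y hy => by
      have := hre _ (fun y hy => (ha k).le_zero β hβ y hy) y hy
      linarith⟩, (ha k).summable⟩
  have hL' := IsLaurent.sum (P := P) (J := J) Finset.univ
    (fun k _ => (hL k).shift (γ k))
  refine ⟨_, J, hJV.trans i.le, hxJ, hL', Subtype.ext (funext fun y => ?_)⟩
  refine (hs ⟨y.1, hJV y.2⟩).trans (Germ.coe_eq.2 ?_)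
  filter_upwards [IsLaurent.eventually_expSum_sum Finset.univ
    (fun k _ => (hL k).shift (γ k)) y.2] with z hz
  rw [hz, hf]
  exact Finset.sum_congr rfl fun k _ => (expSum_shift _ _ _).symm

theorem hasCoeff_laurentSec {J : Opens S1} {A : L → ℂ} (hA : P.IsLaurent J A) {x : S1}
    (hx : x ∈ J) : P.HasCoeff x (P.stalkGerm J x hx (laurentSec hA)) A := ⟨J, hx, hA, rfl⟩

theorem exists_hasCoeff {x : S1} (a : P.Stalk x) : ∃ A, P.HasCoeff x a A := by
  obtain ⟨U, hx, s, rfl⟩ := exists_stalkGerm a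
  obtain ⟨A, J, h, hxJ, hA, e⟩ := exists_hasCoeff_sec s hx
  exact ⟨A, J, hxJ, hA, by rw [← e, stalkGerm_res]⟩

/-- The same family serves at all nearby points. This is the source of the local constancy of
leading terms. -/
theorem exists_hasCoeff_nhds {U : Opens S1} (s : P.Sec U) {x : S1} (hx : x ∈ U) :
    ∃ (A : L → ℂ) (J : Opens S1) (h : J ≤ U) (_ : x ∈ J), P.IsLaurent J A ∧
      ∀ y (hy : y ∈ J), P.HasCoeff y (P.stalkGerm U y (h hy) s) A := by
  obtain ⟨A, J, h, hxJ, hA, e⟩ := exists_hasCoeff_sec s hx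
  refine ⟨A, J, h, hxJ, hA, fun y hy => ⟨J, hy, hA, ?_⟩⟩
  rw [← e, stalkGerm_res]

theorem mem_stalkLE_germ {x : S1} {U : Opens S1} (hx : x ∈ U) {c : ℂ} {s : P.Sec U}
    (h : P.stalkGerm U x hx s ∈ P.stalkLE x c) : ModerateAt x c (s.1 ⟨x, hx⟩) := by
  obtain ⟨V, hV, b, hb, e⟩ := h
  obtain ⟨W, h₁, h₂, hW, e'⟩ := stalkGerm_eq hV hx e
  have h3 := congrArg (fun s : P.Sec W => s.1 ⟨x, hW⟩) e'
  have h4 := hb ⟨x, hV⟩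
  rw [resSec_val, resSec_val] at h3
  rw [← h3]; exact h4

theorem isLE_iff {U : Opens S1} {c : ℂ} {s : P.Sec U} :
    IsLE c s ↔ ∀ x (hx : x ∈ U), P.stalkGerm U x hx s ∈ P.stalkLE x c :=
  ⟨fun h _ hx => ⟨U, hx, s, h, rfl⟩, fun h x => mem_stalkLE_germ x.2 (h x.1 x.2)⟩

/-- Necessity is the argument with generic directions. For sufficiency the growth condition must
hold for a section around `x`, and domination of all exponents at `x` extends to a neighbourhood. -/
theorem HasCoeff.mem_stalkLE_iff {x : S1} {a : P.Stalk x} {A : L → ℂ} (h : P.HasCoeff x a A)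
    {c : ℂ} : a ∈ P.stalkLE x c ↔ ∀ γ, A γ ≠ 0 → LeAt x (P.μ γ) c := by
  obtain ⟨J, hx, hA, rfl⟩ := h
  refine ⟨fun h γ hγ => hA.leAt_of_moderateAt hx (mem_stalkLE_germ hx h) hγ, fun h => ?_⟩
  obtain ⟨V, hVs, hVo, hxV⟩ := mem_nhds_iff.1 (hA.eventually_leAt hx h)
  refine ⟨J ⊓ ⟨V, hVo⟩, ⟨hx, hxV⟩, resSec inf_le_left (laurentSec hA), fun y => ?_,
    stalkGerm_res _ _ _ _⟩
  exact hA.moderateAt y.2.1 (hVs y.2.2)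

variable (P) in
/-- The stalk at `x` of `∑_{c' < c} 𝒜_μ^{≤ c'}`. -/
def stalkLT (x : S1) (c : ℂ) : Set (P.Stalk x) := {a | ∃ c', LtAt x c' c ∧ a ∈ P.stalkLE x c'}

/-- The maximal order of the exponents is attained, so strict domination of each exponent leaves
room for one intermediate index `ρ x`. -/
theorem HasCoeff.mem_stalkLT_iff {x : S1} {a : P.Stalk x} {A : L → ℂ} (h : P.HasCoeff x a A)
    {c : ℂ} : a ∈ P.stalkLT x c ↔ ∀ γ, A γ ≠ 0 → LtAt x (P.μ γ) c := by
  refine ⟨fun ⟨c', hc', ha⟩ γ hγ => (h.mem_stalkLE_iff.1 ha γ hγ).trans_ltAt hc', fun hlt => ?_⟩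
  obtain ⟨ρ, h1, h2⟩ : ∃ ρ : ℝ, ρ < ((x : ℂ)⁻¹ * c).re ∧
      ∀ γ, A γ ≠ 0 → ((x : ℂ)⁻¹ * P.μ γ).re < ρ := by
    by_cases h0 : ∃ γ, A γ ≠ 0
    · obtain ⟨γ₀, h0⟩ := h0
      obtain ⟨J, hx, hA, -⟩ := h
      obtain ⟨β, hβ0, hβ⟩ := hA.exists_max hx h0
      obtain ⟨ρ, h1, h2⟩ := exists_between (ltAt_iff.1 (hlt β hβ0))
      exact ⟨ρ, h2, fun γ hγ => (hβ γ hγ).trans_lt h1⟩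
    · exact ⟨((x : ℂ)⁻¹ * c).re - 1, by linarith, fun γ hγ => absurd ⟨γ, hγ⟩ h0⟩
  refine ⟨ρ * x, ltAt_iff.2 (by rwa [re_inv_mul_real]), h.mem_stalkLE_iff.2 fun γ hγ => ?_⟩
  exact Or.inl (ltAt_iff.2 (by rw [re_inv_mul_real]; exact h2 γ hγ))

/-! ### Arithmetic of the filtration on the stalks of `𝒜_μ` -/

section Filtration

variable {x : S1} {c c' : ℂ} {a b : P.Stalk x}

theorem exists_common (a b : P.Stalk x) (ha : a ∈ P.stalkLE x c) (hb : b ∈ P.stalkLE x c') :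
    ∃ (U : Opens S1) (hx : x ∈ U) (s t : P.Sec U), IsLE c s ∧ IsLE c' t ∧
      P.stalkGerm U x hx s = a ∧ P.stalkGerm U x hx t = b := by
  obtain ⟨U, hU, s, hs, rfl⟩ := ha
  obtain ⟨V, hV, t, ht, rfl⟩ := hb
  exact ⟨U ⊓ V, ⟨hU, hV⟩, resSec inf_le_left s, resSec inf_le_right t,
    fun y => hs ⟨y.1, y.2.1⟩, fun y => ht ⟨y.1, y.2.2⟩, stalkGerm_res _ _ _ _,
    stalkGerm_res _ _ _ _⟩

theorem add_mem_stalkLE (ha : a ∈ P.stalkLE x c) (hb : b ∈ P.stalkLE x c) :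
    a + b ∈ P.stalkLE x c := by
  obtain ⟨U, hx, s, t, hs, ht, rfl, rfl⟩ := exists_common a b ha hb
  exact ⟨U, hx, s + t, fun y => (hs y).add (ht y), map_add _ _ _⟩

theorem mul_mem_stalkLE (ha : a ∈ P.stalkLE x c) (hb : b ∈ P.stalkLE x c') :
    a * b ∈ P.stalkLE x (c + c') := by
  obtain ⟨U, hx, s, t, hs, ht, rfl, rfl⟩ := exists_common a b ha hb
  exact ⟨U, hx, s * t, fun y => (hs y).mul (ht y), map_mul _ _ _⟩

theorem stalkLE_mono (h : LeAt x c c') (ha : a ∈ P.stalkLE x c) : a ∈ P.stalkLE x c' := by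
  obtain ⟨A, hA⟩ := exists_hasCoeff a
  rw [hA.mem_stalkLE_iff] at ha ⊢
  exact fun γ hγ => (ha γ hγ).trans h

theorem constStalk_mem (α : ℂ) : P.constStalk x α ∈ P.stalkLE x 0 :=
  ⟨⊤, trivial, _, constSec_isLE ⊤ α, rfl⟩

theorem zero_mem_stalkLE : (0 : P.Stalk x) ∈ P.stalkLE x c :=
  ⟨⊤, trivial, 0, fun _ => moderateAt_zero, map_zero _⟩

theorem one_mem_stalkLE : (1 : P.Stalk x) ∈ P.stalkLE x 0 := by
  have := constStalk_mem (P := P) (x := x) 1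
  rwa [map_one] at this

theorem neg_mem_stalkLE (ha : a ∈ P.stalkLE x c) : -a ∈ P.stalkLE x c := by
  have := mul_mem_stalkLE (constStalk_mem (-1)) ha
  rwa [map_neg, map_one, neg_one_mul, zero_add] at this

theorem expStalk_mem (γ : L) : P.expStalk x γ ∈ P.stalkLE x (P.μ γ) :=
  ⟨⊤, trivial, _, fun y => moderateAt_exp y.1 (LeAt.refl _ _), rfl⟩

theorem sum_mem_stalkLE {ι : Type*} (s : Finset ι) {f : ι → P.Stalk x}
    (h : ∀ i ∈ s, f i ∈ P.stalkLE x c) : ∑ i ∈ s, f i ∈ P.stalkLE x c := by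
  classical
  induction s using Finset.induction_on with
  | empty => exact zero_mem_stalkLE
  | insert i s hi ih =>
    rw [Finset.sum_insert hi]
    exact add_mem_stalkLE (h i (Finset.mem_insert_self i s))
      (ih fun j hj => h j (Finset.mem_insert_of_mem hj))

theorem prod_mem_stalkLE {ι : Type*} (s : Finset ι) {f : ι → P.Stalk x} {c : ι → ℂ}
    (h : ∀ i ∈ s, f i ∈ P.stalkLE x (c i)) : ∏ i ∈ s, f i ∈ P.stalkLE x (∑ i ∈ s, c i) := by
  classical
  induction s using Finset.induction_on with
  | empty => exact one_mem_stalkLE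
  | insert i s hi ih =>
    rw [Finset.prod_insert hi, Finset.sum_insert hi]
    exact mul_mem_stalkLE (h i (Finset.mem_insert_self i s))
      (ih fun j hj => h j (Finset.mem_insert_of_mem hj))

theorem mul_mem_stalkLT (ha : a ∈ P.stalkLE x c) (hb : b ∈ P.stalkLT x c') :
    a * b ∈ P.stalkLT x (c + c') := by
  obtain ⟨d, hd, hb⟩ := hb
  exact ⟨c + d, by rw [add_comm c, add_comm c]; exact ltAt_add_right.2 hd, mul_mem_stalkLE ha hb⟩

/-- Distinct indices of equal real part are incomparable, so neither of the two indices need bound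
the other. A common bound is `ρ x` with `ρ` between the larger order and the order of `c`. -/
theorem add_mem_stalkLT (ha : a ∈ P.stalkLT x c) (hb : b ∈ P.stalkLT x c) :
    a + b ∈ P.stalkLT x c := by
  obtain ⟨d, hd, ha⟩ := ha
  obtain ⟨d', hd', hb⟩ := hb
  rcases le_total ((x : ℂ)⁻¹ * d).re ((x : ℂ)⁻¹ * d').re with h | h
  · obtain ⟨ρ, h1, h2⟩ := exists_between (ltAt_iff.1 hd')
    exact ⟨ρ * x, ltAt_iff.2 (by rwa [re_inv_mul_real]), add_mem_stalkLE
      (stalkLE_mono (Or.inl (ltAt_iff.2 (by rw [re_inv_mul_real]; linarith))) ha)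
      (stalkLE_mono (Or.inl (ltAt_iff.2 (by rw [re_inv_mul_real]; linarith))) hb)⟩
  · obtain ⟨ρ, h1, h2⟩ := exists_between (ltAt_iff.1 hd)
    exact ⟨ρ * x, ltAt_iff.2 (by rwa [re_inv_mul_real]), add_mem_stalkLE
      (stalkLE_mono (Or.inl (ltAt_iff.2 (by rw [re_inv_mul_real]; linarith))) ha)
      (stalkLE_mono (Or.inl (ltAt_iff.2 (by rw [re_inv_mul_real]; linarith))) hb)⟩

theorem neg_mem_stalkLT (ha : a ∈ P.stalkLT x c) : -a ∈ P.stalkLT x c := by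
  obtain ⟨d, hd, ha⟩ := ha
  exact ⟨d, hd, neg_mem_stalkLE ha⟩

theorem zero_mem_stalkLT : (0 : P.Stalk x) ∈ P.stalkLT x c := by
  refine ⟨((((x : ℂ)⁻¹ * c).re - 1 : ℝ) : ℂ) * x, ltAt_iff.2 ?_, zero_mem_stalkLE⟩
  rw [re_inv_mul_real]; linarith

theorem hasCoeff_exp [DecidableEq L] (α : ℂ) (γ : L) :
    P.HasCoeff x (P.constStalk x α * P.expStalk x γ) (Pi.single γ α) := by
  have hA : P.IsLaurent (⊤ : Opens S1) (Pi.single γ α) :=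
    isLaurent_of_finite {γ} fun β hβ => by
      by_contra hcon
      rw [Finset.mem_singleton] at hcon
      exact hβ (by simp [hcon])
  refine ⟨⊤, trivial, hA, ?_⟩
  rw [constStalk, expStalk, RingHom.comp_apply, ← map_mul]
  congr 1
  refine Subtype.ext (funext fun y => Germ.coe_eq.2 (Eventually.of_forall fun z => ?_))
  rw [expSum, tsum_eq_single γ (fun β hβ => by simp [hβ])]
  simp

theorem HasCoeff.add {A B : L → ℂ} (ha : P.HasCoeff x a A) (hb : P.HasCoeff x b B) :
    P.HasCoeff x (a + b) (A + B) := by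
  obtain ⟨J, hJ, hA, rfl⟩ := ha
  obtain ⟨J', hJ', hB, rfl⟩ := hb
  have h1 : J ⊓ J' ≤ J := inf_le_left
  have h2 : J ⊓ J' ≤ J' := inf_le_right
  have hx : x ∈ J ⊓ J' := ⟨hJ, hJ'⟩
  refine ⟨J ⊓ J', hx, (hA.mono h1).add (hB.mono h2), ?_⟩
  rw [← stalkGerm_res h1 x hx, ← stalkGerm_res h2 x hx, ← map_add]
  congr 1
  exact Subtype.ext (funext fun y => Germ.coe_eq.2
    ((hA.mono h1).eventually_expSum_add (hB.mono h2) y.2))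

theorem expStalk_add (β γ : L) : P.expStalk x (β + γ) = P.expStalk x β * P.expStalk x γ :=
  map_mul (P.expStalkHom x) (Multiplicative.ofAdd β) (Multiplicative.ofAdd γ)

theorem expStalk_zero : P.expStalk x 0 = 1 := map_one (P.expStalkHom x)

theorem expStalk_mul_neg (γ : L) : P.expStalk x γ * P.expStalk x (-γ) = 1 := by
  rw [← expStalk_add, add_neg_cancel, expStalk_zero]

/-- The leading coefficient of a section near a point. -/
theorem exists_lead {U : Opens S1} (s : P.Sec U) (hx : x ∈ U) (hs : P.stalkGerm U x hx s ∈ P.stalkLE x c) :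
    ∃ (V : Opens S1) (h : V ≤ U) (_ : x ∈ V) (α : ℂ), ∀ y (hy : y ∈ V),
      (∀ γ, P.μ γ = c →
        P.stalkGerm U y (h hy) s - P.constStalk y α * P.expStalk y γ ∈ P.stalkLT y c) ∧
      ((∀ γ, P.μ γ ≠ c) → P.stalkGerm U y (h hy) s ∈ P.stalkLT y c) := by
  classical
  obtain ⟨A, J, hJ, hxJ, hA, hco⟩ := exists_hasCoeff_nhds s hx
  have hle := (hco x hxJ).mem_stalkLE_iff.1 hs
  obtain ⟨V, hVs, hVo, hxV⟩ := mem_nhds_iff.1 (hA.eventually_leAt hxJ hle)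
  refine ⟨J ⊓ ⟨V, hVo⟩, inf_le_left.trans hJ, ⟨hxJ, hxV⟩,
    -- If `c` is not in `μ(L)`, no exponent can equal `c`, and the default `0` is never used.
    if h : ∃ γ, P.μ γ = c then A h.choose else 0, fun y hy => ⟨fun γ hγ => ?_, fun hne => ?_⟩⟩
  · have hex : ∃ γ, P.μ γ = c := ⟨γ, hγ⟩
    have e : hex.choose = γ := μ_injective (hex.choose_spec.trans hγ.symm)
    rw [dif_pos hex, e, sub_eq_add_neg, ← neg_mul, ← map_neg]
    refine ((hco y hy.1).add (hasCoeff_exp (-A γ) γ)).mem_stalkLT_iff.2 fun β hβ => ?_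
    by_cases hβγ : β = γ
    · exact absurd (by simp [hβγ]) hβ
    · rcases hVs hy.2 β (by simpa [hβγ] using hβ) with h | h
      · exact h
      · exact absurd (μ_injective (h.trans hγ.symm)) hβγ
  · refine (hco y hy.1).mem_stalkLT_iff.2 fun β hβ => ?_
    exact (hVs hy.2 β hβ).resolve_right (hne β)

theorem const_mul_exp_mem_stalkLT {α : ℂ} {γ : L}
    (h : P.constStalk x α * P.expStalk x γ ∈ P.stalkLT x (P.μ γ)) : α = 0 := by
  classical
  by_contra hα
  have := (hasCoeff_exp α γ).mem_stalkLT_iff.1 h γ (by simpa using hα)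
  simp [LtAt] at this

end Filtration

end PeriodMap

end

section

namespace PeriodMap

/-! ### Units of the stalks -/

/-- Weighted `ℓ¹`-norms are submultiplicative for convolution. -/
theorem summable_conv {G : Type*} [AddCommGroup G] {E : G → ℝ} (hE : ∀ γ, 0 < E γ) (hadd : ∀ β γ, E (β + γ) = E β * E γ)
    {a b : G → ℂ} (ha : Summable fun γ => ‖a γ‖ * E γ) (hb : Summable fun γ => ‖b γ‖ * E γ) :
    (Summable fun γ => ‖conv a b γ‖ * E γ) ∧
      ∑' γ, ‖conv a b γ‖ * E γ ≤ (∑' γ, ‖a γ‖ * E γ) * ∑' γ, ‖b γ‖ * E γ := by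
  have hE' := fun γ => (hE γ).le
  have hprod := ha.mul_of_nonneg hb (fun _ => mul_nonneg (norm_nonneg _) (hE' _))
    (fun _ => mul_nonneg (norm_nonneg _) (hE' _))
  have htsum := ha.tsum_mul_tsum hb hprod
  rw [← (shear (L := G)).summable_iff] at hprod
  rw [← (shear (L := G)).tsum_eq] at htsum
  have hprod2 : Summable fun p : G × G => ‖a p.2 * b (p.1 - p.2)‖ * E p.1 := by
    refine hprod.congr fun p => ?_
    simp only [Function.comp, shear, Equiv.coe_fn_mk]
    have : E p.1 = E p.2 * E (p.1 - p.2) := by rw [← hadd, add_sub_cancel]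
    rw [this, norm_mul]; ring
  have hle : ∀ γ, ‖conv a b γ‖ * E γ ≤ ∑' β, ‖a β * b (γ - β)‖ * E γ := fun γ => by
    have hγ := hprod2.prod_factor γ
    simp only at hγ
    rw [tsum_mul_right]
    have hγ' : Summable fun β => ‖a β * b (γ - β)‖ := (summable_mul_right_iff (hE γ).ne').1 hγ
    exact mul_le_mul_of_nonneg_right (norm_tsum_le_tsum_norm hγ') (hE' γ)
  have hs : Summable fun γ => ‖conv a b γ‖ * E γ :=
    Summable.of_nonneg_of_le (fun _ => mul_nonneg (norm_nonneg _) (hE' _)) hle hprod2.prod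
  refine ⟨hs, (hs.tsum_le_tsum hle hprod2.prod).trans (le_of_eq ?_)⟩
  rw [htsum, ← hprod2.tsum_prod]
  refine tsum_congr fun p => ?_
  simp only [shear, Equiv.coe_fn_mk]
  have : E p.1 = E p.2 * E (p.1 - p.2) := by rw [← hadd, add_sub_cancel]
  rw [this, norm_mul]; ring

/-- The iterated convolutions of a coefficient family. -/
def convPow [DecidableEq L] (b : L → ℂ) : ℕ → L → ℂ
  | 0 => Pi.single 0 1
  | k + 1 => conv b (convPow b k)

theorem isCoeff_convPow [DecidableEq L] {V : Opens S1} {b : L → ℂ} {x : S1} (hx : x ∈ V) (hb : P.IsCoeff V b) (k : ℕ) :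
    P.IsCoeff V (convPow b k) := by
  induction k with
  | zero => exact isCoeff_single V 1
  | succ k ih => exact hb.conv ih hx

/-- An element of the form `1 - b` with `b` of negative exponents is invertible. -/
theorem exists_inv_one_sub {x : S1} {b : P.Stalk x} (hb : b ∈ P.stalkLT x 0) :
    ∃ v ∈ P.stalkLE x 0, (1 - b) * v = 1 := by
  classical
  obtain ⟨B, J, hxJ, hB, rfl⟩ := exists_hasCoeff b
  have hlt := (hasCoeff_laurentSec hB hxJ).mem_stalkLT_iff.1 hb
  obtain ⟨V, hVs, hVo, hxV⟩ := mem_nhds_iff.1 (hB.eventually_leAt hxJ fun γ hγ => Or.inl (hlt γ hγ))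
  set V' : Opens S1 := J ⊓ ⟨V, hVo⟩ with hV'
  have hxV' : x ∈ V' := ⟨hxJ, hxV⟩
  have hBc : P.IsCoeff V' B := ⟨fun γ hγ y hy => hVs hy.2 γ hγ, hB.summable⟩
  obtain ⟨J', ε, hJ', hxJ', hε, hre⟩ := exists_re_le_nhds hxV'
  obtain ⟨R, hR, hsupp⟩ := P.support
  obtain ⟨M, hM, hbd⟩ := exists_norm_le_len P
  obtain ⟨ϱ, hϱ, hs⟩ := hB.summable
  -- the additive functional that controls the cone of exponents
  set φ : L → ℝ := fun γ => -((x : ℂ)⁻¹ * P.μ γ).re with hφ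
  have hφadd : ∀ β γ, φ (β + γ) = φ β + φ γ := fun β γ => by
    simp only [hφ, map_add, mul_add, Complex.add_re]; ring
  have hφle : ∀ γ, φ γ ≤ ‖P.μ γ‖ := fun γ => (neg_le_abs _).trans (norm_re_inv_mul_le x _)
  have hφge : ∀ γ, (∀ y ∈ V', LeAt y (P.μ γ) 0) → ε * ‖P.μ γ‖ ≤ φ γ := fun γ hγ => by
    have := hre _ hγ x hxJ'
    simp only [hφ]; linarith
  have hφpos : ∀ γ, B γ ≠ 0 → 0 < φ γ := fun γ hγ => by
    have := hlt γ hγ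
    simp only [LtAt, sub_zero] at this
    simp only [hφ]; linarith
  obtain ⟨T₀, hT₀⟩ : ∃ T₀ : ℝ, -Real.log ϱ ≤ T₀ * (ε * R) ∧ 0 ≤ T₀ :=
    ⟨max 0 (-Real.log ϱ / (ε * R)), by
      rw [← div_le_iff₀ (by positivity)]; exact le_max_right _ _, le_max_left _ _⟩
  have hbound : ∀ T : ℝ, T₀ ≤ T → ∀ γ, ‖B γ‖ * Real.exp (-T * φ γ) ≤ ‖B γ‖ * ϱ ^ P.len γ := by
    intro T hT γ
    by_cases h0 : B γ = 0
    · simp [h0]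
    refine mul_le_mul_of_nonneg_left ?_ (norm_nonneg _)
    rw [Real.rpow_def_of_pos hϱ]
    refine Real.exp_le_exp.2 ?_
    have h1 := hφge γ (hBc.le_zero γ h0)
    have h2 : R * P.len γ ≤ _ := hsupp γ
    have h3 := mul_le_mul_of_nonneg_left h2 hε.le
    have h4 : 0 ≤ P.len γ := len_nonneg γ
    have h5 := mul_le_mul_of_nonneg_right hT₀.1 h4
    have h6 : T * (ε * (R * P.len γ)) ≤ T * φ γ :=
      mul_le_mul_of_nonneg_left (h3.trans h1) (hT₀.2.trans hT)
    have h7 : T₀ * (ε * (R * P.len γ)) ≤ T * (ε * (R * P.len γ)) := by gcongr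
    nlinarith
  -- All exponents of `B` have `φ > 0`, so a steep enough exponential weight makes the norm of `B`
  -- small.
  have htend : Tendsto (fun T : ℝ => ∑' γ, ‖B γ‖ * Real.exp (-T * φ γ)) atTop (𝓝 0) := by
    have := tendsto_tsum_of_dominated_convergence (𝓕 := (atTop : Filter ℝ))
      (f := fun T γ => ‖B γ‖ * Real.exp (-T * φ γ)) (g := fun _ => 0) hs ?_ ?_
    · simpa using this
    · intro γ
      by_cases h0 : B γ = 0
      · simp [h0]
      rw [← mul_zero ‖B γ‖]
      refine Tendsto.const_mul _ (Real.tendsto_exp_atBot.comp ?_)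
      exact (tendsto_neg_atTop_atBot).atBot_mul_const (hφpos γ h0)
    · filter_upwards [eventually_ge_atTop T₀] with T hT γ
      rw [Real.norm_of_nonneg (by positivity)]
      exact hbound T hT γ
  obtain ⟨T, hT, hT2⟩ := ((eventually_ge_atTop T₀).and
    (htend.eventually_lt_const (show (0 : ℝ) < 1 / 2 by norm_num))).exists
  have hT0 : 0 ≤ T := hT₀.2.trans hT
  -- Since `φ` is additive the weight is multiplicative and the weighted norm is submultiplicative
  -- for convolution; that of `B` is below `1/2`, so the powers decrease geometrically.
  set E : L → ℝ := fun γ => Real.exp (-T * φ γ) with hE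
  have hEpos : ∀ γ, 0 < E γ := fun γ => Real.exp_pos _
  have hEadd : ∀ β γ, E (β + γ) = E β * E γ := fun β γ => by
    simp only [hE, hφadd, mul_add, Real.exp_add]
  have hBE : Summable fun γ => ‖B γ‖ * E γ :=
    Summable.of_nonneg_of_le (fun _ => by positivity) (hbound T hT) hs
  have hN : ∀ k, (Summable fun γ => ‖convPow B k γ‖ * E γ) ∧
      ∑' γ, ‖convPow B k γ‖ * E γ ≤ (1 / 2) ^ k := by
    intro k
    induction k with
    | zero =>
      have h0 : ∀ γ, γ ≠ 0 → ‖convPow B 0 γ‖ * E γ = 0 := fun γ hγ => by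
        simp [convPow, hγ]
      refine ⟨summable_of_ne_finset_zero (s := {0}) fun γ hγ => h0 γ (by simpa using hγ), ?_⟩
      rw [tsum_eq_single 0 h0]
      simp [convPow, hE, hφ]
    | succ k ih =>
      obtain ⟨h1, h2⟩ := summable_conv hEpos hEadd hBE ih.1
      refine ⟨h1, h2.trans ?_⟩
      rw [pow_succ']
      exact mul_le_mul hT2.le ih.2 (tsum_nonneg fun γ => by positivity) (by norm_num)
  have hsum : Summable fun p : ℕ × L => ‖convPow B p.1 p.2‖ * E p.2 := by
    refine (summable_prod_of_nonneg fun p => by positivity).2 ⟨fun k => (hN k).1, ?_⟩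
    exact Summable.of_nonneg_of_le (fun k => tsum_nonneg fun γ => by positivity)
      (fun k => (hN k).2) (summable_geometric_of_lt_one (by norm_num) (by norm_num))
  have hsum' := hsum.prod_symm
  have hsk : ∀ γ, Summable fun k => ‖convPow B k γ‖ := fun γ => by
    have := hsum'.prod_factor γ
    exact (summable_mul_right_iff (hEpos γ).ne').1 this
  set S : L → ℂ := fun γ => ∑' k, convPow B k γ with hS
  have hSc : P.IsCoeff V' S := by
    -- From `φ(γ) ≤ ‖μ(γ)‖ ≤ M ‖γ‖` it follows that this radius to the power `‖γ‖` is at most the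
    -- weight.
    refine ⟨fun γ hγ y hy => ?_, Real.exp (-(T * M)), Real.exp_pos _, ?_⟩
    · obtain ⟨k, hk⟩ : ∃ k, convPow B k γ ≠ 0 := by
        by_contra! hcon
        exact hγ (by simp [hS, hcon])
      exact (isCoeff_convPow hxV' hBc k).le_zero γ hk y hy
    · refine Summable.of_nonneg_of_le (fun _ => by positivity) (fun γ => ?_) hsum'.prod
      have h1 : Real.exp (-(T * M)) ^ P.len γ ≤ E γ := by
        rw [← Real.exp_mul]
        refine Real.exp_le_exp.2 ?_
        have h2 := (hφle γ).trans (hbd γ)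
        have := mul_le_mul_of_nonneg_left h2 hT0
        linarith
      calc _ ≤ (∑' k, ‖convPow B k γ‖) * E γ :=
            mul_le_mul (norm_tsum_le_tsum_norm (hsk γ)) h1 (by positivity)
              (tsum_nonneg fun k => norm_nonneg _)
        _ = ∑' k, ‖convPow B k γ‖ * E γ := tsum_mul_right.symm
        _ = _ := tsum_congr fun k => rfl
  have hconv : S = conv B S + Pi.single 0 1 := by
    funext γ
    have h1 : S γ = convPow B 0 γ + ∑' k, convPow B (k + 1) γ :=
      (hsk γ).of_norm.tsum_eq_zero_add
    -- In a decomposition of `γ` into exponents of the cone both parts have `φ ≥ 0`, so `φ` of the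
    -- first part is at most `φ(γ)`. The convolution is thus a finite sum and commutes with the sum
    -- over `k`.
    have hfin := P.finite_norm_le (φ γ / ε)
    have hzero : ∀ c : L → ℂ, P.IsCoeff V' c → ∀ β ∉ hfin.toFinset, B β * c (γ - β) = 0 := by
      intro c hc β hβ
      by_contra hcon
      refine hβ (hfin.mem_toFinset.2 ?_)
      rw [Set.mem_ofPred_eq, le_div_iff₀ hε, mul_comm]
      have h2 := hφge β (hBc.le_zero β (left_ne_zero_of_mul hcon))
      have h3 := hφge _ (hc.le_zero _ (right_ne_zero_of_mul hcon))
      have h4 : φ γ = φ β + φ (γ - β) := by rw [← hφadd, add_sub_cancel]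
      have : 0 ≤ ε * ‖P.μ (γ - β)‖ := by positivity
      linarith
    have h2 : ∀ k, convPow B (k + 1) γ = ∑ β ∈ hfin.toFinset, B β * convPow B k (γ - β) :=
      fun k => tsum_eq_sum (hzero _ (isCoeff_convPow hxV' hBc k))
    have h3 : conv B S γ = ∑ β ∈ hfin.toFinset, B β * S (γ - β) := tsum_eq_sum (hzero _ hSc)
    rw [h1, Pi.add_apply, h3, add_comm]
    congr 1
    rw [tsum_congr h2, Summable.tsum_finsetSum fun β _ => ((hsk (γ - β)).of_norm.mul_left _)]
    exact Finset.sum_congr rfl fun β _ => tsum_mul_left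
  have hcoeffL : ∀ c : L → ℂ, P.IsCoeff V' c → P.IsLaurent J' c := fun c hc =>
    ⟨⟨0, ε, hε, fun β hβ y hy => by
      have := hre _ (fun y hy => hc.le_zero β hβ y hy) y hy
      linarith⟩, hc.summable⟩
  have hSL := hcoeffL S hSc
  refine ⟨P.stalkGerm J' x hxJ' (laurentSec hSL), (hasCoeff_laurentSec hSL hxJ').mem_stalkLE_iff.2
    fun γ hγ => hSc.le_zero γ hγ x hxV', ?_⟩
  have hJJ : J' ≤ J := hJ'.trans inf_le_left
  rw [← stalkGerm_res hJJ x hxJ', ← map_one (P.stalkGerm J' x hxJ'), ← map_sub, ← map_mul]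
  congr 1
  refine Subtype.ext (funext fun y => Germ.coe_eq.2 ?_)
  have e1 := hBc.expSum_mul hSc (hJ' y.2)
  have e2 := (hcoeffL _ (hBc.conv hSc hxV')).eventually_expSum_add
    (hcoeffL _ (isCoeff_single V' (1 : ℂ))) y.2
  filter_upwards [e1, e2] with z hz1 hz2
  have h3 : P.expSum S z = P.expSum (conv B S) z + 1 := by
    conv_lhs => rw [hconv]
    refine hz2.trans ?_
    rw [Pi.add_apply]
    congr 1
    rw [expSum, tsum_eq_single 0 (fun β hβ => by simp [hβ])]
    simp [u]
  change (1 - P.expSum B z) * P.expSum S z = 1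
  rw [sub_mul, one_mul, hz1, h3]
  ring

/-- An element with a dominant exponent is invertible. -/
theorem exists_inv_of_lead {x : S1} {a : P.Stalk x} {c : ℂ} (ha : a ∈ P.stalkLE x c)
    (ha' : a ∉ P.stalkLT x c) : ∃ v ∈ P.stalkLE x (-c), a * v = 1 := by
  obtain ⟨U, hx, s, rfl⟩ := exists_stalkGerm a
  obtain ⟨V, hV, hxV, α, h⟩ := exists_lead s hx ha
  obtain ⟨h1, h2⟩ := h x hxV
  by_cases hex : ∀ γ, P.μ γ ≠ c
  · exact absurd (h2 hex) ha'
  push Not at hex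
  obtain ⟨γ, rfl⟩ := hex
  set a := P.stalkGerm U x hx s
  have h3 : a - P.constStalk x α * P.expStalk x γ ∈ P.stalkLT x (P.μ γ) := h1 γ rfl
  have hα : α ≠ 0 := by
    rintro rfl
    rw [map_zero, zero_mul, sub_zero] at h3
    exact ha' h3
  have hcc : P.constStalk x α⁻¹ * P.constStalk x α = 1 := by
    rw [← map_mul, inv_mul_cancel₀ hα, map_one]
  have hee := expStalk_mul_neg (P := P) (x := x) γ
  -- The inverse of the leading monomial; multiplying by it reduces to the form `1 - b`.
  set w := P.constStalk x α⁻¹ * P.expStalk x (-γ) with hw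
  have hwm : w ∈ P.stalkLE x (-P.μ γ) := by
    have := mul_mem_stalkLE (constStalk_mem (P := P) (x := x) α⁻¹) (expStalk_mem (-γ))
    rwa [zero_add, map_neg] at this
  have h4 : 1 - a * w ∈ P.stalkLT x 0 := by
    have := neg_mem_stalkLT (mul_mem_stalkLT hwm h3)
    rw [neg_add_cancel] at this
    convert this using 1
    have h5 : w * (P.constStalk x α * P.expStalk x γ) = 1 := by
      rw [hw]
      linear_combination (P.expStalk x γ * P.expStalk x (-γ)) * hcc + hee
    rw [mul_sub, h5]; ring
  obtain ⟨v, hv, e⟩ := exists_inv_one_sub h4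
  rw [sub_sub_cancel] at e
  refine ⟨w * v, ?_, by rw [← mul_assoc]; exact e⟩
  have := mul_mem_stalkLE hwm hv
  rwa [add_zero] at this

end PeriodMap

end

section

namespace PeriodMap

/-! ### Homogeneous elements of the group algebra -/

variable (P) in
/-- `q` is a multiple of some `γ` with `μ(γ) = c`. -/
def IsHomog (c : ℂ) (q : AddMonoidAlgebra ℂ L) : Prop := ∀ γ, q.coeff γ ≠ 0 → P.μ γ = c

variable (P) in
/-- The homogeneous part of degree `c`. -/
def homogPart (c : ℂ) (q : AddMonoidAlgebra ℂ L) : AddMonoidAlgebra ℂ L := by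
  classical exact .ofCoeff (q.coeff.filter fun γ => P.μ γ = c)

theorem isHomog_single (γ : L) (w : ℂ) : P.IsHomog (P.μ γ) (AddMonoidAlgebra.single γ w) := by
  classical
  intro β hβ
  rw [AddMonoidAlgebra.coeff_single, Finsupp.single_apply] at hβ
  split_ifs at hβ with h
  · rw [h]
  · exact absurd rfl hβ

theorem isHomog_zero (c : ℂ) : P.IsHomog c 0 := fun γ hγ => by simp at hγ

theorem IsHomog.eq_single {c : ℂ} {q : AddMonoidAlgebra ℂ L} (h : P.IsHomog c q) {γ : L}
    (hγ : P.μ γ = c) : q = AddMonoidAlgebra.single γ (q.coeff γ) := by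
  classical
  refine AddMonoidAlgebra.ext (Finsupp.ext fun β => ?_)
  rw [AddMonoidAlgebra.coeff_single, Finsupp.single_apply]
  split_ifs with e
  · rw [e]
  · by_contra hβ
    exact e (μ_injective (hγ.trans (h β hβ).symm))

theorem IsHomog.eq_zero {c : ℂ} {q : AddMonoidAlgebra ℂ L} (h : P.IsHomog c q)
    (hγ : ∀ γ, P.μ γ ≠ c) : q = 0 := by
  refine AddMonoidAlgebra.ext (Finsupp.ext fun β => ?_)
  by_contra hβ
  exact hγ β (h β hβ)

theorem isHomog_homogPart (c : ℂ) (q : AddMonoidAlgebra ℂ L) : P.IsHomog c (P.homogPart c q) := by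
  classical
  intro γ hγ
  by_contra hne
  exact hγ (by simp [homogPart, hne])

theorem homogPart_of_isHomog {c : ℂ} {q : AddMonoidAlgebra ℂ L} (h : P.IsHomog c q) :
    P.homogPart c q = q := by
  classical
  refine AddMonoidAlgebra.ext (Finsupp.ext fun β => ?_)
  simp only [homogPart, Finsupp.filter_apply]
  split_ifs with hβ
  · rfl
  · by_contra hne
    exact hβ (h β (Ne.symm hne))

theorem homogPart_add (c : ℂ) (p q : AddMonoidAlgebra ℂ L) :
    P.homogPart c (p + q) = P.homogPart c p + P.homogPart c q := by
  classical
  exact AddMonoidAlgebra.ext (Finsupp.filter_add (p := fun γ => P.μ γ = c))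

theorem homogPart_single_of_ne {c : ℂ} {γ : L} (w : ℂ) (h : P.μ γ ≠ c) :
    P.homogPart c (AddMonoidAlgebra.single γ w) = 0 := by
  classical
  exact AddMonoidAlgebra.ext (Finsupp.filter_single_of_neg (fun γ => P.μ γ = c) h)

theorem homogPart_zero (c : ℂ) : P.homogPart c 0 = 0 := by
  classical
  exact AddMonoidAlgebra.ext (Finsupp.filter_zero (fun γ => P.μ γ = c))

theorem homogPart_coeff (γ : L) (q : AddMonoidAlgebra ℂ L) :
    (P.homogPart (P.μ γ) q).coeff γ = q.coeff γ := by
  classical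
  simp [homogPart]

variable {x : S1}

theorem toStalk_single (γ : L) (w : ℂ) :
    P.groupAlgebraToStalk x (AddMonoidAlgebra.single γ w) = P.constStalk x w * P.expStalk x γ :=
  AddMonoidAlgebra.liftNC_single _ _ _ _

theorem IsHomog.toStalk_mem {c : ℂ} {q : AddMonoidAlgebra ℂ L} (h : P.IsHomog c q) :
    P.groupAlgebraToStalk x q ∈ P.stalkLE x c := by
  by_cases hex : ∃ γ, P.μ γ = c
  · obtain ⟨γ, rfl⟩ := hex
    rw [h.eq_single rfl, toStalk_single]
    have := mul_mem_stalkLE (constStalk_mem (P := P) (x := x) (q.coeff γ)) (expStalk_mem γ)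
    rwa [zero_add] at this
  · push Not at hex
    rw [h.eq_zero hex, map_zero]
    exact zero_mem_stalkLE

theorem IsHomog.eq_zero_of_mem {c : ℂ} {q : AddMonoidAlgebra ℂ L} (h : P.IsHomog c q)
    (hq : P.groupAlgebraToStalk x q ∈ P.stalkLT x c) : q = 0 := by
  by_cases hex : ∃ γ, P.μ γ = c
  · obtain ⟨γ, rfl⟩ := hex
    rw [h.eq_single rfl, toStalk_single] at hq
    rw [h.eq_single rfl, const_mul_exp_mem_stalkLT hq]
    exact AddMonoidAlgebra.ext (by simp)
  · push Not at hex
    exact h.eq_zero hex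

/-- A homogeneous element is a single monomial `α u^γ`, which is defined over any open set. So
leading terms extend as flat sections. -/
theorem IsHomog.exists_section {c : ℂ} {q : AddMonoidAlgebra ℂ L} (h : P.IsHomog c q)
    (U : Opens S1) : ∃ b : P.Sec U, ∀ y (hy : y ∈ U),
      P.stalkGerm U y hy b = P.groupAlgebraToStalk y q := by
  by_cases hex : ∃ γ, P.μ γ = c
  · obtain ⟨γ, hγ⟩ := hex
    refine ⟨P.constSec U (q.coeff γ) * P.expSec U γ, fun y hy => ?_⟩
    conv_rhs => rw [h.eq_single hγ]
    rw [toStalk_single, map_mul, stalkGerm_constSec, stalkGerm_expSec]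
  · push Not at hex
    exact ⟨0, fun y hy => by rw [h.eq_zero hex, map_zero, map_zero]⟩

/-- The leading term of a section near a point. -/
theorem exists_homog_lead {c : ℂ} {U : Opens S1} (s : P.Sec U) (hx : x ∈ U)
    (hs : P.stalkGerm U x hx s ∈ P.stalkLE x c) :
    ∃ (V : Opens S1) (h : V ≤ U) (_ : x ∈ V) (q : AddMonoidAlgebra ℂ L), P.IsHomog c q ∧
      ∀ y (hy : y ∈ V),
        P.stalkGerm U y (h hy) s - P.groupAlgebraToStalk y q ∈ P.stalkLT y c := by
  obtain ⟨V, hV, hxV, α, h⟩ := exists_lead s hx hs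
  by_cases hex : ∃ γ, P.μ γ = c
  · obtain ⟨γ, rfl⟩ := hex
    refine ⟨V, hV, hxV, AddMonoidAlgebra.single γ α, isHomog_single γ α, fun y hy => ?_⟩
    rw [toStalk_single]
    exact (h y hy).1 γ rfl
  · push Not at hex
    refine ⟨V, hV, hxV, 0, isHomog_zero c, fun y hy => ?_⟩
    rw [map_zero, sub_zero]
    exact (h y hy).2 hex

theorem exists_homog_lead_stalk {c : ℂ} {a : P.Stalk x} (ha : a ∈ P.stalkLE x c) :
    ∃ q : AddMonoidAlgebra ℂ L, P.IsHomog c q ∧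
      a - P.groupAlgebraToStalk x q ∈ P.stalkLT x c := by
  obtain ⟨U, hx, s, rfl⟩ := exists_stalkGerm a
  obtain ⟨V, hV, hxV, q, hq, h⟩ := exists_homog_lead s hx ha
  exact ⟨q, hq, h x hxV⟩

end PeriodMap

open PeriodMap

namespace FilteredModule

variable (F : FilteredModule P) {x : S1}

/-! ### The graded module -/

/-- The indices below `c` are directed: an index `ρ x` of intermediate order lies above any two of
them. So the sum of the submodules is their union. -/
theorem mem_filStalkLT_iff {c : ℂ} {t : ModStalk F.mod x} :
    t ∈ F.filStalkLT c x ↔ ∃ c', LtAt x c' c ∧ t ∈ F.filStalk c' x := by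
  refine ⟨fun h => ?_, fun ⟨c', hc', ht⟩ => ?_⟩
  · refine Submodule.iSup_induction (fun c' => ⨆ (_ : LtAt x c' c), F.filStalk c' x)
      (motive := fun t => ∃ c', LtAt x c' c ∧ t ∈ F.filStalk c' x) h ?_ ?_ ?_
    · intro c' t ht
      by_cases hc' : LtAt x c' c
      · rw [iSup_pos hc'] at ht
        exact ⟨c', hc', ht⟩
      · rw [iSup_neg hc', Submodule.mem_bot] at ht
        refine ⟨((((x : Circle) : ℂ)⁻¹ * c).re - 1 : ℝ) * ((x : Circle) : ℂ),
          ltAt_iff.2 (by rw [re_inv_mul_real]; linarith), ?_⟩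
        rw [ht]; exact zero_mem _
    · refine ⟨((((x : Circle) : ℂ)⁻¹ * c).re - 1 : ℝ) * ((x : Circle) : ℂ),
          ltAt_iff.2 (by rw [re_inv_mul_real]; linarith), zero_mem _⟩
    · rintro s t ⟨d, hd, hs⟩ ⟨d', hd', ht⟩
      rcases le_total (((x : Circle) : ℂ)⁻¹ * d).re (((x : Circle) : ℂ)⁻¹ * d').re with h | h
      · obtain ⟨ρ, h1, h2⟩ := exists_between (ltAt_iff.1 hd')
        exact ⟨ρ * (x : Circle), ltAt_iff.2 (by rwa [re_inv_mul_real]), add_mem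
          (F.filStalk_mono (Or.inl (ltAt_iff.2 (by rw [re_inv_mul_real]; linarith))) hs)
          (F.filStalk_mono (Or.inl (ltAt_iff.2 (by rw [re_inv_mul_real]; linarith))) ht)⟩
      · obtain ⟨ρ, h1, h2⟩ := exists_between (ltAt_iff.1 hd)
        exact ⟨ρ * (x : Circle), ltAt_iff.2 (by rwa [re_inv_mul_real]), add_mem
          (F.filStalk_mono (Or.inl (ltAt_iff.2 (by rw [re_inv_mul_real]; linarith))) hs)
          (F.filStalk_mono (Or.inl (ltAt_iff.2 (by rw [re_inv_mul_real]; linarith))) ht)⟩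
  · exact (le_iSup₂_of_le (f := fun c' (_ : LtAt x c' c) => F.filStalk c' x) c' hc' le_rfl) ht

theorem toStalk_smul_mem {c d : ℂ} {q : AddMonoidAlgebra ℂ L} (hq : P.IsHomog c q)
    {t : ModStalk F.mod x} (ht : t ∈ F.filStalk d x) :
    P.groupAlgebraToStalk x q • t ∈ F.filStalk (d + c) x := by
  by_cases hex : ∃ γ, P.μ γ = c
  · obtain ⟨γ, rfl⟩ := hex
    rw [hq.eq_single rfl, toStalk_single, mul_smul, ← complex_smul_def]
    exact Submodule.smul_mem _ _ (F.expMul_mem γ ht)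
  · push Not at hex
    rw [hq.eq_zero hex, map_zero, zero_smul]
    exact zero_mem _

variable (x) in
/-- The class in `gr ℒ` of an element of `ℒ_{≤ c}`. -/
def grCls (c : ℂ) (t : ModStalk F.mod x) (ht : t ∈ F.filStalk c x) : F.GrTot x :=
  F.grIncl c x (F.grMk c x ⟨t, ht⟩)

theorem smul_def (q : AddMonoidAlgebra ℂ L) (v : F.GrTot x) :
    q • v = AddMonoidAlgebra.lift ℂ (Module.End ℂ (F.GrTot x)) L (F.expTotHom x) q v := rfl

theorem single_smul_grCls (γ : L) (w : ℂ) {c : ℂ} {t : ModStalk F.mod x}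
    (ht : t ∈ F.filStalk c x) :
    AddMonoidAlgebra.single γ w • F.grCls x c t ht = F.grCls x (c + P.μ γ)
      (P.groupAlgebraToStalk x (AddMonoidAlgebra.single γ w) • t)
      (F.toStalk_smul_mem (isHomog_single γ w) ht) := by
  rw [smul_def, AddMonoidAlgebra.lift_single, LinearMap.smul_apply]
  change w • F.expTot γ x (F.grIncl c x (F.grMk c x ⟨t, ht⟩)) = _
  rw [expTot_apply, ← map_smul, ← map_smul]
  refine F.grIncl_congr rfl ?_ _ _
  rw [toStalk_single, mul_smul, ← complex_smul_def]

theorem grCls_zero {c : ℂ} (h : (0 : ModStalk F.mod x) ∈ F.filStalk c x) : F.grCls x c 0 h = 0 := by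
  have : (⟨0, h⟩ : F.filStalk c x) = 0 := rfl
  rw [grCls, this, map_zero, map_zero]

theorem smul_grCls {c d : ℂ} {q : AddMonoidAlgebra ℂ L} (hq : P.IsHomog d q) {t : ModStalk F.mod x}
    (ht : t ∈ F.filStalk c x) : q • F.grCls x c t ht =
      F.grCls x (c + d) (P.groupAlgebraToStalk x q • t) (F.toStalk_smul_mem hq ht) := by
  by_cases hex : ∃ γ, P.μ γ = d
  · obtain ⟨γ, rfl⟩ := hex
    obtain ⟨w, rfl⟩ : ∃ w, q = AddMonoidAlgebra.single γ w := ⟨_, hq.eq_single rfl⟩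
    exact F.single_smul_grCls γ w ht
  · push Not at hex
    obtain rfl := hq.eq_zero hex
    rw [zero_smul]
    have e : P.groupAlgebraToStalk x (0 : AddMonoidAlgebra ℂ L) • t = 0 := by
      rw [map_zero, zero_smul]
    exact ((F.grIncl_congr rfl e _ (zero_mem _)).trans (F.grCls_zero _)).symm

variable (x) in
/-- The projection of `gr ℒ` to `gr_c ℒ`. -/
def grComp (c : ℂ) : F.GrTot x →ₗ[ℂ] F.Gr c x := DirectSum.component ℂ ℂ (fun c => F.Gr c x) c

theorem grComp_grCls (c : ℂ) {t : ModStalk F.mod x} (ht : t ∈ F.filStalk c x) :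
    F.grComp x c (F.grCls x c t ht) = F.grMk c x ⟨t, ht⟩ :=
  DirectSum.component.lof_self (R := ℂ) (M := fun c => F.Gr c x) c _

theorem grComp_grCls_of_ne {c d : ℂ} (h : c ≠ d) {t : ModStalk F.mod x} (ht : t ∈ F.filStalk c x) :
    F.grComp x d (F.grCls x c t ht) = 0 :=
  (DirectSum.component.of (R := ℂ) (M := fun c => F.Gr c x) d c _).trans (dif_neg h)

theorem toStalk_homogPart_smul_mem {c d : ℂ} (q : AddMonoidAlgebra ℂ L) {t : ModStalk F.mod x}
    (ht : t ∈ F.filStalk c x) :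
    P.groupAlgebraToStalk x (P.homogPart (d - c) q) • t ∈ F.filStalk d x := by
  have := F.toStalk_smul_mem (isHomog_homogPart (d - c) q) ht
  rwa [add_sub_cancel] at this

/-- A monomial of degree `c'` shifts `gr_c` to `gr_{c + c'}`, so only the part of degree `d - c`
reaches `gr_d`. Relations over `ℂ[L]` can thus be tested degree by degree. -/
theorem grComp_smul_grCls {c d : ℂ} (q : AddMonoidAlgebra ℂ L) {t : ModStalk F.mod x}
    (ht : t ∈ F.filStalk c x) : F.grComp x d (q • F.grCls x c t ht) =
      F.grMk d x ⟨P.groupAlgebraToStalk x (P.homogPart (d - c) q) • t,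
        F.toStalk_homogPart_smul_mem q ht⟩ := by
  induction q using AddMonoidAlgebra.induction_linear with
  | zero =>
    rw [zero_smul, map_zero]
    symm
    rw [← map_zero (F.grMk d x)]
    congr 1
    refine Subtype.ext ?_
    change P.groupAlgebraToStalk x (P.homogPart (d - c) 0) • t = 0
    rw [homogPart_zero, map_zero, zero_smul]
  | add p q hp hq =>
    rw [add_smul, map_add, hp, hq, ← map_add]
    congr 1
    refine Subtype.ext ?_
    change _ = P.groupAlgebraToStalk x (P.homogPart (d - c) (p + q)) • t
    rw [homogPart_add, map_add, add_smul]; rfl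
  | single γ w =>
    rw [single_smul_grCls]
    by_cases h : P.μ γ = d - c
    · have hd : d = c + P.μ γ := by rw [h]; ring
      subst hd
      rw [grComp_grCls]
      congr 1
      refine Subtype.ext ?_
      change _ = P.groupAlgebraToStalk x (P.homogPart (c + P.μ γ - c) (.single γ w)) • t
      rw [← h, homogPart_of_isHomog (isHomog_single γ w)]
    · have hd : c + P.μ γ ≠ d := fun e => h (by rw [← e]; ring)
      rw [grComp_grCls_of_ne _ hd]
      symm
      rw [← map_zero (F.grMk d x)]
      congr 1
      refine Subtype.ext ?_
      change P.groupAlgebraToStalk x (P.homogPart (d - c) (.single γ w)) • t = 0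
      rw [homogPart_single_of_ne w h, map_zero, zero_smul]

theorem grMk_eq_zero {c : ℂ} {t : ModStalk F.mod x} (ht : t ∈ F.filStalk c x) :
    F.grMk c x ⟨t, ht⟩ = 0 ↔ t ∈ F.filStalkLT c x := by
  rw [grMk, Submodule.mkQ_apply, Submodule.Quotient.mk_eq_zero]; rfl

theorem grMk_eq_iff {c : ℂ} {s t : ModStalk F.mod x} (hs : s ∈ F.filStalk c x)
    (ht : t ∈ F.filStalk c x) :
    F.grMk c x ⟨s, hs⟩ = F.grMk c x ⟨t, ht⟩ ↔ s - t ∈ F.filStalkLT c x := by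
  rw [← sub_eq_zero, ← map_sub]
  exact F.grMk_eq_zero (sub_mem hs ht)

variable (x) in
/-- Elements `e i` of `ℒ_{≤ c i}` whose classes form a basis of `gr ℒ` over `ℂ[L]`. -/
structure IsGrFrame {ι : Type} [Fintype ι] (c : ι → ℂ) (e : ι → ModStalk F.mod x) : Prop where
  mem : ∀ i, e i ∈ F.filStalk (c i) x
  indep : ∀ (d : ℂ) (q : ι → AddMonoidAlgebra ℂ L), (∀ i, P.IsHomog (d - c i) (q i)) →
    ∑ i, P.groupAlgebraToStalk x (q i) • e i ∈ F.filStalkLT d x → ∀ i, q i = 0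
  span : ∀ (d : ℂ), ∀ t ∈ F.filStalk d x, ∃ q : ι → AddMonoidAlgebra ℂ L,
    (∀ i, P.IsHomog (d - c i) (q i)) ∧
      t - ∑ i, P.groupAlgebraToStalk x (q i) • e i ∈ F.filStalkLT d x

namespace IsGrFrame

variable {F} {ι : Type} [Fintype ι] {c : ι → ℂ} {e : ι → ModStalk F.mod x}
  (h : F.IsGrFrame x c e)
include h

theorem sum_smul_mem (d : ℂ) {q : ι → AddMonoidAlgebra ℂ L} (hq : ∀ i, P.IsHomog (d - c i) (q i)) :
    ∑ i, P.groupAlgebraToStalk x (q i) • e i ∈ F.filStalk d x := by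
  refine sum_mem fun i _ => ?_
  have := F.toStalk_smul_mem (hq i) (h.mem i)
  rwa [add_sub_cancel] at this

theorem grCls_sum (d : ℂ) {q : ι → AddMonoidAlgebra ℂ L} (hq : ∀ i, P.IsHomog (d - c i) (q i)) :
    F.grCls x d (∑ i, P.groupAlgebraToStalk x (q i) • e i) (h.sum_smul_mem d hq) =
      ∑ i, q i • F.grCls x (c i) (e i) (h.mem i) := by
  have hm : ∀ i, P.groupAlgebraToStalk x (q i) • e i ∈ F.filStalk d x := fun i => by
    have := F.toStalk_smul_mem (hq i) (h.mem i)
    rwa [add_sub_cancel] at this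
  have e1 : ∀ i, q i • F.grCls x (c i) (e i) (h.mem i) = F.grIncl d x (F.grMk d x ⟨_, hm i⟩) :=
    fun i => (F.smul_grCls (hq i) (h.mem i)).trans
      (F.grIncl_congr (add_sub_cancel _ _) rfl _ (hm i))
  rw [Finset.sum_congr rfl fun i _ => e1 i, ← map_sum, ← map_sum, grCls]
  congr 2
  refine Subtype.ext ?_
  rw [AddSubmonoidClass.coe_finsetSum]

theorem grCls_eq {d : ℂ} {t : ModStalk F.mod x} (ht : t ∈ F.filStalk d x)
    {q : ι → AddMonoidAlgebra ℂ L} (hq : ∀ i, P.IsHomog (d - c i) (q i))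
    (hlt : t - ∑ i, P.groupAlgebraToStalk x (q i) • e i ∈ F.filStalkLT d x) :
    F.grCls x d t ht = ∑ i, q i • F.grCls x (c i) (e i) (h.mem i) := by
  rw [← h.grCls_sum d hq, grCls, grCls, (F.grMk_eq_iff _ _).2 hlt]

theorem linearIndependent : LinearIndependent (AddMonoidAlgebra ℂ L)
    fun i => F.grCls x (c i) (e i) (h.mem i) := by
  refine Fintype.linearIndependent_iff.2 fun p hp i => ?_
  refine AddMonoidAlgebra.ext (Finsupp.ext fun γ => ?_)
  -- In this degree the homogeneous part of `p i` consists exactly of its coefficient at `γ`.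
  set d := c i + P.μ γ with hd
  have h1 := congrArg (F.grComp x d) hp
  rw [map_sum, map_zero, Finset.sum_congr rfl fun j _ => F.grComp_smul_grCls (p j) (h.mem j),
    ← map_sum] at h1
  have h2 := h.indep d (fun j => P.homogPart (d - c j) (p j))
    (fun j => isHomog_homogPart _ _) ?_ i
  · have h3 : d - c i = P.μ γ := by rw [hd]; ring
    rw [h3] at h2
    rw [← homogPart_coeff (P := P), h2]
  · rw [← F.grMk_eq_zero (h.sum_smul_mem d fun j => isHomog_homogPart _ _), ← h1]
    congr 1
    refine Subtype.ext ?_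
    rw [AddSubmonoidClass.coe_finsetSum]

theorem span_eq_top : ⊤ ≤ Submodule.span (AddMonoidAlgebra ℂ L)
    (Set.range fun i => F.grCls x (c i) (e i) (h.mem i)) := by
  intro v _
  induction v using DirectSum.induction_on with
  | zero => exact zero_mem _
  | add v w hv hw => exact add_mem (hv trivial) (hw trivial)
  | of d v =>
    obtain ⟨t, rfl⟩ := Submodule.mkQ_surjective _ v
    obtain ⟨q, hq, hlt⟩ := h.span d t.1 t.2
    have := h.grCls_eq t.2 hq hlt
    change F.grCls x d t.1 t.2 ∈ _
    rw [this]
    exact sum_mem fun i _ => Submodule.smul_mem _ _ (Submodule.subset_span ⟨i, rfl⟩)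

/-- The basis of `gr ℒ` over `ℂ[L]`. -/
def grBasis : Module.Basis ι (AddMonoidAlgebra ℂ L) (F.GrTot x) :=
  Module.Basis.mk h.linearIndependent h.span_eq_top

theorem grBasis_apply (i : ι) : h.grBasis i = F.grCls x (c i) (e i) (h.mem i) :=
  Module.Basis.mk_apply _ _ _

/-- The basis of `𝒜_μ ⊗ gr ℒ` over `𝒜_μ`. -/
def tensorBasis : Module.Basis ι (P.Stalk x) (F.TensorStalk x) :=
  Algebra.TensorProduct.basis (P.Stalk x) h.grBasis

theorem tensorBasis_apply (i : ι) :
    h.tensorBasis i = 1 ⊗ₜ F.grCls x (c i) (e i) (h.mem i) := by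
  rw [tensorBasis, Algebra.TensorProduct.basis_apply, grBasis_apply]

theorem tmul_grCls {d : ℂ} {t : ModStalk F.mod x} (ht : t ∈ F.filStalk d x)
    {q : ι → AddMonoidAlgebra ℂ L} (hq : ∀ i, P.IsHomog (d - c i) (q i))
    (hlt : t - ∑ i, P.groupAlgebraToStalk x (q i) • e i ∈ F.filStalkLT d x) (a : P.Stalk x) :
    a ⊗ₜ F.grCls x d t ht = ∑ i, (a * P.groupAlgebraToStalk x (q i)) • h.tensorBasis i := by
  rw [h.grCls_eq ht hq hlt, TensorProduct.tmul_sum]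
  refine Finset.sum_congr rfl fun i _ => ?_
  rw [tensorBasis_apply, TensorProduct.smul_tmul', TensorProduct.tmul_smul,
    TensorProduct.smul_tmul', smul_eq_mul, mul_one, Algebra.smul_def, mul_comm]
  rfl

/-- A generator `a ⊗ v` with `v` of degree `c''` has coordinates `a qᵢ`, where `qᵢ` is homogeneous
of degree `c'' - c i`. So the filtration of the tensor product is the one with basis elements of
degree `c i`. -/
theorem mem_tensorFil_iff {d : ℂ} (a : ι → P.Stalk x) :
    ∑ i, a i • h.tensorBasis i ∈ F.tensorFil d x ↔ ∀ i, a i ∈ P.stalkLE x (d - c i) := by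
  constructor
  · have key : ∀ t ∈ F.tensorFil d x, ∀ i, h.tensorBasis.repr t i ∈ P.stalkLE x (d - c i) := by
      intro t ht
      induction ht using AddSubgroup.closure_induction with
      | mem t ht =>
        obtain ⟨c', c'', hc, a, ha, v, rfl⟩ := ht
        obtain ⟨s, rfl⟩ := Submodule.mkQ_surjective _ v
        obtain ⟨q, hq, hlt⟩ := h.span c'' s.1 s.2
        intro i
        have e1 := h.tmul_grCls s.2 hq hlt a
        change h.tensorBasis.repr (a ⊗ₜ F.grCls x c'' s.1 s.2) i ∈ _
        rw [e1, Module.Basis.repr_sum_self]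
        refine stalkLE_mono ?_ (mul_mem_stalkLE ha (hq i).toStalk_mem)
        have : c' + (c'' - c i) = (c' + c'') - c i := by ring
        rw [this, sub_eq_add_neg, sub_eq_add_neg]
        exact leAt_add_right.2 hc
      | zero => intro i; rw [map_zero]; exact zero_mem_stalkLE
      | add s t _ _ hs ht => intro i; rw [map_add]; exact add_mem_stalkLE (hs i) (ht i)
      | neg t _ ht => intro i; rw [map_neg]; exact neg_mem_stalkLE (ht i)
    intro hm i
    have := key _ hm i
    rwa [Module.Basis.repr_sum_self] at this
  · intro ha
    refine sum_mem fun i _ => AddSubgroup.subset_closure ⟨d - c i, c i, ?_, a i, ha i,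
      F.grMk (c i) x ⟨e i, h.mem i⟩, ?_⟩
    · rw [sub_add_cancel]; exact LeAt.refl _ _
    · rw [tensorBasis_apply, TensorProduct.smul_tmul', smul_eq_mul, mul_one]; rfl

end IsGrFrame

end FilteredModule

end

section

open PeriodMap

theorem exists_common_nhds {κ : Type*} [Finite κ] {x : S1} (W : κ → Opens S1) (hx : ∀ k, x ∈ W k) :
    ∃ V : Opens S1, x ∈ V ∧ ∀ k, V ≤ W k :=
  ⟨⟨⋂ k, (W k : Set S1), isOpen_iInter_of_finite fun k => (W k).isOpen⟩,
    Set.mem_iInter.2 hx, fun k => Set.iInter_subset (fun k => (W k : Set S1)) k⟩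

theorem PeriodMap.toStalk_smul {x : S1} (w : ℂ) (q : AddMonoidAlgebra ℂ L) :
    P.groupAlgebraToStalk x (w • q) = P.constStalk x w * P.groupAlgebraToStalk x q := by
  induction q using AddMonoidAlgebra.induction_linear with
  | zero => simp
  | add p q hp hq => rw [smul_add, map_add, map_add, hp, hq, mul_add]
  | single γ a =>
    rw [AddMonoidAlgebra.smul_single, toStalk_single, toStalk_single, smul_eq_mul, map_mul, mul_assoc]

namespace FilteredModule

variable (F : FilteredModule P) {x : S1}

/-! ### Frames -/

variable (x) in
/-- A basis `e` of the stalk of `ℒ` at `x`, with exponents `c i ∈ -C`, in which the filtration is given by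
`∑ aᵢ eᵢ ∈ ℒ_{≤ d}` if and only if `aᵢ ∈ 𝒜_μ^{≤ d - c i}` for all `i`. -/
structure IsFrame (C : Finset ℂ) {ι : Type} [Fintype ι] (c : ι → ℂ) (e : ι → ModStalk F.mod x) :
    Prop where
  exponent : ∀ i, -c i ∈ C
  exists_sum : ∀ t, ∃ a : ι → P.Stalk x, ∑ i, a i • e i = t
  eq_zero : ∀ a : ι → P.Stalk x, ∑ i, a i • e i = 0 → ∀ i, a i = 0
  mem_iff : ∀ (a : ι → P.Stalk x) (d : ℂ),
    ∑ i, a i • e i ∈ F.filStalk d x ↔ ∀ i, a i ∈ P.stalkLE x (d - c i)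

namespace IsFrame

variable {F} {C : Finset ℂ} {ι : Type} [Fintype ι] {c : ι → ℂ} {e : ι → ModStalk F.mod x}
  (h : F.IsFrame x C c e)
include h

theorem ext {a b : ι → P.Stalk x} (hab : ∑ i, a i • e i = ∑ i, b i • e i) : a = b := by
  funext i
  refine sub_eq_zero.1 (h.eq_zero (fun i => a i - b i) ?_ i)
  simp only [sub_smul, Finset.sum_sub_distrib, hab, sub_self]

theorem mem (i : ι) : e i ∈ F.filStalk (c i) x := by
  classical
  have e1 : e i = ∑ j, (Pi.single i (1 : P.Stalk x) : ι → P.Stalk x) j • e j := by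
    rw [Finset.sum_eq_single i (fun j _ hj => by rw [Pi.single_eq_of_ne hj, zero_smul])
      (fun hi => absurd (Finset.mem_univ i) hi), Pi.single_eq_same, one_smul]
  rw [e1, h.mem_iff]
  intro j
  by_cases hj : j = i
  · subst hj
    rw [Pi.single_eq_same, sub_self]
    exact one_mem_stalkLE
  · rw [Pi.single_eq_of_ne hj]
    exact zero_mem_stalkLE

/-- The definition of a filtered module only controls multiplication by `𝒜_μ^{≤ 0}` and by the
`u^γ`. Compatibility with `𝒜_μ^{≤ d}` for all `d` is a consequence of having a frame. -/
theorem smul_mem {a : P.Stalk x} {d : ℂ} {t : ModStalk F.mod x} {d' : ℂ}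
    (ha : a ∈ P.stalkLE x d) (ht : t ∈ F.filStalk d' x) : a • t ∈ F.filStalk (d + d') x := by
  obtain ⟨b, rfl⟩ := h.exists_sum t
  rw [h.mem_iff] at ht
  rw [Finset.smul_sum]
  simp only [smul_smul]
  rw [h.mem_iff]
  intro i
  rw [add_sub_assoc]
  exact mul_mem_stalkLE ha (ht i)

theorem mem_LT_iff (a : ι → P.Stalk x) (d : ℂ) :
    ∑ i, a i • e i ∈ F.filStalkLT d x ↔ ∀ i, a i ∈ P.stalkLT x (d - c i) := by
  constructor
  · intro ha i
    obtain ⟨d', hd', ha⟩ := F.mem_filStalkLT_iff.1 ha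
    refine ⟨d' - c i, ?_, (h.mem_iff a d').1 ha i⟩
    rw [sub_eq_add_neg, sub_eq_add_neg]
    exact ltAt_add_right.2 hd'
  · intro ha
    refine sum_mem fun i _ => F.mem_filStalkLT_iff.2 ?_
    obtain ⟨d', hd', ha⟩ := ha i
    refine ⟨d' + c i, ?_, h.smul_mem ha (h.mem i)⟩
    have := (ltAt_add_right (c := c i)).2 hd'
    rwa [sub_add_cancel] at this

/-- An element of `ℒ_{≤ d}` agrees modulo `ℒ_{< d}` with the sum of the leading terms of its
coordinates, and these are unique since a nonzero monomial is not of smaller order than its degree.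
-/
theorem isGrFrame : F.IsGrFrame x c e where
  mem := h.mem
  indep d q hq hlt i := (hq i).eq_zero_of_mem ((h.mem_LT_iff _ d).1 hlt i)
  span d t ht := by
    obtain ⟨a, rfl⟩ := h.exists_sum t
    have := fun i => exists_homog_lead_stalk ((h.mem_iff a d).1 ht i)
    choose q hq hlt using this
    refine ⟨q, hq, ?_⟩
    rw [← Finset.sum_sub_distrib]
    simp only [← sub_smul]
    exact (h.mem_LT_iff _ d).2 hlt

/-- The basis given by a frame. -/
def basis : Module.Basis ι (P.Stalk x) (ModStalk F.mod x) :=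
  Module.Basis.mk (v := e) (Fintype.linearIndependent_iff.2 h.eq_zero) fun t _ => by
    obtain ⟨a, rfl⟩ := h.exists_sum t
    exact sum_mem fun i _ => Submodule.smul_mem _ _ (Submodule.subset_span ⟨i, rfl⟩)

theorem basis_apply (i : ι) : h.basis i = e i := Module.Basis.mk_apply _ _ _

/-- The isomorphism `𝒜_μ ⊗ gr ℒ ≅ ℒ` of stalks defined by a frame. -/
def tensorEquiv : F.TensorStalk x ≃ₗ[P.Stalk x] ModStalk F.mod x :=
  h.isGrFrame.tensorBasis.equiv h.basis (Equiv.refl ι)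

theorem tensorEquiv_sum (a : ι → P.Stalk x) :
    h.tensorEquiv (∑ i, a i • h.isGrFrame.tensorBasis i) = ∑ i, a i • e i := by
  rw [map_sum]
  refine Finset.sum_congr rfl fun i _ => ?_
  rw [map_smul, tensorEquiv, Module.Basis.equiv_apply, Equiv.refl_apply, basis_apply]

theorem tensorEquiv_mem (d : ℂ) (t : F.TensorStalk x) :
    h.tensorEquiv t ∈ F.filStalk d x ↔ t ∈ F.tensorFil d x := by
  have e1 := h.isGrFrame.tensorBasis.sum_repr t
  rw [← e1, h.tensorEquiv_sum, h.mem_iff, h.isGrFrame.mem_tensorFil_iff]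

theorem tensorEquiv_tmul {d : ℂ} {t : ModStalk F.mod x} (ht : t ∈ F.filStalk d x)
    {q : ι → AddMonoidAlgebra ℂ L} (hq : ∀ i, P.IsHomog (d - c i) (q i))
    (hlt : t - ∑ i, P.groupAlgebraToStalk x (q i) • e i ∈ F.filStalkLT d x) (a : P.Stalk x) :
    h.tensorEquiv (a ⊗ₜ F.grCls x d t ht) = ∑ i, (a * P.groupAlgebraToStalk x (q i)) • e i := by
  rw [h.isGrFrame.tmul_grCls ht hq hlt, h.tensorEquiv_sum]

end IsFrame

/-- Sections over `U` that form a frame at each point of `U`. -/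
def IsFrameOn (C : Finset ℂ) {ι : Type} [Fintype ι] (c : ι → ℂ) (U : Opens S1)
    (e : ι → ModSec F.mod U) : Prop :=
  ∀ y (hy : y ∈ U), F.IsFrame y C c fun i => germ F.mod U y hy (e i)

/-- Every point has a neighbourhood over which there is a frame. -/
def HasLocalFrames (C : Finset ℂ) : Prop :=
  ∀ x : S1, ∃ (U : Opens S1) (_ : x ∈ U) (ι : Type) (_ : Fintype ι) (c : ι → ℂ)
    (e : ι → ModSec F.mod U), F.IsFrameOn C c U e

theorem germ_sum_smul (M : P.Mod) {ι : Type*} [Fintype ι] {U V : Opens S1} (hV : V ≤ U)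
    (a : ι → P.Sec V) (e : ι → ModSec M U) (y : S1) (hy : y ∈ V) :
    germ M V y hy (∑ i, a i • res M hV (e i)) =
      ∑ i, P.stalkGerm V y hy (a i) • germ M U y (hV hy) (e i) := by
  rw [map_sum]
  exact Finset.sum_congr rfl fun i _ => by rw [germ_smul, germ_res]

namespace IsFrameOn

variable {F} {C : Finset ℂ} {ι : Type} [Fintype ι] {c : ι → ℂ} {U : Opens S1}
  {e : ι → ModSec F.mod U} (h : F.IsFrameOn C c U e)

theorem mono {V : Opens S1} (h : F.IsFrameOn C c U e) (hV : V ≤ U) :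
    F.IsFrameOn C c V fun i => res F.mod hV (e i) := by
  intro y hy
  simp only [germ_res]
  exact h y (hV hy)

include h

/-- The coordinates of a section near a point. -/
theorem exists_coord {V : Opens S1} (hU : x ∈ U) (hV : x ∈ V) (s : ModSec F.mod V) :
    ∃ (W : Opens S1) (h₁ : W ≤ U) (h₂ : W ≤ V) (_ : x ∈ W) (a : ι → P.Sec W), ∀ y (hy : y ∈ W),
      germ F.mod V y (h₂ hy) s =
        ∑ i, P.stalkGerm W y hy (a i) • germ F.mod U y (h₁ hy) (e i) := by
  obtain ⟨a, ha⟩ := (h x hU).exists_sum (germ F.mod V x hV s)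
  choose W₀ hW₀ hxW₀ b hb using fun i => exists_stalkGerm_le hU (a i)
  obtain ⟨W, hxW, hW⟩ := exists_common_nhds (fun o : Option ι => o.elim U W₀)
    (by rintro (_ | i); exacts [hU, hxW₀ i])
  have hWU : W ≤ U := hW none
  have hWi : ∀ i, W ≤ W₀ i := fun i => hW (some i)
  obtain ⟨W', h₁, h₂, hxW', e'⟩ := germ_eq F.mod (U := V) (V := W) hV hxW (s := s)
    (t := ∑ i, resSec (hWi i) (b i) • res F.mod hWU (e i)) (by
      rw [germ_sum_smul, ← ha]
      exact Finset.sum_congr rfl fun i _ => by rw [stalkGerm_res, hb])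
  refine ⟨W', h₂.trans hWU, h₁, hxW', fun i => resSec (h₂.trans (hWi i)) (b i), fun y hy => ?_⟩
  rw [← germ_res F.mod h₁ y hy, e', germ_res, germ_sum_smul]
  exact Finset.sum_congr rfl fun i _ => by rw [stalkGerm_res, stalkGerm_res]

/-- The leading terms of a section near a point. -/
theorem exists_homog {V : Opens S1} (hU : x ∈ U) (hV : x ∈ V) {d : ℂ} {s : ModSec F.mod V}
    (hs : s ∈ F.fil d V) :
    ∃ (W : Opens S1) (h₁ : W ≤ U) (h₂ : W ≤ V) (_ : x ∈ W) (q : ι → AddMonoidAlgebra ℂ L),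
      (∀ i, P.IsHomog (d - c i) (q i)) ∧ ∀ y (hy : y ∈ W),
      germ F.mod V y (h₂ hy) s - ∑ i, P.groupAlgebraToStalk y (q i) • germ F.mod U y (h₁ hy) (e i) ∈
        F.filStalkLT d y := by
  obtain ⟨W, h₁, h₂, hxW, a, ha⟩ := h.exists_coord hU hV s
  have hle : ∀ i, P.stalkGerm W x hxW (a i) ∈ P.stalkLE x (d - c i) := by
    refine ((h x hU).mem_iff _ d).1 ?_
    rw [← ha x hxW]
    exact F.germ_mem _ hs
  choose W₀ hW₀ hxW₀ q hq hlt using fun i => exists_homog_lead (a i) hxW (hle i)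
  obtain ⟨W', hxW', hW'⟩ := exists_common_nhds (fun o : Option ι => o.elim W W₀)
    (by rintro (_ | i); exacts [hxW, hxW₀ i])
  refine ⟨W', (hW' none).trans h₁, (hW' none).trans h₂, hxW', q, hq, fun y hy => ?_⟩
  rw [ha y (hW' none hy), ← Finset.sum_sub_distrib]
  simp only [← sub_smul]
  exact ((h y _).mem_LT_iff _ d).2 fun i => hlt i y (hW' (some i) hy)

theorem section_mem_fil (d : ℂ) {a : ι → P.Sec U}
    (ha : ∀ i, IsLE (d - c i) (a i)) : ∑ i, a i • e i ∈ F.fil d U := by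
  refine F.mem_fil_iff.2 fun y hy => ?_
  have := germ_sum_smul F.mod le_rfl a e y hy
  have e1 : ∀ i, res F.mod (le_refl U) (e i) = e i := fun i =>
    section_ext F.mod fun z hz => germ_res _ _ _ _ _
  simp only [e1] at this
  rw [this, (h y hy).mem_iff]
  exact fun i => isLE_iff.1 (ha i) y hy

end IsFrameOn

/-- Homogeneous coordinates of degree `d`. -/
def homogCoord (P : PeriodMap L) {ι : Type} (c : ι → ℂ) (d : ℂ) :
    Submodule ℂ (ι → AddMonoidAlgebra ℂ L) where
  carrier := {q | ∀ i, P.IsHomog (d - c i) (q i)}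
  zero_mem' i := isHomog_zero _
  add_mem' {p q} hp hq i γ hγ := by
    by_cases h : (p i).coeff γ = 0
    · refine hq i γ fun h' => hγ ?_
      change ((p i) + (q i)).coeff γ = 0
      rw [AddMonoidAlgebra.coeff_add, Finsupp.add_apply, h, h', add_zero]
    · exact hp i γ h
  smul_mem' w q hq i γ hγ := hq i γ fun h => hγ (by
    change (w • q i).coeff γ = 0
    rw [AddMonoidAlgebra.coeff_smul_apply, h, smul_zero])

/-- Each homogeneous coordinate is determined by one complex number, because at most one `γ` has the
required degree. -/
instance {ι : Type} [Finite ι] (c : ι → ℂ) (d : ℂ) :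
    FiniteDimensional ℂ (homogCoord P c d) := by
  classical
  let f : homogCoord P c d →ₗ[ℂ] (ι → ℂ) :=
    { toFun := fun q i => if h : ∃ γ, P.μ γ = d - c i then (q.1 i).coeff h.choose else 0
      map_add' := fun p q => by
        funext i
        simp only [Pi.add_apply]
        split_ifs
        · exact Finsupp.add_apply _ _ _
        · rw [add_zero]
      map_smul' := fun w q => by
        funext i
        simp only [Pi.smul_apply, RingHom.id_apply]
        split_ifs
        · exact AddMonoidAlgebra.coeff_smul_apply _ _ _
        · rw [smul_zero] }
  refine Module.Finite.of_injective f ((injective_iff_map_eq_zero f).2 fun q hq => ?_)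
  refine Subtype.ext (funext fun i => ?_)
  by_cases h : ∃ γ, P.μ γ = d - c i
  · rw [(q.2 i).eq_single h.choose_spec]
    have : f q i = 0 := congrFun hq i
    simp only [f, LinearMap.coe_mk, AddHom.coe_mk, dif_pos h] at this
    rw [this]
    exact AddMonoidAlgebra.ext (by simp)
  · push Not at h
    exact (q.2 i).eq_zero h

/-- The map from homogeneous coordinates to `gr_d ℒ`. -/
def IsGrFrame.grMap {F : FilteredModule P} {x : S1} {ι : Type} [Fintype ι] {c : ι → ℂ}
    {e : ι → ModStalk F.mod x} (h : F.IsGrFrame x c e) (d : ℂ) :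
    homogCoord P c d →ₗ[ℂ] F.Gr d x where
  toFun q := F.grMk d x ⟨∑ i, P.groupAlgebraToStalk x (q.1 i) • e i, h.sum_smul_mem d q.2⟩
  map_add' p q := by
    rw [← map_add]
    congr 1
    refine Subtype.ext ?_
    change _ = (∑ i, P.groupAlgebraToStalk x (p.1 i) • e i) +
      ∑ i, P.groupAlgebraToStalk x (q.1 i) • e i
    rw [← Finset.sum_add_distrib]
    exact Finset.sum_congr rfl fun i _ => by
      rw [← add_smul, ← map_add]; rfl
  map_smul' w q := by
    rw [RingHom.id_apply, ← map_smul]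
    congr 1
    refine Subtype.ext ?_
    change _ = w • ∑ i, P.groupAlgebraToStalk x (q.1 i) • e i
    rw [Finset.smul_sum]
    refine Finset.sum_congr rfl fun i _ => ?_
    rw [complex_smul_def, smul_smul, ← toStalk_smul]; rfl

/-- The isomorphism from homogeneous coordinates to `gr_d ℒ`. -/
def IsGrFrame.grEquiv {F : FilteredModule P} {x : S1} {ι : Type} [Fintype ι] {c : ι → ℂ}
    {e : ι → ModStalk F.mod x} (h : F.IsGrFrame x c e) (d : ℂ) :
    homogCoord P c d ≃ₗ[ℂ] F.Gr d x :=
  LinearEquiv.ofBijective (h.grMap d) <| by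
    refine ⟨(injective_iff_map_eq_zero _).2 fun q hq => ?_, fun v => ?_⟩
    · exact Subtype.ext (funext fun i => h.indep d q.1 q.2 ((F.grMk_eq_zero _).1 hq) i)
    · obtain ⟨t, rfl⟩ := Submodule.mkQ_surjective _ v
      obtain ⟨q, hq, hlt⟩ := h.span d t.1 t.2
      exact ⟨⟨q, hq⟩, ((F.grMk_eq_iff t.2 (h.sum_smul_mem d hq)).2 hlt).symm⟩

theorem IsGrFrame.grEquiv_apply {F : FilteredModule P} {x : S1} {ι : Type} [Fintype ι] {c : ι → ℂ}
    {e : ι → ModStalk F.mod x} (h : F.IsGrFrame x c e) (d : ℂ) (q : homogCoord P c d) :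
    h.grEquiv d q = F.grMk d x
      ⟨∑ i, P.groupAlgebraToStalk x (q.1 i) • e i, h.sum_smul_mem d q.2⟩ := rfl

/-- A frame identifies every `gr_d ℒ` with a space of homogeneous coordinates that does not depend
on the point, and sends the induced basis of `𝒜_μ ⊗ gr ℒ` to the frame. The first makes `gr_d ℒ` a
local system, the second is a splitting. -/
theorem isBetti_of_hasLocalFrames {F : FilteredModule P} {C : Finset ℂ} (hF : F.HasLocalFrames C) :
    F.IsBetti C where
  local_system d x := by
    obtain ⟨U, hx, ι, _, c, e, h⟩ := hF x
    refine ⟨U, hx, _, fun y => (Module.finBasis ℂ (homogCoord P c d)).equivFun.symm ≪≫ₗ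
      (h y.1 y.2).isGrFrame.grEquiv d, fun w => ?_⟩
    set q := (Module.finBasis ℂ (homogCoord P c d)).equivFun.symm w with hq
    choose b hb using fun i => (q.2 i).exists_section U
    intro y
    refine ⟨U, le_rfl, y.2, ∑ i, b i • e i, h.section_mem_fil d fun i => isLE_iff.2 fun z hz => ?_,
      fun z => ?_⟩
    · rw [hb]; exact (q.2 i).toStalk_mem
    · refine ((h z.1 z.2).isGrFrame.grEquiv_apply d q).trans ?_
      congr 1
      refine Subtype.ext ?_
      change _ = germ F.mod U z.1 z.2 (∑ i, b i • e i)
      rw [map_sum]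
      exact Finset.sum_congr rfl fun i _ => by rw [germ_smul, hb]
  exponents d x hd := by
    obtain ⟨U, hx, ι, _, c, e, h⟩ := hF x
    have hn := ((h x hx).isGrFrame.grEquiv d).toEquiv.nontrivial_congr.2 hd
    obtain ⟨q, hq⟩ := exists_ne (0 : homogCoord P c d)
    obtain ⟨i, hi⟩ : ∃ i, q.1 i ≠ 0 := by
      by_contra! hcon
      exact hq (Subtype.ext (funext hcon))
    obtain ⟨γ, hγ⟩ : ∃ γ, (q.1 i).coeff γ ≠ 0 := by
      by_contra! hcon
      exact hi (AddMonoidAlgebra.ext (Finsupp.ext hcon))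
    refine ⟨-c i, (h x hx).exponent i, γ, ?_⟩
    rw [q.2 i γ hγ]; ring
  splitting x := by
    obtain ⟨U, hx, ι, _, c, e, h⟩ := hF x
    refine ⟨U, hx, ⟨⟨fun y => (h y.1 y.2).tensorEquiv, ?_, fun y d t =>
      (h y.1 y.2).tensorEquiv_mem d t, ?_⟩⟩⟩
    · intro V hV t ht
      refine (exists_section F.mod (fun y : V => (h y.1 (hV y.2)).tensorEquiv (t y)) fun x => ?_)
      obtain ⟨V₁, hV₁, hxV₁, n, a, d, v, hv, ht⟩ := ht x
      choose V₂ hV₂ hxV₂ s hs hs' using fun k => hv k ⟨x.1, hxV₁⟩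
      -- The leading terms `q k` are the same at all points of `W k`, so the image of the given
      -- section has sections of `𝒜_μ` as coordinates.
      choose W h₁ h₂ hxW q hq hlt using fun k => h.exists_homog (hV x.2) (hxV₂ k) (hs k)
      obtain ⟨W', hxW', hW'⟩ := exists_common_nhds (fun o : Option (Fin n) => o.elim V₁ W)
        (by rintro (_ | k); exacts [hxV₁, hxW k])
      have hW₁ : W' ≤ V₁ := hW' none
      have hWk : ∀ k, W' ≤ W k := fun k => hW' (some k)
      have hWU : W' ≤ U := (hW₁.trans hV₁).trans hV
      choose b hb using fun k i => (hq k i).exists_section W'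
      refine ⟨W', hW₁.trans hV₁, hxW',
        ∑ k, ∑ i, (resSec hW₁ (a k) * b k i) • res F.mod hWU (e i), fun y => ?_⟩
      have e1 := ht ⟨y.1, hW₁ y.2⟩
      refine Eq.trans ?_ (congrArg (h y.1 (hWU y.2)).tensorEquiv e1).symm
      rw [map_sum, map_sum]
      refine Finset.sum_congr rfl fun k _ => ?_
      rw [germ_sum_smul]
      have e2 := hs' k ⟨y.1, h₂ k (hWk k y.2)⟩
      refine Eq.trans ?_ (congrArg (fun v => (h y.1 (hWU y.2)).tensorEquiv
        (P.stalkGerm V₁ y.1 (hW₁ y.2) (a k) ⊗ₜ[AddMonoidAlgebra ℂ L] F.grIncl (d k) y.1 v)) e2).symm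
      refine Eq.trans ?_ ((h y.1 (hWU y.2)).tensorEquiv_tmul (F.germ_mem _ (hs k)) (hq k)
        (hlt k y.1 (hWk k y.2)) _).symm
      exact Finset.sum_congr rfl fun i _ => by rw [map_mul, stalkGerm_res, hb]
    · intro y d v
      obtain ⟨t, rfl⟩ := Submodule.mkQ_surjective _ v
      obtain ⟨q, hq, hlt⟩ := (h y.1 y.2).isGrFrame.span d t.1 t.2
      have e1 := (h y.1 y.2).tensorEquiv_tmul t.2 hq hlt 1
      simp only [one_mul] at e1
      have e2 : (h y.1 y.2).tensorEquiv (1 ⊗ₜ F.grIncl d y.1 (Submodule.mkQ _ t)) = _ := e1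
      have hm : (h y.1 y.2).tensorEquiv (1 ⊗ₜ F.grIncl d y.1 (Submodule.mkQ _ t)) ∈
          F.filStalk d y.1 := by
        rw [e2]; exact (h y.1 y.2).isGrFrame.sum_smul_mem d hq
      refine ⟨hm, (F.grMk_eq_iff hm t.2).2 ?_⟩
      rw [e2, ← neg_sub]
      exact neg_mem hlt

end FilteredModule

end

section

open PeriodMap

namespace FilteredModule

variable {F : FilteredModule P}

/-! ### Objects of the category have local frames -/

theorem expMul_expMul (β γ : L) {x : S1} (t : ModStalk F.mod x) :
    F.expMul β x (F.expMul γ x t) = F.expMul (β + γ) x t := by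
  refine (smul_smul (P.expStalk x β) (P.expStalk x γ) t).trans ?_
  rw [← expStalk_add]; rfl

theorem expMul_zero {x : S1} (t : ModStalk F.mod x) : F.expMul 0 x t = t := by
  refine Eq.trans ?_ (one_smul (P.Stalk x) t)
  rw [← expStalk_zero]; rfl

/-! ### From bases of the pieces `gr_{-c₀} ℒ` to a basis of `gr ℒ` -/

section LocalSystemBasis

variable {x : S1} {C : Finset ℂ} {n : C → ℕ} {e : (Σ c₀ : C, Fin (n c₀)) → ModStalk F.mod x}

theorem sum_toStalk_smul_eq {c₀ : C} {γ : L} {q : (Σ c₀ : C, Fin (n c₀)) → AddMonoidAlgebra ℂ L}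
    {w : Fin (n c₀) → ℂ} (h : ∀ k, q ⟨c₀, k⟩ = AddMonoidAlgebra.single γ (w k))
    (h0 : ∀ c₁ k, c₁ ≠ c₀ → q ⟨c₁, k⟩ = 0) :
    ∑ i, P.groupAlgebraToStalk x (q i) • e i = F.expMul γ x (∑ k, w k • e ⟨c₀, k⟩) := by
  rw [Fintype.sum_sigma, Finset.sum_eq_single c₀, map_sum]
  · refine Finset.sum_congr rfl fun k _ => ?_
    rw [h, toStalk_single, map_smul, mul_smul]
    rfl
  · intro c₁ _ hne
    exact Finset.sum_eq_zero fun k _ => by rw [h0 c₁ k hne, map_zero, zero_smul]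
  · exact fun h => absurd (Finset.mem_univ _) h

variable (φ : ∀ c₀ : C, (Fin (n c₀) → ℂ) ≃ₗ[ℂ] F.Gr (-(c₀ : ℂ)) x)
  (he : ∀ i : Σ c₀ : C, Fin (n c₀), e i ∈ F.filStalk (-(i.1 : ℂ)) x)
  (hφ : ∀ i : Σ c₀ : C, Fin (n c₀), F.grMk (-(i.1 : ℂ)) x ⟨e i, he i⟩ = φ i.1 (Pi.single i.2 1))

include he in
theorem sum_smul_mem_filStalk {c₀ : C} (w : Fin (n c₀) → ℂ) :
    ∑ k, w k • e ⟨c₀, k⟩ ∈ F.filStalk (-(c₀ : ℂ)) x :=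
  sum_mem fun k _ => Submodule.smul_mem _ _ (he ⟨c₀, k⟩)

include hφ in
theorem grMk_sum_smul {c₀ : C} (w : Fin (n c₀) → ℂ) :
    F.grMk (-(c₀ : ℂ)) x ⟨∑ k, w k • e ⟨c₀, k⟩, sum_smul_mem_filStalk he w⟩ = φ c₀ w := by
  have e1 : (⟨∑ k, w k • e ⟨c₀, k⟩, sum_smul_mem_filStalk he w⟩ : F.filStalk (-(c₀ : ℂ)) x) =
      ∑ k, w k • ⟨e ⟨c₀, k⟩, he ⟨c₀, k⟩⟩ := by
    refine Subtype.ext ?_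
    rw [AddSubmonoidClass.coe_finsetSum]
    rfl
  rw [e1, map_sum]
  conv_rhs => rw [← Finset.univ_sum_single w, map_sum]
  refine Finset.sum_congr rfl fun k _ => ?_
  rw [map_smul, hφ ⟨c₀, k⟩, ← map_smul]
  congr 1
  rw [← Pi.single_smul, smul_eq_mul, mul_one]

include hφ in
/-- Elements whose classes form bases of the `gr_{-c₀} ℒ`, `c₀ ∈ C`, form a basis of `gr ℒ`. -/
theorem isGrFrame_of_basis (hC : ∀ c ∈ C, ∀ c' ∈ C, c ≠ c' → ∀ γ : L, c ≠ c' + P.μ γ)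
    (hexp : ∀ c, Nontrivial (F.Gr c x) → ∃ c₀ ∈ C, ∃ γ : L, c = -c₀ + P.μ γ) :
    F.IsGrFrame x (fun i => -(i.1 : ℂ)) e where
  mem := he
  indep d q hq hlt := by
    rintro ⟨c₀, k⟩
    by_cases hex : ∃ γ, P.μ γ = d - -(c₀ : ℂ)
    · obtain ⟨γ, hγ⟩ := hex
      have hd : d = -(c₀ : ℂ) + P.μ γ := by rw [hγ]; ring
      rw [sum_toStalk_smul_eq (w := fun k => (q ⟨c₀, k⟩).coeff γ)
        (fun k => (hq ⟨c₀, k⟩).eq_single hγ) fun c₁ k hne => (hq ⟨c₁, k⟩).eq_zero fun β hβ => ?_] at hlt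
      · have h1 := F.expMul_mem_LT (-γ) hlt
        have h2 : F.expMul (-γ) x (F.expMul γ x (∑ k, (q ⟨c₀, k⟩).coeff γ • e ⟨c₀, k⟩)) =
            ∑ k, (q ⟨c₀, k⟩).coeff γ • e ⟨c₀, k⟩ := by
          rw [expMul_expMul, neg_add_cancel, expMul_zero]
        have h3 : d + P.μ (-γ) = -(c₀ : ℂ) := by rw [map_neg, hd]; ring
        rw [h2, h3] at h1
        have h4 := (F.grMk_eq_zero (sum_smul_mem_filStalk he _)).2 h1
        rw [grMk_sum_smul φ he hφ, map_eq_zero_iff _ (φ c₀).injective] at h4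
        rw [(hq ⟨c₀, k⟩).eq_single hγ]
        have h5 : (q ⟨c₀, k⟩).coeff γ = 0 := congrFun h4 k
        rw [h5]
        exact AddMonoidAlgebra.ext (by simp)
      -- Coordinates of the same degree in two blocks would make `c₁` and `c₀` congruent modulo
      -- `μ(L)`. So in each degree a single block is involved.
      · refine hC c₁ c₁.2 c₀ c₀.2 (fun h => hne (Subtype.ext h)) (β - γ) ?_
        rw [map_sub, hβ, hd]; ring
    · push Not at hex
      exact (hq ⟨c₀, k⟩).eq_zero hex
  span d t ht := by
    classical
    by_cases hn : Nontrivial (F.Gr d x)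
    -- Multiplication by `u^{-γ}` moves the problem to `gr_{-c₀} ℒ`, where the basis is given.
    · obtain ⟨c₀, hc₀, γ, rfl⟩ := hexp d hn
      lift c₀ to C using hc₀
      have h1 := F.expMul_mem (-γ) ht
      have h3 : -(c₀ : ℂ) + P.μ γ + P.μ (-γ) = -(c₀ : ℂ) := by rw [map_neg]; ring
      rw [h3] at h1
      set w := (φ c₀).symm (F.grMk _ x ⟨_, h1⟩) with hw
      have h2 := grMk_sum_smul φ he hφ w
      rw [hw, LinearEquiv.apply_symm_apply, ← hw, eq_comm, F.grMk_eq_iff] at h2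
      refine ⟨fun i => AddMonoidAlgebra.single γ (Pi.single (M := fun c₀ => Fin (n c₀) → ℂ) c₀ w i.1 i.2),
        fun i => ?_, ?_⟩
      · by_cases hi : i.1 = c₀
        · have := isHomog_single (P := P) γ
            (Pi.single (M := fun c₀ => Fin (n c₀) → ℂ) c₀ w i.1 i.2)
          have h4 : -(c₀ : ℂ) + P.μ γ - -(i.1 : ℂ) = P.μ γ := by rw [hi]; ring
          rwa [h4]
        · intro β hβ
          simp [Pi.single_eq_of_ne hi] at hβ
      · rw [sum_toStalk_smul_eq (γ := γ) (w := w) (fun k => by rw [Pi.single_eq_same])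
          fun c₁ k hne => by
            rw [Pi.single_eq_of_ne hne, Pi.zero_apply]; exact AddMonoidAlgebra.ext (by simp)]
        have h4 := F.expMul_mem_LT γ h2
        rw [map_sub] at h4
        have h5 : F.expMul γ x (F.expMul (-γ) x t) = t := by
          rw [expMul_expMul, add_neg_cancel, expMul_zero]
        rwa [h5] at h4
    · rw [not_nontrivial_iff_subsingleton] at hn
      refine ⟨fun _ => 0, fun i => isHomog_zero _, ?_⟩
      rw [Finset.sum_eq_zero fun i _ => by rw [map_zero, zero_smul], sub_zero]
      exact (F.grMk_eq_zero ht).1 (Subsingleton.elim _ _)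

end LocalSystemBasis

theorem IsGrFrame.isFrame {x : S1} {C : Finset ℂ} {ι : Type} [Fintype ι] {c : ι → ℂ}
    {e : ι → ModStalk F.mod x} (h : F.IsGrFrame x c e) (hc : ∀ i, -c i ∈ C) {I : Opens S1}
    (η : F.Splitting I) (hx : x ∈ I) (he : ∀ i, η.toEquiv ⟨x, hx⟩ (h.tensorBasis i) = e i) :
    F.IsFrame x C c e := by
  have key : ∀ a : ι → P.Stalk x, ∑ i, a i • e i =
      η.toEquiv ⟨x, hx⟩ (∑ i, a i • h.tensorBasis i) := fun a => by
    rw [map_sum]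
    exact Finset.sum_congr rfl fun i _ => by rw [map_smul, he]
  refine ⟨hc, fun t => ?_, fun a ha => ?_, fun a d => ?_⟩
  · obtain ⟨s, rfl⟩ := (η.toEquiv ⟨x, hx⟩).surjective t
    exact ⟨h.tensorBasis.repr s, by rw [key, h.tensorBasis.sum_repr]⟩
  · rw [key, map_eq_zero_iff _ (η.toEquiv ⟨x, hx⟩).injective] at ha
    exact Fintype.linearIndependent_iff.1 h.tensorBasis.linearIndependent a ha
  · rw [key, ← h.mem_tensorFil_iff]
    exact η.mem_fil ⟨x, hx⟩ d _

theorem IsGrSection.mono {c : ℂ} {U V : Opens S1} (hV : V ≤ U) {v : ∀ x : U, F.Gr c x.1}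
    (hv : F.IsGrSection c U v) : F.IsGrSection c V fun x => v ⟨x.1, hV x.2⟩ := by
  intro x
  obtain ⟨W, hW, hxW, s, hs, h⟩ := hv ⟨x.1, hV x.2⟩
  refine ⟨W ⊓ V, inf_le_right, ⟨hxW, x.2⟩, res F.mod inf_le_left s, F.res_mem _ hs, fun y => ?_⟩
  refine (h ⟨y.1, y.2.1⟩).trans ?_
  congr 1
  exact Subtype.ext (germ_res F.mod inf_le_left y.1 y.2 s).symm

theorem IsGrSection.isTensorSection {c : ℂ} {U : Opens S1} {v : ∀ x : U, F.Gr c x.1}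
    (hv : F.IsGrSection c U v) :
    F.IsTensorSection U fun y => 1 ⊗ₜ F.grIncl c y.1 (v y) := by
  intro y
  refine ⟨U, le_rfl, y.2, 1, fun _ => 1, fun _ => c, fun _ => v, fun _ => hv, fun z => ?_⟩
  rw [Fin.sum_univ_one, map_one]

/-- Flat local bases of the `gr_{-c₀} ℒ` give a `ℂ[L]`-basis of `gr ℒ` at every nearby point. The
splitting maps the sections `1 ⊗ v` to sections of `ℒ`, and since `gr η = id` these have the classes
`v`. -/
theorem IsBetti.hasLocalFrames {C : Finset ℂ} (hF : F.IsBetti C)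
    (hC : ∀ c ∈ C, ∀ c' ∈ C, c ≠ c' → ∀ γ : L, c ≠ c' + P.μ γ) : F.HasLocalFrames C := by
  intro x
  obtain ⟨I, hxI, ⟨η⟩⟩ := hF.splitting x
  have hls := fun c₀ : C => hF.local_system (-(c₀ : ℂ)) x
  choose J hxJ n φ hφ using hls
  obtain ⟨V, hxV, hV⟩ := exists_common_nhds (fun o : Option C => o.elim I J)
    (by rintro (_ | k); exacts [hxI, hxJ k])
  have hVI : V ≤ I := hV none
  have hVJ : ∀ c₀, V ≤ J c₀ := fun c₀ => hV (some c₀)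
  have hsec : ∀ i : Σ c₀ : C, Fin (n c₀), F.IsTensorSection V fun y =>
      1 ⊗ₜ F.grIncl (-(i.1 : ℂ)) y.1 (φ i.1 ⟨y.1, hVJ i.1 y.2⟩ (Pi.single i.2 1)) := fun i =>
    ((hφ i.1 (Pi.single i.2 1)).mono (hVJ i.1)).isTensorSection
  choose e he using fun i => η.map_section V hVI _ (hsec i)
  refine ⟨V, hxV, Σ c₀ : C, Fin (n c₀), inferInstance, fun i => -(i.1 : ℂ), e, fun y hy => ?_⟩
  choose hm hcls using fun i : Σ c₀ : C, Fin (n c₀) => η.gr_eq_id ⟨y, hVI hy⟩ (-(i.1 : ℂ)) (φ i.1 ⟨y, hVJ i.1 hy⟩ (Pi.single i.2 1))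
  have hmem : ∀ i : Σ c₀ : C, Fin (n c₀), germ F.mod V y hy (e i) ∈ F.filStalk (-(i.1 : ℂ)) y := fun i => by
    rw [he i ⟨y, hy⟩]; exact hm i
  have hcls' : ∀ i : Σ c₀ : C, Fin (n c₀), F.grMk (-(i.1 : ℂ)) y ⟨_, hmem i⟩ = φ i.1 ⟨y, hVJ i.1 hy⟩ (Pi.single i.2 1) := fun i => by
    refine Eq.trans ?_ (hcls i)
    congr 1
    exact Subtype.ext (he i ⟨y, hy⟩)
  have hgr := isGrFrame_of_basis (fun c₀ => φ c₀ ⟨y, hVJ c₀ hy⟩) hmem hcls' hC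
    (fun c => hF.exponents c y)
  refine hgr.isFrame (fun i => by rw [neg_neg]; exact i.1.2) η (hVI hy) fun i => ?_
  rw [hgr.tensorBasis_apply, grCls, hcls' i]
  exact (he i ⟨y, hy⟩).symm

end FilteredModule

end

section

namespace PeriodMap

/-! ### Variation of the order of growth with the direction -/

/-- Expresses that the index `c + τ y` encodes real order less than `τ` relative to `c`, uniformly
for varying directions `y`. -/
theorem ltAt_add_mul_iff {y : Circle} {m c : ℂ} {τ : ℝ} :
    LtAt y m (c + τ * y) ↔ ((y : ℂ)⁻¹ * (m - c)).re < τ := by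
  rw [ltAt_iff, mul_add, Complex.add_re, re_inv_mul_real, mul_sub, Complex.sub_re]
  exact sub_lt_iff_lt_add'.symm

section Germs

variable {x : S1} {U : Opens S1} (s : P.Sec U) (hx : x ∈ U) {c : ℂ}

theorem eventually_mem_stalkLE (h : P.stalkGerm U x hx s ∈ P.stalkLE x c) :
    ∀ᶠ y : S1 in 𝓝 x, ∀ hy : y ∈ U, P.stalkGerm U y hy s ∈ P.stalkLE y c := by
  obtain ⟨A, J, hJ, hxJ, hA, hco⟩ := exists_hasCoeff_nhds s hx
  have h1 := hA.eventually_leAt hxJ ((hco x hxJ).mem_stalkLE_iff.1 h)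
  filter_upwards [h1, J.isOpen.mem_nhds hxJ] with y hy hyJ hyU
  exact (hco y hyJ).mem_stalkLE_iff.2 hy

theorem eventually_mem_stalkLT {τ : ℝ} (h : P.stalkGerm U x hx s ∈ P.stalkLT x (c + τ * (x : Circle))) :
    ∀ᶠ y : S1 in 𝓝 x, ∀ hy : y ∈ U,
      P.stalkGerm U y hy s ∈ P.stalkLT y (c + τ * (y : Circle)) := by
  obtain ⟨c', hc', h⟩ := h
  have h2 : ∀ᶠ y : Circle in 𝓝 (x : Circle), ((y : ℂ)⁻¹ * (c' - c)).re < τ := by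
    have : Continuous fun y : Circle => ((y : ℂ)⁻¹ * (c' - c)).re :=
      Complex.continuous_re.comp ((continuous_subtype_val.inv₀ Circle.coe_ne_zero).mul
        continuous_const)
    exact this.continuousAt.eventually_lt continuousAt_const (ltAt_add_mul_iff.1 hc')
  filter_upwards [eventually_mem_stalkLE s hx h, h2] with y hy hy2 hyU
  exact ⟨c', ltAt_add_mul_iff.2 hy2, hy hyU⟩

/-- The only exponent that is at most `c` but not below it is `c` itself. If it occurs at `x`, it
occurs nearby, where the coefficients are the same. -/
theorem eventually_notMem_stalkLT (h : P.stalkGerm U x hx s ∈ P.stalkLE x c)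
    (h' : P.stalkGerm U x hx s ∉ P.stalkLT x c) :
    ∀ᶠ y : S1 in 𝓝 x, ∀ hy : y ∈ U, P.stalkGerm U y hy s ∉ P.stalkLT y c := by
  obtain ⟨A, J, hJ, hxJ, hA, hco⟩ := exists_hasCoeff_nhds s hx
  rw [(hco x hxJ).mem_stalkLE_iff] at h
  rw [(hco x hxJ).mem_stalkLT_iff] at h'
  push Not at h'
  obtain ⟨γ, hγ, hlt⟩ := h'
  have hc : P.μ γ = c := (h γ hγ).resolve_left hlt
  filter_upwards [J.isOpen.mem_nhds hxJ] with y hyJ hyU hlt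
  have := ltAt_iff.1 ((hco y hyJ).mem_stalkLT_iff.1 hlt γ hγ)
  rw [hc] at this
  exact lt_irrefl _ this

/-- A negative order of growth relative to `c` cannot be a local maximum. -/
theorem mem_stalkLT_of_eventually {τ : ℝ} (hτ : τ < 0)
    (h : ∀ᶠ y : S1 in 𝓝 x, ∀ hy : y ∈ U, ∀ t > τ,
      P.stalkGerm U y hy s ∈ P.stalkLT y (c + t * (y : Circle))) :
    P.stalkGerm U x hx s ∈ P.stalkLT x (c + τ * (x : Circle)) := by
  obtain ⟨A, J, hJ, hxJ, hA, hco⟩ := exists_hasCoeff_nhds s hx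
  rw [(hco x hxJ).mem_stalkLT_iff]
  intro γ hγ
  by_contra hlt
  rw [ltAt_add_mul_iff, not_lt] at hlt
  have h1 : ∀ᶠ y : Circle in 𝓝 (x : Circle), ((y : ℂ)⁻¹ * (P.μ γ - c)).re ≤ τ := by
    filter_upwards [h, J.isOpen.mem_nhds hxJ] with y hy hyJ
    refine le_of_forall_gt_imp_ge_of_dense fun t ht => ?_
    exact (ltAt_add_mul_iff.1 ((hco y hyJ).mem_stalkLT_iff.1 (hy (hJ hyJ) t ht) γ hγ)).le
  have h2 : ∀ σ : ℝ, ∀ᶠ t : ℝ in 𝓝[>] 0,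
      ((((x : Circle) * Circle.exp (σ * t) : Circle) : ℂ)⁻¹ * (P.μ γ - c)).re ≤ τ := fun σ => by
    have hcont : Continuous fun t : ℝ => (x : Circle) * Circle.exp (σ * t) := by fun_prop
    have := hcont.tendsto 0
    rw [mul_zero, Circle.exp_zero, mul_one] at this
    exact (this.eventually h1).filter_mono nhdsWithin_le_nhds
  have h3 : ∀ᶠ t : ℝ in 𝓝[>] 0, t < 1 := (eventually_lt_nhds one_pos).filter_mono nhdsWithin_le_nhds
  -- Adding the bounds at the angles `t` and `-t` removes the sine, so the order at `x` times `cos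
  -- t` is at most `τ`. With order at least `τ` at `x`, `τ < 0` and `cos t < 1`, this is impossible.
  obtain ⟨t, h4, h5, h6, h7⟩ := ((h2 1).and ((h2 (-1)).and (h3.and self_mem_nhdsWithin))).exists
  rw [re_inv_mul_exp_mul, one_mul] at h4
  rw [re_inv_mul_exp_mul, neg_one_mul, Real.cos_neg, Real.sin_neg] at h5
  have h8 : 0 < Real.cos t := Real.cos_pos_of_mem_Ioo ⟨by linarith [Real.pi_gt_three, h7],
    by linarith [Real.pi_gt_three]⟩
  have h9 : Real.cos t < 1 := by
    have := Real.cos_lt_cos_of_nonneg_of_le_pi le_rfl (by linarith [Real.pi_gt_three]) (h7)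
    rwa [Real.cos_zero] at this
  nlinarith

end Germs

/-! ### Determinants of filtered matrices -/

section Det

variable {x : S1}

/-- An occurring exponent would have a finite order relative to `c`, and taking `τ` equal to it
gives a contradiction. So no exponent occurs. -/
theorem eq_zero_of_forall_mem_stalkLT {a : P.Stalk x} {c : ℂ}
    (h : ∀ τ : ℝ, a ∈ P.stalkLT x (c + τ * (x : Circle))) : a = 0 := by
  obtain ⟨A, hA⟩ := exists_hasCoeff a
  have h0 : ∀ γ, A γ = 0 := fun γ => by
    by_contra hγ
    exact lt_irrefl _ (ltAt_add_mul_iff.1 (hA.mem_stalkLT_iff.1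
      (h (((x : Circle) : ℂ)⁻¹ * (P.μ γ - c)).re) γ hγ))
  obtain ⟨J, hx, hJ, rfl⟩ := hA
  obtain rfl : A = 0 := funext h0
  have : laurentSec hJ = 0 := Subtype.ext (funext fun y => by
    refine Germ.coe_eq.2 (Eventually.of_forall fun z => ?_)
    simp [expSum])
  rw [this, map_zero]

theorem sum_mem_stalkLT {ι : Type*} (s : Finset ι) {f : ι → P.Stalk x} {c : ℂ}
    (h : ∀ i ∈ s, f i ∈ P.stalkLT x c) : ∑ i ∈ s, f i ∈ P.stalkLT x c :=
  Finset.sum_induction f (· ∈ P.stalkLT x c) (fun _ _ => add_mem_stalkLT) zero_mem_stalkLT h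

/-- Every product in the Leibniz formula has the same degree bound, since permuting the `β k` does
not change their sum. -/
theorem det_mem_stalkLE {n : Type*} [Fintype n] [DecidableEq n] {N : Matrix n n (P.Stalk x)}
    {α β : n → ℂ} (h : ∀ k l, N k l ∈ P.stalkLE x (α l - β k)) :
    N.det ∈ P.stalkLE x (∑ k, α k - ∑ k, β k) := by
  rw [Matrix.det_apply]
  refine sum_mem_stalkLE _ fun σ _ => ?_
  have h1 := prod_mem_stalkLE Finset.univ fun k _ => h (σ k) k
  rw [Finset.sum_sub_distrib, Equiv.sum_comp σ β] at h1
  rcases Int.units_eq_one_or (Equiv.Perm.sign σ) with h2 | h2 <;> rw [h2]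
  · rwa [one_smul]
  · rw [Units.neg_smul, one_smul]; exact neg_mem_stalkLE h1

/-- The entry is a determinant in which row `j` is replaced by the `i`-th unit vector. Giving that
row the degree `α i` instead of `β j` keeps all the bounds. -/
theorem adjugate_mem_stalkLE {n : Type*} [Fintype n] [DecidableEq n] {N : Matrix n n (P.Stalk x)}
    {α β : n → ℂ} (h : ∀ k l, N k l ∈ P.stalkLE x (α l - β k)) (i j : n) :
    N.adjugate i j ∈ P.stalkLE x ((∑ k, α k - ∑ k, β k) + (β j - α i)) := by
  rw [Matrix.adjugate_apply]
  have := det_mem_stalkLE (N := N.updateRow j (Pi.single i 1)) (α := α)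
    (β := Function.update β j (α i)) fun k l => ?_
  · convert this using 2
    rw [Finset.sum_update_of_mem (Finset.mem_univ j), Finset.sdiff_singleton_eq_erase, ← Finset.add_sum_erase _ β (Finset.mem_univ j)]
    ring
  · by_cases hk : k = j
    · subst hk
      rw [Matrix.updateRow_self, Function.update_self]
      by_cases hl : l = i
      · subst hl
        rw [Pi.single_eq_same, sub_self]; exact one_mem_stalkLE
      · rw [Pi.single_eq_of_ne hl]; exact zero_mem_stalkLE
    · rw [Matrix.updateRow_ne hk, Function.update_of_ne hk]; exact h k l

end Det

end PeriodMap

/-! ### Change of frames -/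

open PeriodMap

namespace FilteredModule

variable {F : FilteredModule P} {x : S1} {C : Finset ℂ}

theorem IsFrame.reindex {ι ι' : Type} [Fintype ι] [Fintype ι'] {c : ι → ℂ} {e : ι → ModStalk F.mod x}
    (h : F.IsFrame x C c e) (ε : ι' ≃ ι) : F.IsFrame x C (c ∘ ε) (e ∘ ε) where
  exponent i := h.exponent _
  exists_sum t := by
    obtain ⟨a, rfl⟩ := h.exists_sum t
    exact ⟨a ∘ ε, ε.sum_comp fun i => a i • e i⟩
  eq_zero a ha i := by
    have := h.eq_zero (a ∘ ε.symm) (by rw [← ha, ← ε.sum_comp]; simp) (ε i)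
    simpa using this
  mem_iff a d := by
    have := h.mem_iff (a ∘ ε.symm) d
    rw [← ε.sum_comp, ← ε.forall_congr_right] at this
    simpa using this

/-- A base change which is invertible as a map of filtered modules turns frames into frames. -/
theorem IsFrame.change {ι : Type} [Fintype ι] [DecidableEq ι] {c : ι → ℂ} {e : ι → ModStalk F.mod x}
    (h : F.IsFrame x C c e) {c' : ι → ℂ} (hc' : ∀ i, -c' i ∈ C) {T : Matrix ι ι (P.Stalk x)}
    (hT : ∀ i j, T i j ∈ P.stalkLE x (c' j - c i))
    (hdet : T.det ∉ P.stalkLT x (∑ i, c' i - ∑ i, c i)) :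
    F.IsFrame x C c' fun j => ∑ i, T i j • e i := by
  obtain ⟨v, hv, hdv⟩ := exists_inv_of_lead (det_mem_stalkLE hT) hdet
  set S : Matrix ι ι (P.Stalk x) := v • T.adjugate with hS
  have hTS : T * S = 1 := by
    rw [hS, Matrix.mul_smul, Matrix.mul_adjugate, smul_smul, mul_comm, hdv, one_smul]
  have hST : S * T = 1 := by
    rw [hS, Matrix.smul_mul, Matrix.adjugate_mul, smul_smul, mul_comm, hdv, one_smul]
  -- The degree of the inverse determinant cancels that of the determinant in the bound for the
  -- adjugate, so the inverse base change is filtered too.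
  have hSm : ∀ i j, S i j ∈ P.stalkLE x (c j - c' i) := fun i j => by
    have := mul_mem_stalkLE hv (adjugate_mem_stalkLE hT i j)
    rw [← add_assoc, neg_add_cancel, zero_add] at this
    exact this
  have key : ∀ a : ι → P.Stalk x,
      ∑ j, a j • ∑ i, T i j • e i = ∑ i, (T.mulVec a) i • e i := fun a => by
    simp only [Finset.smul_sum, smul_smul, Matrix.mulVec, dotProduct, Finset.sum_smul]
    rw [Finset.sum_comm]
    simp only [mul_comm]
  have hTa : ∀ a : ι → P.Stalk x, S.mulVec (T.mulVec a) = a := fun a => by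
    rw [Matrix.mulVec_mulVec, hST, Matrix.one_mulVec]
  have hSa : ∀ a : ι → P.Stalk x, T.mulVec (S.mulVec a) = a := fun a => by
    rw [Matrix.mulVec_mulVec, hTS, Matrix.one_mulVec]
  have bound : ∀ {N : Matrix ι ι (P.Stalk x)} {α β : ι → ℂ} {a : ι → P.Stalk x} {d : ℂ},
      (∀ i j, N i j ∈ P.stalkLE x (α j - β i)) → (∀ j, a j ∈ P.stalkLE x (d - α j)) →
        ∀ i, N.mulVec a i ∈ P.stalkLE x (d - β i) := fun {N α β a d} hN ha i => by
    refine sum_mem_stalkLE _ fun j _ => ?_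
    have := mul_mem_stalkLE (hN i j) (ha j)
    rwa [sub_add_sub_comm, add_comm, add_comm (β i), ← sub_sub, add_sub_cancel_right] at this
  refine ⟨hc', fun t => ?_, fun a ha => ?_, fun a d => ?_⟩
  · obtain ⟨a, rfl⟩ := h.exists_sum t
    exact ⟨S.mulVec a, by rw [key, hSa]⟩
  · rw [key] at ha
    have : T.mulVec a = 0 := funext (h.eq_zero _ ha)
    rw [← hTa a, this, Matrix.mulVec_zero]
    exact fun _ => rfl
  · rw [key, h.mem_iff]
    exact ⟨fun H => hTa a ▸ bound hSm H, bound hT⟩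

end FilteredModule

end

section

open PeriodMap

/-! ### Minors of a morphism -/

/-- Multilinearity in the rows. A weak form of Cauchy–Binet, with a sum over all maps `J`, is enough
for estimates. -/
theorem det_mul_eq_sum {R κ : Type*} [CommRing R] [Fintype κ] {s : ℕ} (M : Matrix (Fin s) κ R)
    (N : Matrix κ (Fin s) R) :
    (M * N).det = ∑ J : Fin s → κ, (∏ k, M k (J k)) * (N.submatrix J id).det := by
  classical
  have e : (M * N : Matrix (Fin s) (Fin s) R) = Matrix.of fun k => ∑ j, M k j • N j := by
    ext k l
    simp [Matrix.mul_apply, Finset.sum_apply]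
  have h := (Matrix.detRowAlternating (R := R) (n := Fin s)).toMultilinearMap.map_sum
    fun k j => M k j • N j
  rw [e]
  refine h.trans (Finset.sum_congr rfl fun J _ => ?_)
  exact (Matrix.detRowAlternating (R := R) (n := Fin s)).toMultilinearMap.map_smul_univ
    (fun k => M k (J k)) fun k => N (J k)

theorem det_mul_eq_sum' {R κ : Type*} [CommRing R] [Fintype κ] {s : ℕ} (M : Matrix (Fin s) κ R)
    (N : Matrix κ (Fin s) R) :
    (M * N).det = ∑ I : Fin s → κ, (∏ l, N (I l) l) * (M.submatrix id I).det := by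
  rw [← Matrix.det_transpose, Matrix.transpose_mul, det_mul_eq_sum]
  refine Finset.sum_congr rfl fun I _ => ?_
  rw [← Matrix.det_transpose (M.submatrix id I)]
  rfl

/-- The determinant is a combination of minors of `A` with coefficients of complementary degree.
This makes the bound on minors independent of the frames. -/
theorem det_mul_mul_mem_stalkLT {x : S1} {ι κ : Type*} [Fintype ι] [Fintype κ] {s : ℕ}
    {A : Matrix κ ι (P.Stalk x)} {M : Matrix (Fin s) κ (P.Stalk x)} {N : Matrix ι (Fin s) (P.Stalk x)}
    {c : ι → ℂ} {d : κ → ℂ} {c' d' : Fin s → ℂ} {τ : ℂ}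
    (hM : ∀ k j, M k j ∈ P.stalkLE x (d j - d' k)) (hN : ∀ i l, N i l ∈ P.stalkLE x (c' l - c i))
    (hA : ∀ (J : Fin s → κ) (I : Fin s → ι),
      (A.submatrix J I).det ∈ P.stalkLT x (∑ l, c (I l) - ∑ k, d (J k) + τ)) :
    (M * A * N).det ∈ P.stalkLT x (∑ l, c' l - ∑ k, d' k + τ) := by
  rw [det_mul_eq_sum']
  refine sum_mem_stalkLT _ fun I _ => ?_
  have e : (M * A).submatrix id I = M * A.submatrix id I := rfl
  rw [e, det_mul_eq_sum, Finset.mul_sum]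
  refine sum_mem_stalkLT _ fun J _ => ?_
  have h1 := prod_mem_stalkLE Finset.univ fun k _ => hM k (J k)
  have h2 := prod_mem_stalkLE Finset.univ fun l _ => hN (I l) l
  have := mul_mem_stalkLT h2 (mul_mem_stalkLT h1 (hA J I))
  rw [Finset.sum_sub_distrib, Finset.sum_sub_distrib] at this
  convert this using 2
  · ring
  · rfl

namespace FilteredModule

variable {F G : FilteredModule P} (f : F ⟶ G)

/-- The minors of size `s` of `f` at `x`, with respect to arbitrary filtered vectors and covectors, have
order of growth less than `τ` relative to the exponents. -/
def MinorBound (s : ℕ) (x : S1) (τ : ℝ) : Prop :=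
  ∀ (c d : Fin s → ℂ) (v : Fin s → ModStalk F.mod x)
    (φ : Fin s → ModStalk G.mod x →ₗ[P.Stalk x] P.Stalk x),
    (∀ l, v l ∈ F.filStalk (c l) x) →
    (∀ k e, ∀ t ∈ G.filStalk e x, φ k t ∈ P.stalkLE x (e - d k)) →
    (Matrix.of fun k l => φ k (stalkMap (Hom.hom f) x (v l))).det ∈
      P.stalkLT x (∑ l, c l - ∑ k, d k + τ * (x : Circle))

section Frame

variable {f} {x : S1} {C : Finset ℂ} {ι κ : Type} [Fintype ι] [Fintype κ] {c : ι → ℂ} {d : κ → ℂ}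
  {e : ι → ModStalk F.mod x} {e' : κ → ModStalk G.mod x} (h : F.IsFrame x C c e)
  (h' : G.IsFrame x C d e') {A : Matrix κ ι (P.Stalk x)}
  (hA : ∀ i, stalkMap (Hom.hom f) x (e i) = ∑ j, A j i • e' j)
include h h' hA

theorem IsFrame.matrix_mem (j : κ) (i : ι) : A j i ∈ P.stalkLE x (c i - d j) := by
  have := Hom.stalkMap_mem f (h.mem i)
  rw [hA i] at this
  exact (h'.mem_iff _ _).1 this j

/-- The bound on the minors can be checked in frames. -/
theorem minorBound_iff {s : ℕ} {τ : ℝ} : MinorBound f s x τ ↔ ∀ (J : Fin s → κ) (I : Fin s → ι),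
    (A.submatrix J I).det ∈ P.stalkLT x (∑ l, c (I l) - ∑ k, d (J k) + τ * (x : Circle)) := by
  classical
  constructor
  · intro H J I
    -- Frame elements and coordinate forms are admissible vectors and covectors, and they produce
    -- the minors of the matrix.
    have := H (fun l => c (I l)) (fun k => d (J k)) (fun l => e (I l))
      (fun k => h'.basis.coord (J k)) (fun l => h.mem _) ?_
    · convert this using 2
      ext k l
      rw [Matrix.submatrix_apply, Matrix.of_apply, hA, Module.Basis.coord_apply]
      have h1 : ∑ j, A j (I l) • e' j = ∑ j, A j (I l) • h'.basis j := by
        simp only [h'.basis_apply]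
      rw [h1, Module.Basis.repr_sum_self]
    · intro k b t ht
      obtain ⟨a, rfl⟩ := h'.exists_sum t
      have h1 : ∑ j, a j • e' j = ∑ j, a j • h'.basis j := by simp only [h'.basis_apply]
      rw [Module.Basis.coord_apply, h1, Module.Basis.repr_sum_self]
      exact (h'.mem_iff _ _).1 ht (J k)
  · intro H c' d' v φ hv hφ
    choose b hb using fun l => h.exists_sum (v l)
    have hbm : ∀ i l, b l i ∈ P.stalkLE x (c' l - c i) := fun i l =>
      (h.mem_iff _ _).1 (by rw [hb]; exact hv l) i
    have e1 : (Matrix.of fun k l => φ k (stalkMap (Hom.hom f) x (v l))) =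
        (Matrix.of fun k j => φ k (e' j)) * A * (Matrix.of fun i l => b l i) := by
      ext k l
      rw [Matrix.of_apply, ← hb l, map_sum, map_sum, Matrix.mul_apply]
      refine Finset.sum_congr rfl fun i _ => ?_
      rw [map_smul, map_smul, hA, map_sum, Matrix.mul_apply, Matrix.of_apply, smul_eq_mul, mul_comm]
      congr 1
      refine Finset.sum_congr rfl fun j _ => ?_
      rw [map_smul, smul_eq_mul, mul_comm]; rfl
    rw [e1]
    exact det_mul_mul_mem_stalkLT (fun k j => hφ k _ _ (h'.mem j)) hbm H

end Frame

/-- The matrix of a morphism near a point. -/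
theorem exists_matrix {C : Finset ℂ} {ι κ : Type} [Fintype ι] [Fintype κ] {d : κ → ℂ}
    {U V : Opens S1} {x : S1} (hU : x ∈ U) (hV : x ∈ V) {e : ι → ModSec F.mod U}
    {e' : κ → ModSec G.mod V} (h' : G.IsFrameOn C d V e') :
    ∃ (W : Opens S1) (h₁ : W ≤ U) (h₂ : W ≤ V) (_ : x ∈ W) (A : Matrix κ ι (P.Sec W)),
      ∀ y (hy : y ∈ W) (i : ι), stalkMap (Hom.hom f) y (germ F.mod U y (h₁ hy) (e i)) =
        ∑ j, P.stalkGerm W y hy (A j i) • germ G.mod V y (h₂ hy) (e' j) := by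
  choose W h₁ h₂ hxW a ha using fun i => h'.exists_coord hV hU (secMap (Hom.hom f) U (e i))
  obtain ⟨W', hxW', hW'⟩ := exists_common_nhds (fun o : Option ι => o.elim (U ⊓ V) W)
    (by rintro (_ | i); exacts [⟨hU, hV⟩, hxW i])
  have hWU : W' ≤ U ⊓ V := hW' none
  have hWi : ∀ i, W' ≤ W i := fun i => hW' (some i)
  refine ⟨W', hWU.trans inf_le_left, hWU.trans inf_le_right, hxW',
    Matrix.of fun j i => resSec (hWi i) (a i j), fun y hy i => ?_⟩
  rw [stalkMap_germ, ha i y (hWi i hy)]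
  exact Finset.sum_congr rfl fun j _ => by rw [Matrix.of_apply, stalkGerm_res]

/-- Near a point the bound amounts to bounds on finitely many sections of `𝒜_μ`, namely the minors
in frames. The results on single germs thereby apply to it. -/
theorem exists_minors {C : Finset ℂ} (hF : F.HasLocalFrames C) (hG : G.HasLocalFrames C) (s : ℕ)
    (x : S1) : ∃ (W : Opens S1) (_ : x ∈ W) (Λ : Type) (_ : Finite Λ) (m : Λ → P.Sec W) (b : Λ → ℂ),
      ∀ y (hy : y ∈ W), (∀ l, P.stalkGerm W y hy (m l) ∈ P.stalkLE y (b l)) ∧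
        ∀ τ : ℝ, MinorBound f s y τ ↔
          ∀ l, P.stalkGerm W y hy (m l) ∈ P.stalkLT y (b l + τ * (y : Circle)) := by
  obtain ⟨U, hU, ι, _, c, e, h⟩ := hF x
  obtain ⟨V, hV, κ, _, d, e', h'⟩ := hG x
  obtain ⟨W, h₁, h₂, hxW, A, hA⟩ := exists_matrix f hU hV (e := e) h'
  refine ⟨W, hxW, (Fin s → κ) × (Fin s → ι), inferInstance, fun l => (A.submatrix l.1 l.2).det,
    fun l => ∑ k, c (l.2 k) - ∑ k, d (l.1 k), fun y hy => ?_⟩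
  have e1 : ∀ l : (Fin s → κ) × (Fin s → ι), P.stalkGerm W y hy (A.submatrix l.1 l.2).det =
      ((A.map (P.stalkGerm W y hy)).submatrix l.1 l.2).det := fun l => RingHom.map_det _ _
  simp only [e1]
  have hA' : ∀ i, stalkMap (Hom.hom f) y (germ F.mod U y (h₁ hy) (e i)) =
      ∑ j, (A.map (P.stalkGerm W y hy)) j i • germ G.mod V y (h₂ hy) (e' j) := hA y hy
  refine ⟨fun l => det_mem_stalkLE fun k i => (h y (h₁ hy)).matrix_mem (h' y (h₂ hy)) hA' _ _,
    fun τ => ?_⟩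
  rw [minorBound_iff (h y (h₁ hy)) (h' y (h₂ hy)) hA']
  exact ⟨fun H l => H l.1 l.2, fun H J I => H (J, I)⟩

end FilteredModule

/-! ### Constancy of the rank -/

/-- A family of bounds on a compact space which is open, not attained, and satisfies a maximum principle at
negative levels. -/
theorem forall_of_forall_zero {X : Type*} [TopologicalSpace X] [CompactSpace X] {H : X → ℝ → Prop}
    (mono : ∀ x τ τ', τ ≤ τ' → H x τ → H x τ') (isOpen : ∀ x τ, H x τ → ∀ᶠ y in 𝓝 x, H y τ)
    (strict : ∀ x τ, H x τ → ∃ τ' < τ, H x τ')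
    (max : ∀ x τ, τ < 0 → (∀ᶠ y in 𝓝 x, ∀ t > τ, H y t) → H x τ) (h0 : ∀ x, H x 0) (x : X) (τ : ℝ) :
    H x τ := by
  -- Compactness turns the improvements of the level near each point into a uniform one.
  have step : ∀ τ, (∀ x, H x τ) → ∃ τ' < τ, ∀ x, H x τ' := fun τ h => by
    have := isCompact_univ.induction_on (p := fun S : Set X => ∃ τ' < τ, ∀ x ∈ S, H x τ')
      ⟨τ - 1, by linarith, by simp⟩
      (fun S T hST ⟨τ', h1, h2⟩ => ⟨τ', h1, fun x hx => h2 x (hST hx)⟩)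
      (fun S T ⟨τ', h1, h2⟩ ⟨σ', h3, h4⟩ => ⟨τ' ⊔ σ', max_lt h1 h3, by
        rintro x (hx | hx)
        · exact mono _ _ _ le_sup_left (h2 x hx)
        · exact mono _ _ _ le_sup_right (h4 x hx)⟩)
      (fun x _ => by
        obtain ⟨τ', h1, h2⟩ := strict x τ (h x)
        exact ⟨_, mem_nhdsWithin_of_mem_nhds (isOpen x τ' h2), τ', h1, fun y hy => hy⟩)
    obtain ⟨τ', h1, h2⟩ := this
    exact ⟨τ', h1, fun x => h2 x trivial⟩
  by_contra hx
  set S : Set ℝ := {σ | ∀ x, H x σ} with hS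
  have hbdd : BddBelow S := ⟨τ, fun σ hσ => by
    by_contra! hlt
    exact hx (mono _ _ _ hlt.le (hσ x))⟩
  have hne : S.Nonempty := ⟨0, h0⟩
  obtain ⟨σ, hσ, hσ'⟩ := step 0 h0
  have hneg : sInf S < 0 := (csInf_le hbdd hσ').trans_lt hσ
  -- By the maximum principle the infimum of the admissible levels is itself admissible, and `step`
  -- lowers it further.
  have hmem : ∀ x, H x (sInf S) := fun x => max x _ hneg (Eventually.of_forall fun y t ht => by
    obtain ⟨σ, hσ, hlt⟩ := exists_lt_of_csInf_lt hne ht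
    exact mono _ _ _ hlt.le (hσ y))
  obtain ⟨σ, hσ, hσ'⟩ := step _ hmem
  exact absurd (csInf_le hbdd hσ') (not_le.2 hσ)

namespace FilteredModule

variable {F G : FilteredModule P} (f : F ⟶ G)

theorem ltAt_add_mul_mono {x : Circle} {m c : ℂ} {τ τ' : ℝ} (h : τ ≤ τ') (hm : LtAt x m (c + τ * x)) :
    LtAt x m (c + τ' * x) :=
  ltAt_add_mul_iff.2 ((ltAt_add_mul_iff.1 hm).trans_le h)

section Minors

variable {f} {C : Finset ℂ} (hF : F.HasLocalFrames C) (hG : G.HasLocalFrames C) {s : ℕ}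

theorem MinorBound.mono {x : S1} {τ τ' : ℝ} (h : τ ≤ τ') (H : MinorBound f s x τ) :
    MinorBound f s x τ' := fun c d v φ hv hφ => by
  obtain ⟨m, hm, h'⟩ := H c d v φ hv hφ
  exact ⟨m, ltAt_add_mul_mono h hm, h'⟩

include hF hG

theorem MinorBound.eventually {x : S1} {τ : ℝ} (H : MinorBound f s x τ) :
    ∀ᶠ y : S1 in 𝓝 x, MinorBound f s y τ := by
  obtain ⟨W, hxW, Λ, _, m, b, h⟩ := exists_minors f hF hG s x
  have h1 := (h x hxW).2 τ |>.1 H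
  have h2 := eventually_all.2 fun l => eventually_mem_stalkLT (m l) hxW (h1 l)
  filter_upwards [h2, W.isOpen.mem_nhds hxW] with y hy hyW
  exact ((h y hyW).2 τ).2 fun l => hy l hyW

theorem MinorBound.exists_lt {x : S1} {τ : ℝ} (H : MinorBound f s x τ) :
    ∃ τ' < τ, MinorBound f s x τ' := by
  obtain ⟨W, hxW, Λ, _, m, b, h⟩ := exists_minors f hF hG s x
  have h1 := (h x hxW).2 τ |>.1 H
  choose c hc hcm using h1
  obtain ⟨τ', h2, h3⟩ : ∃ τ' < τ, ∀ l, (((x : Circle) : ℂ)⁻¹ * (c l - b l)).re < τ' := by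
    have := eventually_all.2 fun l => eventually_gt_nhds (ltAt_add_mul_iff.1 (hc l))
    have h4 : ∀ᶠ t in 𝓝[<] τ, t < τ := eventually_mem_nhdsWithin
    obtain ⟨t, ht, ht'⟩ := (h4.and (this.filter_mono nhdsWithin_le_nhds)).exists
    exact ⟨t, ht, ht'⟩
  exact ⟨τ', h2, ((h x hxW).2 τ').2 fun l => ⟨c l, ltAt_add_mul_iff.2 (h3 l), hcm l⟩⟩

theorem minorBound_of_eventually {x : S1} {τ : ℝ} (hτ : τ < 0)
    (H : ∀ᶠ y : S1 in 𝓝 x, ∀ t > τ, MinorBound f s y t) : MinorBound f s x τ := by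
  obtain ⟨W, hxW, Λ, _, m, b, h⟩ := exists_minors f hF hG s x
  refine ((h x hxW).2 τ).2 fun l => mem_stalkLT_of_eventually (m l) hxW hτ ?_
  filter_upwards [H] with y hy hyW t ht
  exact ((h y hyW).2 t).1 (hy t ht) l

theorem eventually_not_minorBound {x : S1} (H : ¬ MinorBound f s x 0) :
    ∀ᶠ y : S1 in 𝓝 x, ¬ MinorBound f s y 0 := by
  obtain ⟨W, hxW, Λ, _, m, b, h⟩ := exists_minors f hF hG s x
  rw [(h x hxW).2] at H
  push Not at H
  obtain ⟨l, hl⟩ := H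
  rw [Complex.ofReal_zero, zero_mul, add_zero] at hl
  filter_upwards [eventually_notMem_stalkLT (m l) hxW ((h x hxW).1 l) hl, W.isOpen.mem_nhds hxW]
    with y hy hyW H
  have := ((h y hyW).2 0).1 H l
  rw [Complex.ofReal_zero, zero_mul, add_zero] at this
  exact hy hyW this

/-- Both the vanishing and the nonvanishing of leading terms persist nearby, and the circle is
connected. -/
theorem minorBound_zero_iff (x y : S1) : MinorBound f s x 0 ↔ MinorBound f s y 0 := by
  have hc : IsClopen {x : Circle | MinorBound f s x 0} := by
    refine ⟨⟨isOpen_iff_mem_nhds.2 fun x hx => ?_⟩, isOpen_iff_mem_nhds.2 fun x hx => ?_⟩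
    · exact eventually_not_minorBound hF hG hx
    · exact MinorBound.eventually hF hG hx
  rcases isClopen_iff.1 hc with h | h
  · exact ⟨fun hx => absurd (show (x : Circle) ∈ {x : Circle | MinorBound f s x 0} from hx) (h ▸ Set.notMem_empty _),
      fun hx => absurd (show (y : Circle) ∈ {x : Circle | MinorBound f s x 0} from hx) (h ▸ Set.notMem_empty _)⟩
  · have : ∀ z : Circle, MinorBound f s z 0 := fun z =>
      (h ▸ Set.mem_univ z : z ∈ {x : Circle | MinorBound f s x 0})
    exact ⟨fun _ => this y, fun _ => this x⟩

/-- Vanishing of the leading terms in one direction spreads over the circle, and the maximum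
principle then pushes the order of the minors down to `-∞`. -/
theorem MinorBound.all {x : S1} (H : MinorBound f s x 0) (y : S1) (τ : ℝ) : MinorBound f s y τ :=
  forall_of_forall_zero (X := Circle) (H := fun x τ => MinorBound f s x τ)
    (fun _ _ _ h H => H.mono h) (fun _ _ H => H.eventually hF hG) (fun _ _ H => H.exists_lt hF hG)
    (fun _ _ hτ H => minorBound_of_eventually hF hG hτ H)
    (fun y => (minorBound_zero_iff hF hG x y).1 H) y τ

/-- The rank of the morphism on `gr` is constant, and it is the rank of the morphism. -/
theorem exists_rank : ∃ r : ℕ, (∀ x, ¬ MinorBound f r x 0) ∧ ∀ x τ, MinorBound f (r + 1) x τ := by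
  classical
  have hex : ∃ s, MinorBound f s (1 : Circle) 0 := by
    obtain ⟨U, hU, ι, _, c, e, h⟩ := hF (1 : Circle)
    obtain ⟨V, hV, κ, _, d, e', h'⟩ := hG (1 : Circle)
    obtain ⟨W, h₁, h₂, hxW, A, hA⟩ := exists_matrix f hU hV (e := e) h'
    -- A minor larger than the number of columns has a repeated column.
    refine ⟨Fintype.card ι + 1, (minorBound_iff (h _ hU) (h' _ hV)
      (A := A.map (P.stalkGerm W _ hxW)) (hA _ hxW)).2 fun J I => ?_⟩
    obtain ⟨k, l, hkl, hI⟩ := Fintype.exists_ne_map_eq_of_card_lt I (by simp)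
    rw [Matrix.det_zero_of_column_eq hkl fun i => by simp only [Matrix.submatrix_apply, hI]]
    exact zero_mem_stalkLT
  -- The empty minor is `1`, whose leading term is not zero.
  have h0 : Nat.find hex ≠ 0 := fun h => by
    have := Nat.find_spec hex
    rw [h] at this
    obtain ⟨U, hU, ι, _, c, e, h⟩ := hF (1 : Circle)
    have h1 := this (fun _ => 0) (fun _ => 0) (fun _ => 0) (fun _ => 0) (fun l => l.elim0)
      fun l => l.elim0
    rw [Matrix.det_isEmpty, Finset.univ_eq_empty, Finset.sum_empty, Complex.ofReal_zero, zero_mul,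
      sub_zero, add_zero] at h1
    have h2 := const_mul_exp_mem_stalkLT (P := P) (x := (1 : Circle)) (α := 1) (γ := 0)
      (by rw [map_one, expStalk_zero, map_zero, one_mul]; exact h1)
    exact one_ne_zero h2
  obtain ⟨r, hr⟩ := Nat.exists_eq_succ_of_ne_zero h0
  refine ⟨r, fun x H => ?_, fun x τ => MinorBound.all hF hG (x := (1 : Circle)) ?_ x τ⟩
  · exact Nat.find_min hex (m := r) (by omega) ((minorBound_zero_iff hF hG x _).1 H)
  · have := Nat.find_spec hex
    rwa [hr] at this

end Minors

end FilteredModule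

end

section

open PeriodMap

/-! ### Normal forms of morphisms -/

theorem PeriodMap.exists_matrix_germ {m n : Type*} [Finite m] [Finite n] {x : S1} {W : Opens S1}
    (hx : x ∈ W) (M : Matrix m n (P.Stalk x)) :
    ∃ (V : Opens S1) (_ : V ≤ W) (hV : x ∈ V) (N : Matrix m n (P.Sec V)),
      N.map (P.stalkGerm V x hV) = M := by
  choose V hVW hxV N hN using fun p : m × n => exists_stalkGerm_le hx (M p.1 p.2)
  obtain ⟨V', hxV', hV'⟩ := exists_common_nhds (fun o : Option (m × n) => o.elim W V)
    (by rintro (_ | p); exacts [hx, hxV p])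
  have hVp : ∀ p, V' ≤ V p := fun p => hV' (some p)
  refine ⟨V', hV' none, hxV', Matrix.of fun i j => resSec (hVp (i, j)) (N (i, j)), ?_⟩
  ext i j
  rw [Matrix.map_apply, Matrix.of_apply, stalkGerm_res, hN]

theorem PeriodMap.one_notMem_stalkLT {x : S1} : (1 : P.Stalk x) ∉ P.stalkLT x 0 := fun h =>
  one_ne_zero (const_mul_exp_mem_stalkLT (P := P) (x := x) (α := 1) (γ := 0)
    (by rwa [map_one, expStalk_zero, map_zero, one_mul]))

namespace FilteredModule

variable {F G : FilteredModule P} {x : S1} {C : Finset ℂ}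

/-- The degree bounds on the entries and the nonzero leading term of the determinant persist near
`x`, so a filtered base change at `x` extends to a neighbourhood. -/
theorem IsFrameOn.eventually_change {ι : Type} [Fintype ι] [DecidableEq ι] {c : ι → ℂ} {U : Opens S1}
    {e : ι → ModSec F.mod U} (h : F.IsFrameOn C c U e) {c' : ι → ℂ} (hc' : ∀ i, -c' i ∈ C)
    (hx : x ∈ U) {T : Matrix ι ι (P.Sec U)}
    (hT : ∀ i j, P.stalkGerm U x hx (T i j) ∈ P.stalkLE x (c' j - c i))
    (hdet : P.stalkGerm U x hx T.det ∉ P.stalkLT x (∑ i, c' i - ∑ i, c i)) :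
    ∀ᶠ y : S1 in 𝓝 x, ∀ hy : y ∈ U,
      F.IsFrame y C c' fun j => germ F.mod U y hy (∑ i, T i j • e i) := by
  have hdetLE : P.stalkGerm U x hx T.det ∈ P.stalkLE x (∑ i, c' i - ∑ i, c i) := by
    rw [RingHom.map_det]
    exact det_mem_stalkLE hT
  have h1 := eventually_all.2 fun i => eventually_all.2 fun j =>
    eventually_mem_stalkLE (T i j) hx (hT i j)
  filter_upwards [h1, eventually_notMem_stalkLT T.det hx hdetLE hdet] with y hy1 hy2 hy
  have := (h y hy).change hc' (T := T.map (P.stalkGerm U y hy)) (fun i j => hy1 i j hy) (by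
    have := hy2 hy
    rwa [RingHom.map_det] at this)
  convert this using 2 with j
  rw [map_sum]
  exact Finset.sum_congr rfl fun i _ => germ_smul _ _ _ _ _ _

variable (f : F ⟶ G)

/-- In suitable frames near `x`, the morphism `f` is the identity on a common subset of the frames and zero
on the other elements. -/
def HasNormalForm (C : Finset ℂ) (x : S1) : Prop :=
  ∃ (U : Opens S1) (_ : x ∈ U) (ρ κ κ' : Type) (_ : Fintype ρ) (_ : Fintype κ) (_ : Fintype κ')
    (b : ρ → ℂ) (c : κ → ℂ) (d : κ' → ℂ) (e : ρ ⊕ κ → ModSec F.mod U) (e' : ρ ⊕ κ' → ModSec G.mod U),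
    F.IsFrameOn C (Sum.elim b c) U e ∧ G.IsFrameOn C (Sum.elim b d) U e' ∧
    (∀ k, secMap (Hom.hom f) U (e (.inl k)) = e' (.inl k)) ∧
    ∀ i, secMap (Hom.hom f) U (e (.inr i)) = 0

variable {f}

/-- A unipotent column operation with a column of `X` clears the upper right block. The bordered
minor then equals `det A` times an entry of `D - C X`, and `det A` is a unit. -/
theorem schur_complement_eq_zero {R m n p : Type*} [CommRing R] [Fintype m] [DecidableEq m]
    {A : Matrix m m R} {B : Matrix m n R} {C : Matrix p m R} {D : Matrix p n R} {v : R}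
    (hv : A.det * v = 1) {X : Matrix m n R} (hX : A * X = B)
    (h : ∀ j i, (Matrix.fromBlocks A (B.submatrix id fun _ : Unit => i) (C.submatrix (fun _ : Unit => j) id)
      (D.submatrix (fun _ : Unit => j) fun _ : Unit => i)).det = 0) : C * X = D := by
  ext j i
  have h1 := congrArg (· * (Matrix.fromBlocks 1 (-X.submatrix id fun _ : Unit => i) 0 1).det) (h j i)
  simp only [← Matrix.det_mul, zero_mul, Matrix.fromBlocks_multiply, Matrix.mul_one, Matrix.mul_zero,
    add_zero] at h1
  have h2 : A * -(X.submatrix id fun _ : Unit => i) + B.submatrix id (fun _ : Unit => i) = 0 := by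
    rw [← hX, Matrix.mul_neg]
    exact neg_add_cancel _
  rw [h2, Matrix.det_fromBlocks_zero₁₂, Matrix.det_unique (n := Unit)] at h1
  have h3 := (IsUnit.of_mul_eq_one v hv).mul_right_eq_zero.1 h1
  have h4 : -(C * X) j i + D j i = 0 := by
    refine Eq.trans ?_ h3
    simp [Matrix.mul_apply, Matrix.add_apply]
  rw [neg_add_eq_zero] at h4
  exact h4

/-- A morphism has a normal form if it has a minor with nonvanishing leading term, and the minors that
extend it vanish. -/
theorem hasNormalForm_of_minors {ρ κ κ' : Type} [Fintype ρ] [Fintype κ] [Fintype κ'] [DecidableEq ρ]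
    [DecidableEq κ] [DecidableEq κ'] {c : ρ ⊕ κ → ℂ} {d : ρ ⊕ κ' → ℂ} {W : Opens S1}
    {e : ρ ⊕ κ → ModSec F.mod W} {e' : ρ ⊕ κ' → ModSec G.mod W} (h : F.IsFrameOn C c W e)
    (h' : G.IsFrameOn C d W e') {A : Matrix (ρ ⊕ κ') (ρ ⊕ κ) (P.Sec W)}
    (hA : ∀ i, secMap (Hom.hom f) W (e i) = ∑ j, A j i • e' j) (hx : x ∈ W)
    (hdet : P.stalkGerm W x hx A.toBlocks₁₁.det ∉
      P.stalkLT x (∑ k, c (.inl k) - ∑ k, d (.inl k)))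
    (hminor : ∀ j i, P.stalkGerm W x hx (A.submatrix (Sum.map id fun _ : Unit => j)
      (Sum.map id fun _ : Unit => i)).det = 0) : HasNormalForm f C x := by
  have hAx : ∀ i, stalkMap (Hom.hom f) x (germ F.mod W x hx (e i)) =
      ∑ j, (A.map (P.stalkGerm W x hx)) j i • germ G.mod W x hx (e' j) := fun i => by
    rw [stalkMap_germ, hA, map_sum]
    exact Finset.sum_congr rfl fun j _ => germ_smul _ _ _ _ _ _
  have hAm := (h x hx).matrix_mem (h' x hx) hAx
  set A' := A.map (P.stalkGerm W x hx) with hA'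
  have hdet' : A'.toBlocks₁₁.det ∉ P.stalkLT x (∑ k, c (.inl k) - ∑ k, d (.inl k)) := by
    rwa [RingHom.map_det] at hdet
  have hdetm : A'.toBlocks₁₁.det ∈ P.stalkLE x (∑ k, c (.inl k) - ∑ k, d (.inl k)) :=
    det_mem_stalkLE fun k l => hAm (.inl k) (.inl l)
  obtain ⟨v, hv, hdv⟩ := exists_inv_of_lead hdetm hdet'
  -- This is `A₁₁⁻¹ A₁₂`; the nonzero leading term of the determinant provides the inverse `v` of
  -- the correct degree.
  set X : Matrix ρ κ (P.Stalk x) := v • (A'.toBlocks₁₁.adjugate * A'.toBlocks₁₂) with hX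
  have hAX : A'.toBlocks₁₁ * X = A'.toBlocks₁₂ := by
    rw [hX, Matrix.mul_smul, ← Matrix.mul_assoc, Matrix.mul_adjugate, Matrix.smul_mul, Matrix.one_mul,
      smul_smul, mul_comm, hdv, one_smul]
  have hCX : A'.toBlocks₂₁ * X = A'.toBlocks₂₂ := by
    refine schur_complement_eq_zero hdv hAX fun j i => ?_
    rw [← hminor j i, RingHom.map_det]
    congr 1
    ext (a | a) (b | b) <;> rfl
  have hXm : ∀ k i, X k i ∈ P.stalkLE x (c (.inr i) - c (.inl k)) := fun k i => by
    have h1 : (A'.toBlocks₁₁.adjugate * A'.toBlocks₁₂) k i ∈ P.stalkLE x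
        (∑ k, c (.inl k) - ∑ k, d (.inl k) + (c (.inr i) - c (.inl k))) := by
      refine sum_mem_stalkLE _ fun l _ => ?_
      have := mul_mem_stalkLE (adjugate_mem_stalkLE (N := A'.toBlocks₁₁) (α := fun k => c (.inl k))
        (β := fun k => d (.inl k)) (fun k l => hAm (.inl k) (.inl l)) k l) (hAm (.inl l) (.inr i))
      convert this using 2
      · ring
      · rfl
    have := mul_mem_stalkLE hv h1
    rwa [← add_assoc, neg_add_cancel, zero_add] at this
  obtain ⟨V, hVW, hxV, Y, hY⟩ := exists_matrix_germ hx X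
  have hYX : ∀ k i, P.stalkGerm V x hxV (Y k i) = X k i := fun k i => by rw [← hY]; rfl
  -- In the source the columns outside the block are corrected so that they become elements of the
  -- kernel.
  set T : Matrix (ρ ⊕ κ) (ρ ⊕ κ) (P.Sec V) := Matrix.fromBlocks 1 (-Y) 0 1 with hT
  set B : Matrix (ρ ⊕ κ') (ρ ⊕ κ) (P.Sec V) := A.map (resSec hVW) with hB
  have hBA : ∀ j i, P.stalkGerm V x hxV (B j i) = A' j i := fun j i => stalkGerm_res _ _ _ _
  -- In the target the first part of the frame is replaced by the images of the first part of the
  -- source frame; these new elements receive the exponents of the source.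
  set S : Matrix (ρ ⊕ κ') (ρ ⊕ κ') (P.Sec V) := Matrix.fromBlocks B.toBlocks₁₁ 0 B.toBlocks₂₁ 1 with hS
  have hone : ∀ {n : Type} [DecidableEq n] (b : n → ℂ) (i j : n),
      P.stalkGerm V x hxV ((1 : Matrix n n (P.Sec V)) i j) ∈ P.stalkLE x (b j - b i) := by
    intro n _ b i j
    by_cases hij : i = j
    · subst hij
      rw [Matrix.one_apply_eq, map_one, sub_self]; exact one_mem_stalkLE
    · rw [Matrix.one_apply_ne hij, map_zero]; exact zero_mem_stalkLE
  have hTm : ∀ i j, P.stalkGerm V x hxV (T i j) ∈ P.stalkLE x (c j - c i) := by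
    rintro (i | i) (j | j)
    · exact hone (fun k => c (.inl k)) i j
    · change P.stalkGerm V x hxV (-Y i j) ∈ _
      rw [map_neg, hYX]
      exact neg_mem_stalkLE (hXm i j)
    · change P.stalkGerm V x hxV 0 ∈ _
      rw [map_zero]; exact zero_mem_stalkLE
    · exact hone (fun k => c (.inr k)) i j
  have hSm : ∀ i j, P.stalkGerm V x hxV (S i j) ∈
      P.stalkLE x (Sum.elim (fun k => c (.inl k)) (fun k => d (.inr k)) j - d i) := by
    rintro (i | i) (j | j)
    · change P.stalkGerm V x hxV (B (.inl i) (.inl j)) ∈ _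
      rw [hBA]; exact hAm _ _
    · change P.stalkGerm V x hxV 0 ∈ _
      rw [map_zero]; exact zero_mem_stalkLE
    · change P.stalkGerm V x hxV (B (.inr i) (.inl j)) ∈ _
      rw [hBA]; exact hAm _ _
    · exact hone (fun k => d (.inr k)) i j
  have hTdet : P.stalkGerm V x hxV T.det ∉ P.stalkLT x (∑ i, c i - ∑ i, c i) := by
    rw [hT, Matrix.det_fromBlocks_zero₂₁, Matrix.det_one, Matrix.det_one, one_mul, map_one, sub_self]
    exact one_notMem_stalkLT
  have hSdet : P.stalkGerm V x hxV S.det ∉ P.stalkLT x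
      (∑ i, Sum.elim (fun k => c (.inl k)) (fun k => d (.inr k)) i - ∑ i, d i) := by
    rw [hS, Matrix.det_fromBlocks_zero₁₂, Matrix.det_one, mul_one, Fintype.sum_sum_type,
      Fintype.sum_sum_type]
    have e1 : P.stalkGerm V x hxV B.toBlocks₁₁.det = A'.toBlocks₁₁.det := by
      rw [RingHom.map_det]
      congr 1
      ext i j
      exact hBA _ _
    rw [e1]
    simpa using hdet'
  have hcd : ∀ i, -(Sum.elim (fun k => c (.inl k)) (fun k => d (.inr k)) : ρ ⊕ κ' → ℂ) i ∈ C := by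
    rintro (i | i)
    · exact (h x hx).exponent _
    · exact (h' x hx).exponent _
  have ev1 := (h.mono hVW).eventually_change (fun i => (h x hx).exponent i) hxV hTm hTdet
  have ev2 := (h'.mono hVW).eventually_change hcd hxV hSm hSdet
  have hsec : ∀ i, secMap (Hom.hom f) V (res F.mod hVW (e i)) = ∑ j, B j i • res G.mod hVW (e' j) :=
    fun i => by
      rw [secMap_res, hA, map_sum]
      exact Finset.sum_congr rfl fun j _ => res_smul _ _ _ _
  have hinl : ∀ k, secMap (Hom.hom f) V (∑ i, T i (.inl k) • res F.mod hVW (e i)) =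
      ∑ j, S j (.inl k) • res G.mod hVW (e' j) := fun k => by
    have e1 : ∑ i, T i (.inl k) • res F.mod hVW (e i) = res F.mod hVW (e (.inl k)) := by
      rw [Fintype.sum_sum_type, Finset.sum_eq_single k]
      · simp [hT]
      · intro l _ hl
        simp [hT, Matrix.one_apply_ne hl]
      · exact fun hk => absurd (Finset.mem_univ _) hk
    rw [e1, hsec]
    refine Finset.sum_congr rfl ?_
    rintro (j | j) _ <;> rfl
  have hinr : ∀ i, germ G.mod V x hxV
      (secMap (Hom.hom f) V (∑ j, T j (.inr i) • res F.mod hVW (e j))) = germ G.mod V x hxV 0 := fun i => by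
    rw [map_sum, map_zero]
    simp only [map_smul, hsec]
    rw [map_sum]
    have e1 : ∀ j : ρ ⊕ κ, germ G.mod V x hxV (T j (.inr i) • ∑ l, B l j • res G.mod hVW (e' l)) =
        ∑ l, (A' l j * P.stalkGerm V x hxV (T j (.inr i))) • germ G.mod W x hx (e' l) := fun j => by
      rw [germ_smul, map_sum, Finset.smul_sum]
      refine Finset.sum_congr rfl fun l _ => ?_
      rw [germ_smul, smul_smul, germ_res, hBA, mul_comm]
    rw [Finset.sum_congr rfl fun j _ => e1 j, Finset.sum_comm]
    refine Finset.sum_eq_zero fun l _ => ?_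
    rw [← Finset.sum_smul, Fintype.sum_sum_type]
    have e2 : ∑ j : κ, A' l (.inr j) * P.stalkGerm V x hxV (T (.inr j) (.inr i)) = A' l (.inr i) := by
      rw [Finset.sum_eq_single i]
      · simp [hT]
      · intro j _ hj
        simp [hT, Matrix.one_apply_ne hj]
      · exact fun hk => absurd (Finset.mem_univ _) hk
    have e3 : ∑ k : ρ, A' l (.inl k) * P.stalkGerm V x hxV (T (.inl k) (.inr i)) = -A' l (.inr i) := by
      have e4 : ∀ k, P.stalkGerm V x hxV (T (.inl k) (.inr i)) = -X k i := fun k => by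
        rw [← hYX, ← map_neg]; rfl
      simp only [e4, mul_neg, Finset.sum_neg_distrib]
      congr 1
      rcases l with l | l
      · exact congrFun (congrFun hAX l) i
      · exact congrFun (congrFun hCX l) i
    rw [e2, e3, neg_add_cancel, zero_smul]
  -- The images vanish as germs at `x`; being finitely many, they vanish on a common neighbourhood.
  choose V' h₁ h₂ hxV' hres using fun i => germ_eq G.mod hxV hxV (hinr i)
  obtain ⟨V₁, hV₁, hoV₁, hxV₁⟩ := mem_nhds_iff.1 (ev1.and ev2)
  obtain ⟨Z, hxZ, hZ⟩ := exists_common_nhds (fun o : Option κ => o.elim (V ⊓ ⟨V₁, hoV₁⟩) V')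
    (by rintro (_ | i); exacts [⟨hxV, hxV₁⟩, hxV' i])
  have hZ0 : Z ≤ V ⊓ ⟨V₁, hoV₁⟩ := hZ none
  have hZV : Z ≤ V := hZ0.trans inf_le_left
  have hZi : ∀ i, Z ≤ V' i := fun i => hZ (some i)
  refine ⟨Z, hxZ, ρ, κ, κ', inferInstance, inferInstance, inferInstance, fun k => c (.inl k), fun k => c (.inr k), fun k => d (.inr k),
    fun j => res F.mod hZV (∑ i, T i j • res F.mod hVW (e i)),
    fun j => res G.mod hZV (∑ i, S i j • res G.mod hVW (e' i)), fun y hy => ?_, fun y hy => ?_,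
    fun k => ?_, fun i => ?_⟩
  · simp only [germ_res F.mod hZV]
    have e1 : Sum.elim (fun k => c (.inl k)) (fun k => c (.inr k)) = c := Sum.elim_comp_inl_inr c
    rw [e1]
    exact (hV₁ (hZ0 hy).2).1 (hZV hy)
  · simp only [germ_res G.mod hZV]
    exact (hV₁ (hZ0 hy).2).2 (hZV hy)
  · rw [secMap_res, hinl]
  · rw [secMap_res, ← res_res G.mod (h₁ i) (hZi i), hres i, map_zero, map_zero]

/-- Any injection is, up to a bijection, the inclusion of a summand. -/
theorem exists_equiv_sum {n ι : Type} [Finite ι] {I : n → ι} (hI : Function.Injective I) :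
    ∃ (κ : Type) (_ : Fintype κ) (ε : n ⊕ κ ≃ ι), ∀ k, ε (.inl k) = I k := by
  classical
  exact ⟨((Set.range I)ᶜ : Set ι), Fintype.ofFinite _,
    ((Equiv.ofInjective I hI).sumCongr (Equiv.refl _)).trans (Equiv.Set.sumCompl (Set.range I)),
    fun k => rfl⟩

/-- Every morphism between modules with local frames has local normal forms. -/
theorem HasLocalFrames.hasNormalForm (hF : F.HasLocalFrames C) (hG : G.HasLocalFrames C) (f : F ⟶ G)
    (x : S1) : HasNormalForm f C x := by
  classical
  obtain ⟨r, hr, hr'⟩ := exists_rank (f := f) hF hG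
  obtain ⟨U, hU, ι, _, c, e, h⟩ := hF x
  obtain ⟨V, hV, κ, _, d, e', h'⟩ := hG x
  obtain ⟨W, h₁, h₂, hxW, A, hA⟩ := exists_matrix f hU hV (e := e) h'
  have hAx := hA x hxW
  have hno := hr x
  rw [minorBound_iff (h x hU) (h' x hV) (A := A.map (P.stalkGerm W x hxW)) hAx] at hno
  push Not at hno
  obtain ⟨J, I, hJI⟩ := hno
  rw [Complex.ofReal_zero, zero_mul, add_zero] at hJI
  have hI : Function.Injective I := fun k l hkl => by
    by_contra hne
    refine hJI ?_
    rw [Matrix.det_zero_of_column_eq hne fun i => by simp only [Matrix.submatrix_apply, hkl]]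
    exact zero_mem_stalkLT
  have hJ : Function.Injective J := fun k l hkl => by
    by_contra hne
    refine hJI ?_
    rw [Matrix.det_zero_of_row_eq hne (funext fun i => by simp only [Matrix.submatrix_apply, hkl])]
    exact zero_mem_stalkLT
  obtain ⟨κ₁, _, ε, hε⟩ := exists_equiv_sum hI
  obtain ⟨κ₂, _, ε', hε'⟩ := exists_equiv_sum hJ
  -- Bordered minors are indexed by `Fin r ⊕ Unit` but are minors of size `r + 1`, all of which
  -- vanish because they are below every order.
  have σ : Fin (r + 1) ≃ Fin r ⊕ Unit := Fintype.equivOfCardEq (by simp)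
  refine hasNormalForm_of_minors (A := A.submatrix ε' ε) (c := c ∘ ε) (d := d ∘ ε')
    (e := fun i => res F.mod h₁ (e (ε i))) (e' := fun j => res G.mod h₂ (e' (ε' j)))
    (fun y hy => (h.mono h₁ y hy).reindex ε) (fun y hy => (h'.mono h₂ y hy).reindex ε')
    (fun i => ?_) hxW ?_ fun j i => ?_
  · refine section_ext G.mod fun y hy => ?_
    rw [← stalkMap_germ, germ_res, hA y hy, map_sum, ← ε'.sum_comp]
    refine Finset.sum_congr rfl fun j _ => ?_
    rw [germ_smul, germ_res]; rfl
  · have e1 : P.stalkGerm W x hxW (A.submatrix ε' ε).toBlocks₁₁.det =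
        ((A.map (P.stalkGerm W x hxW)).submatrix J I).det := by
      rw [RingHom.map_det]
      congr 1
      ext k l
      change P.stalkGerm W x hxW (A (ε' (.inl k)) (ε (.inl l))) = _
      rw [hε, hε']; rfl
    rw [e1]
    simpa only [Function.comp_apply, hε, hε'] using hJI
  · have e1 := fun τ => (minorBound_iff (h x hU) (h' x hV) hAx).1 (hr' x τ)
      (fun k => ε' (Sum.map id (fun _ : Unit => j) (σ k)))
      (fun k => ε (Sum.map id (fun _ : Unit => i) (σ k)))
    rw [RingHom.map_det, ← Matrix.det_submatrix_equiv_self σ]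
    exact eq_zero_of_forall_mem_stalkLT e1

end FilteredModule

end

section

open Limits

namespace PeriodMap

variable {M N : P.Mod} (f : M ⟶ N)

/-! ### Kernels and epimorphisms of sheaves of modules -/

/-- A section which is killed by a morphism comes from its kernel. -/
theorem exists_kernel_section {U : Opens S1} {s : ModSec M U} (hs : secMap f U s = 0) :
    ∃ k : ModSec (kernel f) U, secMap (kernel.ι f) U k = s := by
  let S : ShortComplex P.Mod := ShortComplex.mk (kernel.ι f) f (kernel.condition f)
  have hS : S.Exact := S.exact_of_f_is_kernel (kernelIsKernel f)
  let E := SheafOfModules.evaluation P.ringSheaf (op U)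
  have : E.PreservesZeroMorphisms := ⟨fun _ _ => rfl⟩
  -- Kernels of sheaves of modules are computed on sections.
  have hl : IsLimit (KernelFork.map (KernelFork.ofι (kernel.ι f) (kernel.condition f)) E) :=
    KernelFork.mapIsLimit _ (kernelIsKernel f) E
  have hE : (S.map E).Exact := (S.map E).exact_of_f_is_kernel
    (IsLimit.ofIsoLimit hl (Cone.ext (Iso.refl _) (by rintro (_ | _) <;> rfl)))
  exact (ShortComplex.moduleCat_exact_iff _).1 hE s hs

theorem secMap_injective [Mono f] (U : Opens S1) : Function.Injective (secMap f U) := by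
  have : Mono ((SheafOfModules.evaluation P.ringSheaf (op U)).map f) := inferInstance
  exact (ModuleCat.mono_iff_injective _).1 this

theorem stalkMap_injective [Mono f] (x : S1) : Function.Injective (stalkMap f x) := by
  refine (injective_iff_map_eq_zero _).2 fun t ht => ?_
  obtain ⟨U, hx, s, rfl⟩ := exists_germ M t
  rw [stalkMap_germ] at ht
  obtain ⟨W, h₁, h₂, hW, e⟩ := germ_eq N hx hx (t := 0) (by rw [ht, map_zero])
  rw [map_zero, ← secMap_res] at e
  have := secMap_injective f W (e.trans (map_zero _).symm)
  rw [← germ_res M h₁ x hW, this, map_zero]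

theorem exists_kernel_stalk {x : S1} {t : ModStalk M x} (ht : stalkMap f x t = 0) :
    ∃ k : ModStalk (kernel f) x, stalkMap (kernel.ι f) x k = t := by
  obtain ⟨U, hx, s, rfl⟩ := exists_germ M t
  rw [stalkMap_germ] at ht
  obtain ⟨W, h₁, h₂, hW, e⟩ := germ_eq N hx hx (t := 0) (by rw [ht, map_zero])
  rw [map_zero, ← secMap_res] at e
  obtain ⟨k, hk⟩ := exists_kernel_section f e
  exact ⟨germ _ W x hW k, by rw [stalkMap_germ, hk, germ_res]⟩

/-- An epimorphism of sheaves of modules is locally surjective. -/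
theorem stalkMap_surjective [Epi f] (x : S1) : Function.Surjective (stalkMap f x) := by
  intro t
  obtain ⟨U, hx, s, rfl⟩ := exists_germ N t
  let a := PresheafOfModules.sheafification (𝟙 P.ringSheaf.obj)
  let r : P.Mod ⥤ PresheafOfModules P.ringSheaf.obj :=
    SheafOfModules.forget P.ringSheaf ⋙ PresheafOfModules.restrictScalars (𝟙 P.ringSheaf.obj)
  let adj : a ⊣ r := PresheafOfModules.sheafificationAdjunction (𝟙 P.ringSheaf.obj)
  have hadj : IsIso adj.counit := inferInstanceAs
    (IsIso (PresheafOfModules.sheafificationAdjunction (𝟙 P.ringSheaf.obj)).counit)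
  -- Up to the counit isomorphisms this is `f` itself, so the map of presheaves becomes an
  -- epimorphism after sheafification.
  have h1 : Epi (a.map (r.map f)) := by
    have h : (r ⋙ a).map f = adj.counit.app M ≫ f ≫ inv (adj.counit.app N) := by
      rw [← Category.assoc, IsIso.eq_comp_inv]
      exact adj.counit.naturality f
    change Epi ((r ⋙ a).map f)
    rw [h]
    have h' : Epi (f ≫ inv (adj.counit.app N)) := epi_comp _ _
    exact epi_comp _ _
  obtain ⟨Q, q, hq, hex⟩ : ∃ (Q : PresheafOfModules P.ringSheaf.obj) (q : r.obj N ⟶ Q),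
      r.map f ≫ q = 0 ∧ ∀ (V : Opens S1) (s : ModSec N V), q.app (op V) s = 0 →
        ∃ t, secMap f V t = s := by
    refine ⟨_, cokernel.π (r.map f), cokernel.condition _, fun V s hs => ?_⟩
    let S := ShortComplex.mk (r.map f) (cokernel.π (r.map f)) (cokernel.condition _)
    have hS : S.Exact := S.exact_of_g_is_cokernel (cokernelIsCokernel _)
    let E := PresheafOfModules.evaluation P.ringSheaf.obj (op V)
    have hz : E.PreservesZeroMorphisms := ⟨fun _ _ => rfl⟩
    have hl : IsColimit (CokernelCofork.map (CokernelCofork.ofπ _ (cokernel.condition (r.map f))) E) :=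
      CokernelCofork.mapIsColimit _ (cokernelIsCokernel (r.map f)) E
    have hE : (S.map E).Exact := (S.map E).exact_of_g_is_cokernel
      (IsColimit.ofIsoColimit hl (Cocone.ext (Iso.refl _) (by rintro (_ | _) <;> rfl)))
    exact (ShortComplex.moduleCat_exact_iff _).1 hE s hs
  -- Sheafification kills the presheaf cokernel map, hence so does the unit. As the unit is locally
  -- injective, the class of a section in the presheaf cokernel vanishes locally, which gives local
  -- preimages.
  have h2 : a.map q = a.map 0 := by
    rw [← cancel_epi (a.map (r.map f)), ← a.map_comp, ← a.map_comp, hq, comp_zero]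
  have h3 : q ≫ adj.unit.app Q = 0 ≫ adj.unit.app Q :=
    (adj.unit_naturality q).symm.trans ((congrArg (fun g => adj.unit.app _ ≫ r.map g) h2).trans
      (adj.unit_naturality 0))
  let τ := (PresheafOfModules.toPresheaf _).map (adj.unit.app Q)
  have hτ : Presheaf.IsLocallyInjective (Opens.grothendieckTopology S1) τ :=
    inferInstanceAs (Presheaf.IsLocallyInjective _
      (CategoryTheory.toSheafify (Opens.grothendieckTopology S1) Q.presheaf))
  have h4 : τ.app (op U) (q.app (op U) s) = τ.app (op U) 0 := by
    rw [map_zero]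
    exact congrArg (fun g : r.obj N ⟶ _ => g.app (op U) s) (h3.trans zero_comp)
  obtain ⟨V, i, hi, hxV⟩ := Presheaf.equalizerSieve_mem (Opens.grothendieckTopology S1) τ _ _ h4 x hx
  have h5 : q.app (op V) (res N i.le s) = 0 := by
    have h6 := PresheafOfModules.naturality_apply q i.op s
    refine h6.trans (hi.trans (map_zero _))
  obtain ⟨t, ht⟩ := hex V _ h5
  exact ⟨germ M V x hxV t, by rw [stalkMap_germ, ht, germ_res]⟩

/-- The stalk of the cokernel is the cokernel of the map of stalks. -/
theorem exists_of_stalkMap_cokernel {x : S1} {t : ModStalk N x}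
    (ht : stalkMap (cokernel.π f) x t = 0) : ∃ s, stalkMap f x s = t := by
  obtain ⟨k, rfl⟩ := exists_kernel_stalk _ ht
  -- The kernel of the cokernel is the image, onto which the source maps epimorphically.
  obtain ⟨s, rfl⟩ := stalkMap_surjective (Abelian.factorThruImage f) x k
  exact ⟨s, by rw [← stalkMap_comp]; exact congrArg (stalkMap · x s) (Abelian.image.fac f).symm⟩

end PeriodMap

end

/-! ### Filtrations prescribed by their stalks, and the additive structure -/

section

open Limits PeriodMap

/-- A family of subgroups of the stalks of a sheaf of modules which are the stalks of a filtration. -/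
structure IsStalkFiltration (M : P.Mod) (S : ℂ → ∀ x : S1, AddSubgroup (ModStalk M x)) : Prop where
  exists_section : ∀ {c : ℂ} {x : S1} {t : ModStalk M x}, t ∈ S c x →
    ∃ (U : Opens S1) (hx : x ∈ U) (s : ModSec M U), germ M U x hx s = t ∧
      ∀ y (hy : y ∈ U), germ M U y hy s ∈ S c y
  smul_mem : ∀ {c : ℂ} {x : S1} {a : P.Stalk x} {t : ModStalk M x}, a ∈ P.stalkLE x 0 →
    t ∈ S c x → a • t ∈ S c x
  mono : ∀ {c c' : ℂ} {x : S1}, LeAt x c c' → S c x ≤ S c' x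
  exp_smul : ∀ (γ : L) {c : ℂ} {x : S1} {t : ModStalk M x}, t ∈ S c x →
    P.expStalk x γ • t ∈ S (c + P.μ γ) x

/-- A section agrees near `x` with the one provided by the definition, so membership of its germ is
an open condition. -/
theorem IsStalkFiltration.exists_res {M : P.Mod} {S : ℂ → ∀ x : S1, AddSubgroup (ModStalk M x)}
    (h : IsStalkFiltration M S) {c : ℂ} {x : S1} {U : Opens S1} (hx : x ∈ U) {s : ModSec M U}
    (hs : germ M U x hx s ∈ S c x) : ∃ (V : Opens S1) (_ : V ≤ U), x ∈ V ∧
      ∀ y (hy : y ∈ U), y ∈ V → germ M U y hy s ∈ S c y := by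
  obtain ⟨W, hW, s', e, hs'⟩ := h.exists_section hs
  obtain ⟨V, h₁, h₂, hV, e'⟩ := germ_eq M hx hW e.symm
  refine ⟨V, h₁, hV, fun y hy hyV => ?_⟩
  rw [← germ_res M h₁ y hyV, e', germ_res]
  exact hs' y _

namespace FilteredModule

/-- The filtered module with given stalks of the filtration. -/
def ofStalks (M : P.Mod) (S : ℂ → ∀ x : S1, AddSubgroup (ModStalk M x))
    (h : IsStalkFiltration M S) : FilteredModule P where
  mod := M
  fil c U :=
    { carrier := {s | ∀ x (hx : x ∈ U), germ M U x hx s ∈ S c x}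
      zero_mem' := fun x hx => by rw [map_zero]; exact zero_mem _
      add_mem' := fun hs ht x hx => by rw [map_add]; exact add_mem (hs x hx) (ht x hx)
      neg_mem' := fun hs x hx => by rw [map_neg]; exact neg_mem (hs x hx) }
  res_mem h s hs x hx := by
    rw [germ_res]
    exact hs x _
  local_mem hs x hx := by
    obtain ⟨V, hV, hxV, h'⟩ := hs x hx
    have := h' x hxV
    rwa [germ_res] at this
  smul_mem ha hs x hx := by
    rw [germ_smul]
    exact h.smul_mem ⟨_, hx, _, ha, rfl⟩ (hs x hx)
  le_mem hc _ s hx hs := by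
    obtain ⟨V, hV, hxV, h'⟩ := h.exists_res hx (h.mono hc (hs _ hx))
    exact ⟨V, hV, hxV, fun y hy => by rw [germ_res]; exact h' y (hV hy) hy⟩
  exp_smul γ c U := by
    have key : ∀ (β : L) (d : ℂ) (s : ModSec M U), (∀ x (hx : x ∈ U), germ M U x hx s ∈ S d x) →
        ∀ x (hx : x ∈ U), germ M U x hx (P.expSec U β • s) ∈ S (d + P.μ β) x := fun β d s hs x hx => by
      rw [germ_smul, stalkGerm_expSec]
      exact h.exp_smul β (hs x hx)
    refine le_antisymm ?_ fun s hs => ⟨P.expSec U (-γ) • s, ?_, ?_⟩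
    · rintro _ ⟨s, hs, rfl⟩
      exact key γ c s hs
    · have := key (-γ) _ s hs
      rwa [map_neg, add_neg_cancel_right] at this
    · change P.expSec U γ • P.expSec U (-γ) • s = s
      refine section_ext M fun x hx => ?_
      rw [germ_smul, germ_smul, stalkGerm_expSec, stalkGerm_expSec, smul_smul, ← expStalk_add,
        add_neg_cancel, expStalk_zero, one_smul]

theorem mem_filStalk_ofStalks {M : P.Mod} {S : ℂ → ∀ x : S1, AddSubgroup (ModStalk M x)}
    {h : IsStalkFiltration M S} {c : ℂ} {x : S1} {t : ModStalk M x} :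
    t ∈ (ofStalks M S h).filStalk c x ↔ t ∈ S c x := by
  refine ⟨?_, fun ht => ?_⟩
  · rintro ⟨U, hx, s, hs, rfl⟩
    exact hs x hx
  · obtain ⟨U, hx, s, rfl, hs⟩ := h.exists_section ht
    exact ⟨U, hx, s, hs, rfl⟩

variable {F G : FilteredModule P}

/-- A morphism of sheaves of modules which preserves the filtration on stalks. -/
def homOfStalk (φ : F.mod ⟶ G.mod)
    (h : ∀ c x, ∀ t ∈ F.filStalk c x, stalkMap φ x t ∈ G.filStalk c x) : F ⟶ G where
  hom := φ
  map_fil c U s hs := by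
    refine G.mem_fil_iff.2 fun x hx => ?_
    have := h c x _ (F.mem_fil_iff.1 hs x hx)
    rwa [stalkMap_germ] at this

theorem hom_ext' {f g : F ⟶ G} (h : Hom.hom f = Hom.hom g) : f = g := Hom.ext h

variable (F) in
theorem isStalkFiltration : IsStalkFiltration F.mod fun c x => (F.filStalk c x).toAddSubgroup where
  exists_section := by
    rintro c x _ ⟨U, hx, s, hs, rfl⟩
    exact ⟨U, hx, s, rfl, fun y hy => F.germ_mem hy hs⟩
  smul_mem := F.smul_mem_filStalk
  mono := F.filStalk_mono
  exp_smul γ _ _ _ ht := F.expMul_mem γ ht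

end FilteredModule

/-- The preimage of a filtration. -/
theorem IsStalkFiltration.comap {M N : P.Mod} {S : ℂ → ∀ x : S1, AddSubgroup (ModStalk N x)}
    (h : IsStalkFiltration N S) (f : M ⟶ N) :
    IsStalkFiltration M fun c x => (S c x).comap (stalkMap f x).toAddMonoidHom where
  exists_section {c x t} ht := by
    obtain ⟨U, hx, s, rfl⟩ := exists_germ M t
    change stalkMap f x (germ M U x hx s) ∈ S c x at ht
    rw [stalkMap_germ] at ht
    obtain ⟨V, hV, hxV, h'⟩ := h.exists_res hx ht
    refine ⟨V, hxV, res M hV s, germ_res _ _ _ _ _, fun y hy => ?_⟩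
    change stalkMap f y (germ M V y hy (res M hV s)) ∈ S c y
    rw [germ_res, stalkMap_germ]
    exact h' y _ hy
  smul_mem {c x a t} ha ht := by
    change stalkMap f x (a • t) ∈ S c x
    rw [map_smul]
    exact h.smul_mem ha ht
  mono hc := fun t ht => h.mono hc ht
  exp_smul γ c x t ht := by
    change stalkMap f x (P.expStalk x γ • t) ∈ S (c + P.μ γ) x
    rw [map_smul]
    exact h.exp_smul γ ht

/-- The image of a filtration. -/
theorem IsStalkFiltration.map {M N : P.Mod} {S : ℂ → ∀ x : S1, AddSubgroup (ModStalk M x)}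
    (h : IsStalkFiltration M S) (f : M ⟶ N) :
    IsStalkFiltration N fun c x => (S c x).map (stalkMap f x).toAddMonoidHom where
  exists_section := by
    rintro c x _ ⟨t, ht, rfl⟩
    obtain ⟨U, hx, s, rfl, hs⟩ := h.exists_section ht
    exact ⟨U, hx, secMap f U s, (stalkMap_germ f U x hx s).symm,
      fun y hy => ⟨_, hs y hy, stalkMap_germ f U y hy s⟩⟩
  smul_mem := by
    rintro c x a _ ha ⟨t, ht, rfl⟩
    exact ⟨a • t, h.smul_mem ha ht, map_smul (stalkMap f x) a t⟩
  mono hc := AddSubgroup.map_mono (h.mono hc)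
  exp_smul := by
    rintro γ c x _ ⟨t, ht, rfl⟩
    exact ⟨_, h.exp_smul γ ht, map_smul (stalkMap f x) _ t⟩

/-- The intersection of two filtrations. -/
theorem IsStalkFiltration.inf {M : P.Mod} {S T : ℂ → ∀ x : S1, AddSubgroup (ModStalk M x)}
    (hS : IsStalkFiltration M S) (hT : IsStalkFiltration M T) :
    IsStalkFiltration M fun c x => S c x ⊓ T c x where
  exists_section := by
    rintro c x t ⟨h₁, h₂⟩
    obtain ⟨U, hx, s, rfl, hs⟩ := hS.exists_section h₁
    obtain ⟨V, hV, hxV, hs'⟩ := hT.exists_res hx h₂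
    exact ⟨V, hxV, res M hV s, germ_res _ _ _ _ _, fun y hy => by
      rw [germ_res]; exact ⟨hs y _, hs' y _ hy⟩⟩
  smul_mem ha ht := ⟨hS.smul_mem ha ht.1, hT.smul_mem ha ht.2⟩
  mono hc := inf_le_inf (hS.mono hc) (hT.mono hc)
  exp_smul γ _ _ _ ht := ⟨hS.exp_smul γ ht.1, hT.exp_smul γ ht.2⟩

/-! ### The preadditive category of filtered modules -/

namespace FilteredModule

/-- The group of the morphisms which preserve the filtration. -/
def homSubgroup (F G : FilteredModule P) : AddSubgroup (F.mod ⟶ G.mod) where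
  carrier := {φ | ∀ (c : ℂ) (U : Opens S1) (s : ModSec F.mod U), s ∈ F.fil c U →
    secMap φ U s ∈ G.fil c U}
  zero_mem' _ _ _ _ := zero_mem _
  add_mem' h h' c U s hs := add_mem (h c U s hs) (h' c U s hs)
  neg_mem' h c U s hs := neg_mem (h c U s hs)

/-- Morphisms of filtered modules as elements of a group. -/
def homEquiv (F G : FilteredModule P) : (F ⟶ G) ≃ homSubgroup F G where
  toFun f := ⟨Hom.hom f, Hom.map_fil f⟩
  invFun φ := Hom.mk φ.1 φ.2

instance (F G : FilteredModule P) : AddCommGroup (F ⟶ G) := (homEquiv F G).addCommGroup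

variable {F G : FilteredModule P}

theorem zero_hom : Hom.hom (0 : F ⟶ G) = 0 := rfl

theorem add_hom (f g : F ⟶ G) : Hom.hom (f + g) = Hom.hom f + Hom.hom g := rfl

theorem comp_hom {H : FilteredModule P} (f : F ⟶ G) (g : G ⟶ H) :
    Hom.hom (f ≫ g) = Hom.hom f ≫ Hom.hom g := rfl

theorem id_hom : Hom.hom (𝟙 F) = 𝟙 F.mod := rfl

instance : Preadditive (FilteredModule P) where
  add_comp _ _ _ f g h := hom_ext' <| by
    rw [comp_hom, add_hom, add_hom, comp_hom, comp_hom, Preadditive.add_comp]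
  comp_add _ _ _ f g h := hom_ext' <| by
    rw [comp_hom, add_hom, add_hom, comp_hom, comp_hom, Preadditive.comp_add]

end FilteredModule

end

section

open Limits PeriodMap

namespace FilteredModule

variable {F G : FilteredModule P} (f : F ⟶ G) {C : Finset ℂ}

/-! ### Kernels and cokernels -/

/-- The kernel of a morphism of filtered modules, with the induced filtration. -/
def ker : FilteredModule P :=
  ofStalks (kernel (Hom.hom f)) _ (F.isStalkFiltration.comap (kernel.ι (Hom.hom f)))

theorem mem_filStalk_ker {c : ℂ} {x : S1} {t : ModStalk (ker f).mod x} :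
    t ∈ (ker f).filStalk c x ↔ stalkMap (kernel.ι (Hom.hom f)) x t ∈ F.filStalk c x :=
  mem_filStalk_ofStalks

/-- The inclusion of the kernel. -/
def kerι : ker f ⟶ F := homOfStalk (kernel.ι (Hom.hom f)) fun _ _ _ => (mem_filStalk_ker f).1

/-- The cokernel of a morphism of filtered modules, with the induced filtration. -/
def coker : FilteredModule P :=
  ofStalks (cokernel (Hom.hom f)) _ (G.isStalkFiltration.map (cokernel.π (Hom.hom f)))

theorem mem_filStalk_coker {c : ℂ} {x : S1} {t : ModStalk (coker f).mod x} :
    t ∈ (coker f).filStalk c x ↔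
      ∃ s ∈ G.filStalk c x, stalkMap (cokernel.π (Hom.hom f)) x s = t :=
  mem_filStalk_ofStalks

/-- The projection to the cokernel. -/
def cokerπ : G ⟶ coker f :=
  homOfStalk (cokernel.π (Hom.hom f)) fun _ _ t ht => (mem_filStalk_coker f).2 ⟨t, ht, rfl⟩

variable {f} in
-- In normal form the kernel is spanned by the elements that are sent to zero, and the induced
-- filtration is that of a direct summand of the frame.
theorem hasLocalFrames_ker (h : ∀ x, HasNormalForm f C x) : (ker f).HasLocalFrames C := by
  intro x
  obtain ⟨U, hx, ρ, κ, κ', _, _, _, b, c, d, e, e', he, he', hinl, hinr⟩ := h x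
  choose k hk using fun i => exists_kernel_section (Hom.hom f) (hinr i)
  refine ⟨U, hx, κ, inferInstance, c, k, fun y hy => ?_⟩
  have hs : ∀ a : κ → P.Stalk y, stalkMap (kernel.ι (Hom.hom f)) y
      (∑ i, a i • germ (kernel (Hom.hom f)) U y hy (k i)) =
        ∑ j, Sum.elim (fun _ => 0) a j • germ F.mod U y hy (e j) := fun a => by
    rw [map_sum, Fintype.sum_sum_type]
    simp only [Sum.elim_inl, Sum.elim_inr, zero_smul, Finset.sum_const_zero, zero_add, map_smul,
      stalkMap_germ, hk]
  have hex : ∀ t : ModStalk (kernel (Hom.hom f)) y,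
      ∃ a : κ → P.Stalk y, ∑ i, a i • germ (kernel (Hom.hom f)) U y hy (k i) = t := fun t => by
    obtain ⟨a, ha⟩ := (he y hy).exists_sum (stalkMap (kernel.ι (Hom.hom f)) y t)
    -- The coordinates of the image are the `inl` coordinates, so these vanish for an element of the
    -- kernel.
    have h0 : ∑ j, Sum.elim (fun i => a (.inl i)) (fun _ => 0) j • germ G.mod U y hy (e' j) = 0 := by
      have h1 : stalkMap (Hom.hom f) y (∑ j, a j • germ F.mod U y hy (e j)) = 0 := by
        rw [ha, ← stalkMap_comp, kernel.condition, stalkMap_zero]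
      rw [map_sum, Fintype.sum_sum_type] at h1
      rw [Fintype.sum_sum_type, ← h1]
      simp only [Sum.elim_inl, Sum.elim_inr, zero_smul, map_smul, stalkMap_germ, hinl, hinr, map_zero,
        smul_zero, Finset.sum_const_zero]
    refine ⟨fun i => a (.inr i), stalkMap_injective (kernel.ι (Hom.hom f)) y ?_⟩
    rw [hs, ← ha]
    refine Finset.sum_congr rfl fun j _ => ?_
    obtain j | j := j
    · rw [show a (.inl j) = 0 from (he' y hy).eq_zero _ h0 (.inl j)]; rfl
    · rfl
  refine ⟨fun i => (he y hy).exponent (.inr i), hex, fun a ha i => ?_, fun a d => ?_⟩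
  · have h1 := hs a
    rw [show ∑ i, a i • germ (kernel (Hom.hom f)) U y hy (k i) = 0 from ha, map_zero] at h1
    exact (he y hy).eq_zero _ h1.symm (.inr i)
  · refine (mem_filStalk_ker f).trans ?_
    have h1 := (he y hy).mem_iff (Sum.elim (fun _ => 0) a) d
    rw [← hs] at h1
    refine h1.trans ⟨fun h i => h (.inr i), ?_⟩
    rintro h (i | i)
    · exact zero_mem_stalkLE
    · exact h i

section Cokernel

variable {f} {y : S1} {U : Opens S1} {ρ κ κ' : Type} [Fintype ρ] [Fintype κ] [Fintype κ']
  {b : ρ → ℂ} {c : κ → ℂ} {d : κ' → ℂ} {e : ρ ⊕ κ → ModSec F.mod U} {e' : ρ ⊕ κ' → ModSec G.mod U}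
  (he : F.IsFrameOn C (Sum.elim b c) U e) (he' : G.IsFrameOn C (Sum.elim b d) U e')
  (hinl : ∀ k, secMap (Hom.hom f) U (e (.inl k)) = e' (.inl k))
  (hinr : ∀ i, secMap (Hom.hom f) U (e (.inr i)) = 0) (hy : y ∈ U)

include hinl hinr in
theorem stalkMap_sum_normalForm (a : ρ ⊕ κ → P.Stalk y) :
    stalkMap (Hom.hom f) y (∑ j, a j • germ F.mod U y hy (e j)) =
      ∑ j, Sum.elim (fun i => a (.inl i)) (fun _ => 0) j • germ G.mod U y hy (e' j) := by
  rw [map_sum, Fintype.sum_sum_type, Fintype.sum_sum_type]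
  simp only [Sum.elim_inl, Sum.elim_inr, zero_smul, map_smul, stalkMap_germ, hinl, hinr, map_zero,
    smul_zero, Finset.sum_const_zero]

omit [Fintype κ] in
include hinl in
theorem stalkMap_cokernel_sum (a : ρ ⊕ κ' → P.Stalk y) : stalkMap (cokernel.π (Hom.hom f)) y
    (∑ j, a j • germ G.mod U y hy (e' j)) = ∑ i, a (.inr i) • germ (cokernel (Hom.hom f)) U y hy
      (secMap (cokernel.π (Hom.hom f)) U (e' (.inr i))) := by
  have hπ : ∀ i, stalkMap (cokernel.π (Hom.hom f)) y (germ G.mod U y hy (e' (.inl i))) = 0 := fun i => by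
    rw [← hinl, ← stalkMap_germ, ← stalkMap_comp, cokernel.condition, stalkMap_zero]
  rw [map_sum, Fintype.sum_sum_type]
  simp only [map_smul, hπ, smul_zero, Finset.sum_const_zero, zero_add, stalkMap_germ]

include he he' hinl hinr in
/-- Two lifts of an element of the cokernel have the same coordinates on the complement of the image. -/
theorem coord_eq_of_stalkMap_cokernel_eq {a a' : ρ ⊕ κ' → P.Stalk y}
    (h : stalkMap (cokernel.π (Hom.hom f)) y (∑ j, a j • germ G.mod U y hy (e' j)) =
      stalkMap (cokernel.π (Hom.hom f)) y (∑ j, a' j • germ G.mod U y hy (e' j))) (i : κ') :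
    a (.inr i) = a' (.inr i) := by
  rw [← sub_eq_zero, ← map_sub] at h
  obtain ⟨s, hs⟩ := exists_of_stalkMap_cokernel _ h
  obtain ⟨v, rfl⟩ := (he y hy).exists_sum s
  rw [stalkMap_sum_normalForm hinl hinr, ← Finset.sum_sub_distrib] at hs
  simp only [← sub_smul] at hs
  exact (sub_eq_zero.1 (congrFun ((he' y hy).ext hs) (.inr i)).symm)

include he he' hinl hinr in
-- The image is spanned by the `inl` part of the target frame. Any two lifts share their `inr`
-- coordinates, and the lift with zero `inl` coordinates has the smallest order, so the quotient
-- filtration is read off from the `inr` part.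
theorem isFrame_coker : (coker f).IsFrame y C d fun i => germ (cokernel (Hom.hom f)) U y hy
    (secMap (cokernel.π (Hom.hom f)) U (e' (.inr i))) := by
  have hs' : ∀ a : κ' → P.Stalk y, ∑ i, a i • germ (cokernel (Hom.hom f)) U y hy
      (secMap (cokernel.π (Hom.hom f)) U (e' (.inr i))) = stalkMap (cokernel.π (Hom.hom f)) y
        (∑ j, Sum.elim (0 : ρ → P.Stalk y) a j • germ G.mod U y hy (e' j)) := fun a =>
    (stalkMap_cokernel_sum hinl hy (Sum.elim (0 : ρ → P.Stalk y) a)).symm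
  have hex : ∀ t : ModStalk (cokernel (Hom.hom f)) y, ∃ a : κ' → P.Stalk y,
      ∑ i, a i • germ (cokernel (Hom.hom f)) U y hy
        (secMap (cokernel.π (Hom.hom f)) U (e' (.inr i))) = t := fun t => by
    obtain ⟨s, rfl⟩ := stalkMap_surjective (cokernel.π (Hom.hom f)) y t
    obtain ⟨a, rfl⟩ := (he' y hy).exists_sum s
    exact ⟨_, (stalkMap_cokernel_sum hinl hy a).symm⟩
  have heq : ∀ a : κ' → P.Stalk y, ∑ i, a i • germ (cokernel (Hom.hom f)) U y hy
      (secMap (cokernel.π (Hom.hom f)) U (e' (.inr i))) = 0 → ∀ i, a i = 0 := fun a ha i => by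
    have h0 : stalkMap (cokernel.π (Hom.hom f)) y (∑ j, (0 : ρ ⊕ κ' → P.Stalk y) j •
        germ G.mod U y hy (e' j)) = 0 := by
      simp only [Pi.zero_apply, zero_smul, Finset.sum_const_zero, map_zero]
    have h1 := coord_eq_of_stalkMap_cokernel_eq he he' hinl hinr hy
      ((hs' a).symm.trans (ha.trans h0.symm)) i
    exact h1
  have hmem : ∀ (a : κ' → P.Stalk y) (z : ℂ), (∃ s ∈ G.filStalk z y,
      stalkMap (cokernel.π (Hom.hom f)) y s = ∑ i, a i • germ (cokernel (Hom.hom f)) U y hy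
        (secMap (cokernel.π (Hom.hom f)) U (e' (.inr i)))) ↔ ∀ i, a i ∈ P.stalkLE y (z - d i) := by
    refine fun a z => ⟨?_, fun h => ⟨_, ?_, (hs' a).symm⟩⟩
    · rintro ⟨s, hs₁, hs₂⟩ i
      obtain ⟨v, rfl⟩ := (he' y hy).exists_sum s
      rw [(he' y hy).mem_iff] at hs₁
      have h1 := coord_eq_of_stalkMap_cokernel_eq he he' hinl hinr hy
        (a' := Sum.elim (0 : ρ → P.Stalk y) a) (hs₂.trans (hs' a)) i
      rw [show a i = v (.inr i) from h1.symm]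
      exact hs₁ (.inr i)
    · rw [(he' y hy).mem_iff]
      rintro (i | i)
      · exact zero_mem_stalkLE
      · exact h i
  exact ⟨fun i => (he' y hy).exponent (.inr i), hex, heq,
    fun a z => (mem_filStalk_coker f).trans (hmem a z)⟩

end Cokernel

variable {f} in
theorem hasLocalFrames_coker (h : ∀ x, HasNormalForm f C x) : (coker f).HasLocalFrames C := by
  intro x
  obtain ⟨U, hx, ρ, κ, κ', _, _, _, b, c, d, e, e', he, he', hinl, hinr⟩ := h x
  exact ⟨U, hx, κ', inferInstance, d, fun i => secMap (cokernel.π (Hom.hom f)) U (e' (.inr i)),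
    fun y hy => isFrame_coker he he' hinl hinr hy⟩

variable {f} in
/-- Morphisms with local normal forms are strict. -/
theorem exists_mem_filStalk_of_normalForm {x : S1} (h : HasNormalForm f C x) {c : ℂ}
    {t : ModStalk F.mod x} (ht : stalkMap (Hom.hom f) x t ∈ G.filStalk c x) :
    ∃ t' ∈ F.filStalk c x, stalkMap (Hom.hom f) x t' = stalkMap (Hom.hom f) x t := by
  obtain ⟨U, hx, ρ, κ, κ', _, _, _, b, c, d, e, e', he, he', hinl, hinr⟩ := h
  obtain ⟨a, rfl⟩ := (he x hx).exists_sum t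
  have hs := stalkMap_sum_normalForm hinl hinr hx
  rw [hs, (he' x hx).mem_iff] at ht
  -- Dropping the coordinates along the kernel does not change the image, and the remaining ones
  -- obey the same bounds because the common elements have equal exponents.
  refine ⟨∑ j, Sum.elim (fun i => a (.inl i)) (fun _ => 0) j • germ F.mod U x hx (e j), ?_, ?_⟩
  · rw [(he x hx).mem_iff]
    rintro (i | i)
    · exact ht (.inl i)
    · exact zero_mem_stalkLE
  · rw [hs, hs]; rfl

end FilteredModule

end

section

open Limits PeriodMap

namespace FilteredModule

variable {F G : FilteredModule P} {C : Finset ℂ}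

/-! ### Biproducts and the zero object -/

variable (F G) in
/-- The direct sum of two filtered modules. -/
def prod : FilteredModule P :=
  ofStalks (F.mod ⊞ G.mod) _ ((F.isStalkFiltration.comap biprod.fst).inf
    (G.isStalkFiltration.comap biprod.snd))

theorem mem_filStalk_prod {c : ℂ} {x : S1} {t : ModStalk (F.mod ⊞ G.mod) x} :
    t ∈ (prod F G).filStalk c x ↔ stalkMap (biprod.fst : F.mod ⊞ G.mod ⟶ F.mod) x t ∈ F.filStalk c x ∧
      stalkMap (biprod.snd : F.mod ⊞ G.mod ⟶ G.mod) x t ∈ G.filStalk c x :=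
  mem_filStalk_ofStalks

theorem stalkMap_biprod_fst_inl {M N : P.Mod} (x : S1) (t : ModStalk M x) :
    stalkMap (biprod.fst : M ⊞ N ⟶ M) x (stalkMap biprod.inl x t) = t := by
  rw [← stalkMap_comp, biprod.inl_fst, stalkMap_id]

theorem stalkMap_biprod_snd_inr {M N : P.Mod} (x : S1) (t : ModStalk N x) :
    stalkMap (biprod.snd : M ⊞ N ⟶ N) x (stalkMap biprod.inr x t) = t := by
  rw [← stalkMap_comp, biprod.inr_snd, stalkMap_id]

theorem stalkMap_biprod_snd_inl {M N : P.Mod} (x : S1) (t : ModStalk M x) :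
    stalkMap (biprod.snd : M ⊞ N ⟶ N) x (stalkMap biprod.inl x t) = 0 := by
  rw [← stalkMap_comp, biprod.inl_snd, stalkMap_zero]

theorem stalkMap_biprod_fst_inr {M N : P.Mod} (x : S1) (t : ModStalk N x) :
    stalkMap (biprod.fst : M ⊞ N ⟶ M) x (stalkMap biprod.inr x t) = 0 := by
  rw [← stalkMap_comp, biprod.inr_fst, stalkMap_zero]

theorem stalkMap_biprod_total {M N : P.Mod} (x : S1) (t : ModStalk (M ⊞ N) x) :
    stalkMap (biprod.inl : M ⟶ M ⊞ N) x (stalkMap biprod.fst x t) +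
      stalkMap biprod.inr x (stalkMap biprod.snd x t) = t := by
  rw [← stalkMap_comp, ← stalkMap_comp, ← stalkMap_add, biprod.total, stalkMap_id]

theorem inl_mem_filStalk_prod {c : ℂ} {x : S1} {t : ModStalk F.mod x} (ht : t ∈ F.filStalk c x) :
    stalkMap (biprod.inl : F.mod ⟶ F.mod ⊞ G.mod) x t ∈ (prod F G).filStalk c x := by
  refine mem_filStalk_prod.2 ⟨?_, ?_⟩
  · rwa [stalkMap_biprod_fst_inl]
  · rw [stalkMap_biprod_snd_inl]
    exact zero_mem _

theorem inr_mem_filStalk_prod {c : ℂ} {x : S1} {t : ModStalk G.mod x} (ht : t ∈ G.filStalk c x) :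
    stalkMap (biprod.inr : G.mod ⟶ F.mod ⊞ G.mod) x t ∈ (prod F G).filStalk c x := by
  refine mem_filStalk_prod.2 ⟨?_, ?_⟩
  · rw [stalkMap_biprod_fst_inr]
    exact zero_mem _
  · rwa [stalkMap_biprod_snd_inr]

variable (F G) in
/-- The structure of the direct sum of filtered modules as a biproduct. -/
def prodBicone : BinaryBicone F G where
  pt := prod F G
  fst := homOfStalk biprod.fst fun _ _ _ ht => (mem_filStalk_prod.1 ht).1
  snd := homOfStalk biprod.snd fun _ _ _ ht => (mem_filStalk_prod.1 ht).2
  inl := homOfStalk biprod.inl fun _ _ _ => inl_mem_filStalk_prod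
  inr := homOfStalk biprod.inr fun _ _ _ => inr_mem_filStalk_prod
  inl_fst := hom_ext' biprod.inl_fst
  inl_snd := hom_ext' biprod.inl_snd
  inr_fst := hom_ext' biprod.inr_fst
  inr_snd := hom_ext' biprod.inr_snd

theorem prodBicone_total : (prodBicone F G).fst ≫ (prodBicone F G).inl +
    (prodBicone F G).snd ≫ (prodBicone F G).inr = 𝟙 (prodBicone F G).pt :=
  hom_ext' biprod.total

theorem IsFrame.prod {x : S1} {ι κ : Type} [Fintype ι] [Fintype κ] {c : ι → ℂ} {d : κ → ℂ}
    {e : ι → ModStalk F.mod x} {e' : κ → ModStalk G.mod x} (h : F.IsFrame x C c e)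
    (h' : G.IsFrame x C d e') : (prod F G).IsFrame x C (Sum.elim c d)
      (Sum.elim (fun i => stalkMap (biprod.inl : F.mod ⟶ F.mod ⊞ G.mod) x (e i))
        fun i => stalkMap (biprod.inr : G.mod ⟶ F.mod ⊞ G.mod) x (e' i)) := by
  set E : ι ⊕ κ → ModStalk (F.mod ⊞ G.mod) x :=
    Sum.elim (fun i => stalkMap (biprod.inl : F.mod ⟶ F.mod ⊞ G.mod) x (e i))
      fun i => stalkMap (biprod.inr : G.mod ⟶ F.mod ⊞ G.mod) x (e' i) with hE
  have hsum : ∀ a : ι ⊕ κ → P.Stalk x, ∑ j, a j • E j =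
      stalkMap biprod.inl x (∑ i, a (.inl i) • e i) +
        stalkMap biprod.inr x (∑ i, a (.inr i) • e' i) := fun a => by
    rw [Fintype.sum_sum_type, map_sum, map_sum]
    simp only [hE, Sum.elim_inl, Sum.elim_inr, map_smul]
  have hfst : ∀ a : ι ⊕ κ → P.Stalk x, stalkMap (biprod.fst : F.mod ⊞ G.mod ⟶ F.mod) x
      (∑ j, a j • E j) = ∑ i, a (.inl i) • e i := fun a => by
    rw [hsum, map_add, stalkMap_biprod_fst_inl, stalkMap_biprod_fst_inr, add_zero]
  have hsnd : ∀ a : ι ⊕ κ → P.Stalk x, stalkMap (biprod.snd : F.mod ⊞ G.mod ⟶ G.mod) x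
      (∑ j, a j • E j) = ∑ i, a (.inr i) • e' i := fun a => by
    rw [hsum, map_add, stalkMap_biprod_snd_inl, stalkMap_biprod_snd_inr, zero_add]
  have hex : ∀ t : ModStalk (F.mod ⊞ G.mod) x, ∃ a : ι ⊕ κ → P.Stalk x, ∑ j, a j • E j = t := by
    intro t
    obtain ⟨a, ha⟩ := h.exists_sum (stalkMap biprod.fst x t)
    obtain ⟨b, hb⟩ := h'.exists_sum (stalkMap biprod.snd x t)
    refine ⟨Sum.elim a b, ?_⟩
    rw [hsum, ← stalkMap_biprod_total x t, ← ha, ← hb]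
    rfl
  have heq : ∀ a : ι ⊕ κ → P.Stalk x, ∑ j, a j • E j = 0 → ∀ i, a i = 0 := fun a ha => by
    have h1 := hfst a
    have h2 := hsnd a
    rw [ha, map_zero] at h1 h2
    rintro (i | i)
    · exact h.eq_zero _ h1.symm i
    · exact h'.eq_zero _ h2.symm i
  have hmem : ∀ (a : ι ⊕ κ → P.Stalk x) (z : ℂ), ∑ j, a j • E j ∈ (FilteredModule.prod F G).filStalk z x ↔
      ∀ i, a i ∈ P.stalkLE x (z - Sum.elim c d i) := fun a z => by
    rw [Sum.forall]
    refine mem_filStalk_prod.trans (and_congr ?_ ?_)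
    · rw [hfst]; exact h.mem_iff _ z
    · rw [hsnd]; exact h'.mem_iff _ z
  refine ⟨?_, hex, heq, hmem⟩
  rintro (i | i)
  exacts [h.exponent i, h'.exponent i]

theorem HasLocalFrames.prod (hF : F.HasLocalFrames C) (hG : G.HasLocalFrames C) :
    (prod F G).HasLocalFrames C := by
  intro x
  obtain ⟨U, hU, ι, _, c, e, h⟩ := hF x
  obtain ⟨V, hV, κ, _, d, e', h'⟩ := hG x
  have hUV : x ∈ U ⊓ V := ⟨hU, hV⟩
  refine ⟨U ⊓ V, hUV, ι ⊕ κ, inferInstance, Sum.elim c d,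
    Sum.elim (fun i => secMap (biprod.inl : F.mod ⟶ F.mod ⊞ G.mod) _ (res F.mod inf_le_left (e i)))
      (fun i => secMap (biprod.inr : G.mod ⟶ F.mod ⊞ G.mod) _ (res G.mod inf_le_right (e' i))),
    fun y hy => ?_⟩
  convert (h y hy.1).prod (h' y hy.2) using 1
  funext i
  obtain i | i := i
  · exact ((stalkMap_germ _ _ _ _ _).symm.trans (congrArg _ (germ_res _ _ _ _ _)))
  · exact ((stalkMap_germ _ _ _ _ _).symm.trans (congrArg _ (germ_res _ _ _ _ _)))

open ZeroObject in
variable (P) in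
/-- The zero filtered module. -/
def zero : FilteredModule P := ofStalks (0 : P.Mod) (fun _ _ => ⊤)
  { exists_section := fun {_ x t} _ => by
      obtain ⟨U, hx, s, hs⟩ := exists_germ (0 : P.Mod) t
      exact ⟨U, hx, s, hs, fun _ _ => trivial⟩
    smul_mem := fun _ _ => trivial
    mono := fun _ => le_rfl
    exp_smul := fun _ _ _ _ _ => trivial }

theorem zero_id : 𝟙 (zero P) = 0 := hom_ext' ((isZero_zero P.Mod).eq_of_src _ _)

theorem hasLocalFrames_zero : (zero P).HasLocalFrames C := by
  have h0 : ∀ (x : S1) (t : ModStalk (zero P).mod x), t = 0 := fun x t => by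
    rw [← stalkMap_id x t, ← id_hom, zero_id, zero_hom, stalkMap_zero]
  refine fun x => ⟨⊤, trivial, Empty, inferInstance, Empty.elim, fun i => i.elim, fun y hy =>
    ⟨fun i => i.elim, fun t => ⟨Empty.elim, ((h0 y _).trans (h0 y t).symm)⟩, fun _ _ i => i.elim,
      fun a d => ⟨fun _ i => i.elim, fun _ => ?_⟩⟩⟩
  rw [h0 y (∑ i, _)]
  exact zero_mem _

/-! ### Universal properties -/

/-- The underlying sheaf of modules. -/
def toMod : FilteredModule P ⥤ P.Mod where
  obj F := F.mod
  map f := Hom.hom f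

instance : (toMod (P := P)).Faithful := ⟨fun h => hom_ext' h⟩

variable (f : F ⟶ G)

theorem kerι_comp : kerι f ≫ f = 0 := hom_ext' (kernel.condition _)

theorem comp_cokerπ : f ≫ cokerπ f = 0 := hom_ext' (cokernel.condition _)

instance : Mono (kerι f) := toMod.mono_of_mono_map (inferInstanceAs (Mono (kernel.ι (Hom.hom f))))

instance : Epi (cokerπ f) := toMod.epi_of_epi_map (inferInstanceAs (Epi (cokernel.π (Hom.hom f))))

variable {f} {H : FilteredModule P}

theorem hom_comp_eq_zero {g : G ⟶ H} (h : f ≫ g = 0) : Hom.hom f ≫ Hom.hom g = 0 :=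
  congrArg Hom.hom h

theorem lift_mem_filStalk_ker {k : H ⟶ F} (hk : Hom.hom k ≫ Hom.hom f = 0) {c : ℂ} {x : S1}
    {t : ModStalk H.mod x} (ht : t ∈ H.filStalk c x) :
    stalkMap (kernel.lift (Hom.hom f) (Hom.hom k) hk) x t ∈ (ker f).filStalk c x := by
  refine (mem_filStalk_ker f).2 ?_
  rw [← stalkMap_comp, kernel.lift_ι]
  exact Hom.stalkMap_mem k ht

theorem desc_mem_filStalk_coker {k : G ⟶ H} (hk : Hom.hom f ≫ Hom.hom k = 0) {c : ℂ} {x : S1}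
    {t : ModStalk (cokernel (Hom.hom f)) x} (ht : t ∈ (coker f).filStalk c x) :
    stalkMap (cokernel.desc (Hom.hom f) (Hom.hom k) hk) x t ∈ H.filStalk c x := by
  obtain ⟨s, hs, rfl⟩ := (mem_filStalk_coker f).1 ht
  rw [← stalkMap_comp, cokernel.π_desc]
  exact Hom.stalkMap_mem k hs

/-- The universal property of the kernel. -/
def kerLift (k : H ⟶ F) (hk : k ≫ f = 0) : { l : H ⟶ ker f // l ≫ kerι f = k } :=
  ⟨homOfStalk (kernel.lift (Hom.hom f) (Hom.hom k) (hom_comp_eq_zero hk))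
    fun _ _ _ => lift_mem_filStalk_ker _, hom_ext' (kernel.lift_ι _ _ _)⟩

/-- The universal property of the cokernel. -/
def cokerDesc (k : G ⟶ H) (hk : f ≫ k = 0) : { l : coker f ⟶ H // cokerπ f ≫ l = k } :=
  ⟨homOfStalk (cokernel.desc (Hom.hom f) (Hom.hom k) (hom_comp_eq_zero hk))
    fun _ _ _ => desc_mem_filStalk_coker _, hom_ext' (cokernel.π_desc _ _ _)⟩

/-- By strictness an element of the filtration lying in the image has a preimage in the same step,
and by injectivity this is the given one. So a lift of sheaves of modules is automatically filtered.
-/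
theorem mem_filStalk_of_comp_mono [Mono (Hom.hom f)] (hf : ∀ x, HasNormalForm f C x) {k : H ⟶ G}
    {l : H.mod ⟶ F.mod} (hl : l ≫ Hom.hom f = Hom.hom k) {c : ℂ} {x : S1} {t : ModStalk H.mod x}
    (ht : t ∈ H.filStalk c x) : stalkMap l x t ∈ F.filStalk c x := by
  have h1 : stalkMap (Hom.hom f) x (stalkMap l x t) ∈ G.filStalk c x := by
    rw [← stalkMap_comp, hl]
    exact Hom.stalkMap_mem k ht
  obtain ⟨t', ht', e⟩ := exists_mem_filStalk_of_normalForm (hf x) h1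
  exact stalkMap_injective _ x e ▸ ht'

/-- Strictness provides preimages in the same step of the filtration, on which the factored morphism
is known to be filtered. -/
theorem mem_filStalk_of_epi_comp [Epi (Hom.hom f)] (hf : ∀ x, HasNormalForm f C x) {k : F ⟶ H}
    {l : G.mod ⟶ H.mod} (hl : Hom.hom f ≫ l = Hom.hom k) {c : ℂ} {x : S1} {t : ModStalk G.mod x}
    (ht : t ∈ G.filStalk c x) : stalkMap l x t ∈ H.filStalk c x := by
  obtain ⟨s, rfl⟩ := stalkMap_surjective (Hom.hom f) x t
  obtain ⟨t', ht', e⟩ := exists_mem_filStalk_of_normalForm (hf x) ht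
  rw [← e, ← stalkMap_comp, hl]
  exact Hom.stalkMap_mem k ht'

/-- A strict monomorphism is the kernel of its cokernel. -/
def liftOfMono [Mono (Hom.hom f)] (hf : ∀ x, HasNormalForm f C x) (k : H ⟶ G)
    (hk : k ≫ cokerπ f = 0) : { l : H ⟶ F // l ≫ f = k } :=
  ⟨homOfStalk (Abelian.monoLift (Hom.hom f) (Hom.hom k) (hom_comp_eq_zero hk))
    fun _ _ _ => mem_filStalk_of_comp_mono hf (Abelian.monoLift_comp _ _ _),
    hom_ext' (Abelian.monoLift_comp _ _ _)⟩

/-- A strict epimorphism is the cokernel of its kernel. -/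
def descOfEpi [Epi (Hom.hom f)] (hf : ∀ x, HasNormalForm f C x) (k : F ⟶ H)
    (hk : kerι f ≫ k = 0) : { l : G ⟶ H // f ≫ l = k } :=
  ⟨homOfStalk (Abelian.epiDesc (Hom.hom f) (Hom.hom k) (hom_comp_eq_zero hk))
    fun _ _ _ => mem_filStalk_of_epi_comp hf (Abelian.comp_epiDesc _ _ _),
    hom_ext' (Abelian.comp_epiDesc _ _ _)⟩

end FilteredModule

end

section

open Limits PeriodMap FilteredModule

namespace Be

variable {C : Finset ℂ} (hC : ∀ c ∈ C, ∀ c' ∈ C, c ≠ c' → ∀ γ : L, c ≠ c' + P.μ γ)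
  {X Y : Be C P} (f : X ⟶ Y)

/-! ### The abelian category -/

include hC

theorem hasNormalForm (x : S1) : HasNormalForm f.hom C x :=
  (X.property.hasLocalFrames hC).hasNormalForm (Y.property.hasLocalFrames hC) f.hom x

/-- The kernel of a morphism. -/
def ker : Be C P :=
  ⟨FilteredModule.ker f.hom, isBetti_of_hasLocalFrames (hasLocalFrames_ker (hasNormalForm hC f))⟩

/-- The cokernel of a morphism. -/
def coker : Be C P :=
  ⟨FilteredModule.coker f.hom, isBetti_of_hasLocalFrames (hasLocalFrames_coker (hasNormalForm hC f))⟩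

/-- The inclusion of the kernel. -/
def kerι : ker hC f ⟶ X := ObjectProperty.homMk (FilteredModule.kerι f.hom)

/-- The projection to the cokernel. -/
def cokerπ : Y ⟶ coker hC f := ObjectProperty.homMk (FilteredModule.cokerπ f.hom)

theorem kerι_comp : kerι hC f ≫ f = 0 := ObjectProperty.hom_ext _ (FilteredModule.kerι_comp f.hom)

theorem comp_cokerπ : f ≫ cokerπ hC f = 0 :=
  ObjectProperty.hom_ext _ (FilteredModule.comp_cokerπ f.hom)

theorem mono_kerι : Mono (kerι hC f) :=
  ⟨fun _ _ h => ObjectProperty.hom_ext _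
    ((cancel_mono (FilteredModule.kerι f.hom)).1 (congrArg (·.hom) h))⟩

theorem epi_cokerπ : Epi (cokerπ hC f) :=
  ⟨fun _ _ h => ObjectProperty.hom_ext _
    ((cancel_epi (FilteredModule.cokerπ f.hom)).1 (congrArg (·.hom) h))⟩

/-- The kernel is a kernel. -/
def isLimitKer : IsLimit (KernelFork.ofι (kerι hC f) (kerι_comp hC f)) :=
  have := mono_kerι hC f
  KernelFork.IsLimit.ofι' _ _ fun k hk =>
    let l := kerLift (f := f.hom) k.hom (congrArg (·.hom) hk)
    ⟨ObjectProperty.homMk l.1, ObjectProperty.hom_ext _ l.2⟩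

/-- The cokernel is a cokernel. -/
def isColimitCoker : IsColimit (CokernelCofork.ofπ (cokerπ hC f) (comp_cokerπ hC f)) :=
  have := epi_cokerπ hC f
  CokernelCofork.IsColimit.ofπ' _ _ fun k hk =>
    let l := cokerDesc (f := f.hom) k.hom (congrArg (·.hom) hk)
    ⟨ObjectProperty.homMk l.1, ObjectProperty.hom_ext _ l.2⟩

/-- The filtered kernel belongs to the category and its inclusion composes to zero with `f`, hence
is zero. Its underlying map is the kernel inclusion of sheaves of modules. -/
theorem mono_hom [Mono f] : Mono (Hom.hom f.hom) := by
  have h : kerι hC f = 0 := zero_of_comp_mono f (kerι_comp hC f)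
  exact Preadditive.mono_of_kernel_zero (congrArg (fun g => Hom.hom g.hom) h)

theorem epi_hom [Epi f] : Epi (Hom.hom f.hom) := by
  have h : cokerπ hC f = 0 := zero_of_epi_comp f (comp_cokerπ hC f)
  exact Preadditive.epi_of_cokernel_zero (congrArg (fun g => Hom.hom g.hom) h)

/-- A monomorphism is the kernel of its cokernel. -/
abbrev normalMono [Mono f] : NormalMono f where
  Z := coker hC f
  g := cokerπ hC f
  w := comp_cokerπ hC f
  isLimit := KernelFork.IsLimit.ofι' _ _ fun k hk =>
    have := mono_hom hC f
    let l := liftOfMono (f := f.hom) (hasNormalForm hC f) k.hom (congrArg (·.hom) hk)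
    ⟨ObjectProperty.homMk l.1, ObjectProperty.hom_ext _ l.2⟩

/-- An epimorphism is the cokernel of its kernel. -/
abbrev normalEpi [Epi f] : NormalEpi f where
  W := ker hC f
  g := kerι hC f
  w := kerι_comp hC f
  isColimit := CokernelCofork.IsColimit.ofπ' _ _ fun k hk =>
    have := epi_hom hC f
    let l := descOfEpi (f := f.hom) (hasNormalForm hC f) k.hom (congrArg (·.hom) hk)
    ⟨ObjectProperty.homMk l.1, ObjectProperty.hom_ext _ l.2⟩

omit hC in
theorem hasZeroObject : HasZeroObject (Be C P) :=
  ⟨⟨FilteredModule.zero P, isBetti_of_hasLocalFrames hasLocalFrames_zero⟩,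
    (IsZero.iff_id_eq_zero _).2 (ObjectProperty.hom_ext _ zero_id)⟩

variable (X Y) in
/-- The direct sum of two objects. -/
def prodBicone : BinaryBicone X Y where
  pt := ⟨FilteredModule.prod X.obj Y.obj, isBetti_of_hasLocalFrames
    ((X.property.hasLocalFrames hC).prod (Y.property.hasLocalFrames hC))⟩
  fst := ObjectProperty.homMk (FilteredModule.prodBicone X.obj Y.obj).fst
  snd := ObjectProperty.homMk (FilteredModule.prodBicone X.obj Y.obj).snd
  inl := ObjectProperty.homMk (FilteredModule.prodBicone X.obj Y.obj).inl
  inr := ObjectProperty.homMk (FilteredModule.prodBicone X.obj Y.obj).inr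
  inl_fst := ObjectProperty.hom_ext _ (FilteredModule.prodBicone X.obj Y.obj).inl_fst
  inl_snd := ObjectProperty.hom_ext _ (FilteredModule.prodBicone X.obj Y.obj).inl_snd
  inr_fst := ObjectProperty.hom_ext _ (FilteredModule.prodBicone X.obj Y.obj).inr_fst
  inr_snd := ObjectProperty.hom_ext _ (FilteredModule.prodBicone X.obj Y.obj).inr_snd

theorem hasBinaryBiproducts : HasBinaryBiproducts (Be C P) :=
  ⟨fun X Y => ⟨⟨prodBicone hC X Y, isBinaryBilimitOfTotal _
    (ObjectProperty.hom_ext _ prodBicone_total)⟩⟩⟩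

theorem hasFiniteProducts : HasFiniteProducts (Be C P) :=
  have := hasZeroObject (P := P) (C := C)
  have := hasBinaryBiproducts hC
  hasFiniteProducts_of_has_binary_and_terminal

/-- The category `Be_{C,μ}` is abelian. -/
abbrev abelian : Abelian (Be C P) where
  normalMonoOfMono f _ := ⟨normalMono hC f⟩
  normalEpiOfEpi f _ := ⟨normalEpi hC f⟩
  has_finite_products := hasFiniteProducts hC
  has_kernels := ⟨fun f => ⟨⟨⟨_, isLimitKer hC f⟩⟩⟩⟩
  has_cokernels := ⟨fun f => ⟨⟨⟨_, isColimitCoker hC f⟩⟩⟩⟩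

end Be

end

end BettiStokes

end

theorem theorem3p7 {L : Type*} [AddCommGroup L] [Module.Free ℤ L] [Module.Finite ℤ L]
    (P : BettiStokes.PeriodMap L) (C : Finset ℂ)
    (hC : ∀ c ∈ C, ∀ c' ∈ C, c ≠ c' → ∀ γ : L, c ≠ c' + P.μ γ) :
    Nonempty (CategoryTheory.Abelian (BettiStokes.Be C P)) := ⟨BettiStokes.Be.abelian hC⟩
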